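/- **Setting.** Let $d\ge 1$, $\lambda>0$, $\theta>0$. Let $D\subset\mathbb R^d$ be a bounded open set, star-shaped about the origin, containing the origin, with continuous boundary, and let $n_D$ be its (continuous) gauge function. Let $f$ be a positive continuous probability density on $\mathbb R^d$ with $f(z)\sim f_*(n_D(z))$ as $\|z\|\to\infty$, where $f_*(r)=L(r)/r^{\lambda+d}$ is continuous and decreasing on $[0,\infty)$ and $L$ is slowly varying. Assume that all univariate marginals of $f$ are equal to one positive continuous symmetric density $f_0$ with distribution function $F_0$. Let $g_0$ be a positive continuous symmetric density on $\mathbb R$ with distribution function $G_0$ and $g_0(s)\sim e^{-\psi(s)}$ as $s\to\infty$, where (near infinity) $\psi$ is $C^2$ with $\psi'>0$, $\psi(s)\to\infty$, $(1/\psi')'(s)\to 0$, and $\psi$ is regularly varying at infinity with exponent $\theta$. Put $K_0=F_0^{-1}\circ G_0$ and $K(x)=(K_0(x_1),\dots,K_0(x_d))$, and let $g$ be the meta density, i.e. a density of the distribution function $F\circ K$, where $F$ is the distribution function of $f$. Define $$h(w)=n_D(w)^{-(\lambda+d)}\ (w\ne0),\qquad E_{\lambda,\theta}=\{u\in\mathbb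 R^d: |u_1|^\theta+\dots+|u_d|^\theta+\lambda\ge(\lambda+d)\|u\|_\infty^\theta\}.$$ Let the constants $c_n>0$ satisfy $n(1-F_0(c_n))\to\int_{\{w_i\ge1\}}h(w)\,dw$ for some coordinate $i$ (the integral is the same for all $i$; if $D$ is scaled so that it equals $1$, this says $1-F_0(c_n)\sim1/n$), and let $r_n>0$ satisfy $r_n\to\infty$ and $\psi(r_n)\sim\log n$. **Partitions.** A partition $(A_n)$ of $\mathbb R^d$ into Borel sets is *regular* if (1) each $A_n$ is bounded with positive volume; (2) every compact set is covered by finitely many $A_n$; (3) there are points $p_n\in A_n$, $p_n\neq0$, such that for every $\varepsilon>0$ the set $A_n$ lies in the open ball of radius $\varepsilon\|p_n\|$ about $p_n$ for all large $n$. A *block partition* is built on cubes $[-s_k,s_k]^d$ with $0<s_0<s_1<\cdots$, $s_k\to\infty$: for each $k$ choose division points $0<s_{k1}<\dots<s_{km_k}=s_k<s_{k,m_k+1}=s_{k+1}$ with $m_k\ge1$; the points $\pm s_{kj}$ $(1\le j\le m_k+1)$ in each coordinate divide $[-s_{k+1},s_{k+1}]^d$ into $(2m_k+1)^d$ blocks,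 and those not contained in $[-s_k,s_k]^d$ are atoms of the partition; the initial cube $[-s_0,s_0]^d$ is divided into coordinate blocks in an arbitrary way. Boundary points of blocks may be allotted to the atoms in any way that yields a Borel partition, and the atoms may be enumerated in any order. **Convergence.** For independent observations $Y_1,Y_2,\dots$ from a distribution and constants $a_n>0$, the sample cloud scaled by $a_n$ is the point process $N_n=\{Y_1/a_n,\dots,Y_n/a_n\}$. The sample clouds *converge to a Poisson point process* $N$ if $N_n\to N$ in distribution, weakly on the complement of centered balls: for every $\varepsilon>0$ and every bounded continuous $\varphi$ the integrals $\int_{\|w\|\ge\varepsilon}\varphi\,dN_n$ converge in distribution to $\int_{\|w\|\ge\varepsilon}\varphi\,dN$. They *converge onto* the compact set $E$ if $\mathbb P\{N_n(U^c)>0\}\to0$ for every open $U\supseteq E$, and $\mathbb P\{N_n(B(p,\varepsilon))>m\}\to1$ for all $p\in E$, $\varepsilon>0$ and integers $m\ge1$, where $B(p,\varepsilon)$ is the open ball. **Theorem.** Let $(A_n)$ be a block partition in $x$-space and $B_n=K(A_n)$ its image in $z$-space, and suppose that both partitions are regular. Let $\tilde\mu$ be a probability measure on $x$-space and $\tilde\pi=K(\tilde\mu)$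 its image under $K$. Then $$\tilde\pi(B_n)\sim\int_{B_n}f(z)\,dz\quad\Longleftrightarrow\quad\tilde\mu(A_n)\sim\int_{A_n}g(x)\,dx\qquad(n\to\infty),$$ and if one of these equivalent relations holds, then the sample clouds from $\tilde\pi$ scaled by $c_n$ converge to the Poisson point process on $\mathbb R^d\setminus\{0\}$ with intensity $h$, and the sample clouds from $\tilde\mu$ scaled by $r_n$ converge onto the compact set $E_{\lambda,\theta}$. -/

import Mathlib

open MeasureTheory ProbabilityTheory Filter Topology Set

open scoped ENNReal NNReal

noncomputable section

/-! ### Densities, distribution functions, regular variation -/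

/-- A positive continuous probability density. -/
structure IsPosContDensity {α : Type*} [TopologicalSpace α] [MeasureSpace α] (p : α → ℝ) :
    Prop where
  continuous : Continuous p
  pos : ∀ x, 0 < p x
  lintegral_eq_one : ∫⁻ x, ENNReal.ofReal (p x) = 1

/-- The measure with (Lebesgue) density `p`. -/
def densityMeasure {α : Type*} [MeasureSpace α] (p : α → ℝ) : Measure α :=
  volume.withDensity fun x => ENNReal.ofReal (p x)

/-- The univariate distribution function of the density `p` on the line. -/
def dfOf (p : ℝ → ℝ) (t : ℝ) : ℝ := ∫ s in Iic t, p s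

/-- `u` varies regularly at infinity with exponent `α`. -/
def VariesRegularly (u : ℝ → ℝ) (α : ℝ) : Prop :=
  (∀ᶠ t in atTop, 0 < u t) ∧ ∀ x : ℝ, 0 < x → Tendsto (fun t => u (x * t) / u t) atTop (𝓝 (x ^ α))

/-- `u` varies slowly at infinity. -/
def VariesSlowly (u : ℝ → ℝ) : Prop := VariesRegularly u 0

/-! ### Heavy-tailed densities and light-tailed marginals -/

/-- `D` is a bounded open star-shaped set which contains the origin and has a continuous boundary,
i.e. the distance from the origin to the boundary in a given direction depends continuously on the
direction; for such a set this says that the gauge function `n_D` is continuous. -/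
structure IsShape {d : ℕ} (D : Set (EuclideanSpace ℝ (Fin d))) : Prop where
  isBounded : Bornology.IsBounded D
  isOpen : IsOpen D
  zero_mem : 0 ∈ D
  starConvex : StarConvex ℝ 0 D
  continuous_gauge : Continuous (gauge D)

/-- `f` is a density in the class `F_lam`, with shape `D`: it is positive and continuous, and
asymptotic to `f_* (n_D z)` for `‖z‖ → ∞`, where `f_* r = L r / r ^ (lam + d)` is continuous and
decreasing on `[0, ∞)` and `L` varies slowly. -/
structure IsHeavyTailedDensity {d : ℕ} (lam : ℝ) (D : Set (EuclideanSpace ℝ (Fin d)))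
    (f : EuclideanSpace ℝ (Fin d) → ℝ) : Prop where
  density : IsPosContDensity f
  shape : IsShape D
  asymp : ∃ fstar : ℝ → ℝ, ContinuousOn fstar (Ici 0) ∧ AntitoneOn fstar (Ici 0) ∧
    VariesSlowly (fun r => fstar r * r ^ (lam + (d : ℝ))) ∧
    Asymptotics.IsEquivalent (Bornology.cobounded (EuclideanSpace ℝ (Fin d)))
      f (fun z => fstar (gauge D z))

/-- `e^{-ψ}` is a von Mises function: near infinity `ψ` is `C²` with positive derivative,
`ψ → ∞`, and the scale function `a = 1 / ψ'` has a derivative which tends to zero. -/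
structure IsVonMises (ψ : ℝ → ℝ) : Prop where
  smooth : ∃ s₀ : ℝ, ContDiffOn ℝ 2 ψ (Ioi s₀) ∧ ∀ s, s₀ < s → 0 < deriv ψ s
  tendsto_atTop : Tendsto ψ atTop atTop
  deriv_scale : Tendsto (deriv fun s => 1 / deriv ψ s) atTop (𝓝 0)

/-! ### The meta transformation and the meta density -/

/-- The univariate component `K₀ = F₀⁻¹ ∘ G₀` of the meta transformation, where `F₀` and `G₀` are
the distribution functions of the densities `f0` and `g0`, and `F₀⁻¹` is the quantile function. -/
def metaComponent (f0 g0 : ℝ → ℝ) (s : ℝ) : ℝ := sInf {t : ℝ | dfOf g0 s ≤ dfOf f0 t}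

/-- The meta transformation `K (x₁, …, x_d) = (K₀ x₁, …, K₀ x_d)` from `x`-space to `z`-space. -/
def metaMap {d : ℕ} (f0 g0 : ℝ → ℝ) (x : EuclideanSpace ℝ (Fin d)) : EuclideanSpace ℝ (Fin d) :=
  WithLp.toLp 2 fun i => metaComponent f0 g0 (x i)

/-- `g` is a density of the meta distribution `G = F ∘ K`, where `F` is the distribution function
of the density `f`. -/
structure IsMetaDensity {d : ℕ} (f0 g0 : ℝ → ℝ) (f g : EuclideanSpace ℝ (Fin d) → ℝ) :
    Prop where
  measurable : Measurable g
  nonneg : ∀ x, 0 ≤ g x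
  df_eq : ∀ x : EuclideanSpace ℝ (Fin d),
    densityMeasure g {y | ∀ i, y i ≤ x i} = densityMeasure f {z | ∀ i, z i ≤ metaMap f0 g0 x i}

/-- The standard set-up, with equal marginals: the density `f` lies in the class `F_lam` with shape
`D`; all its marginal densities are equal to the positive continuous symmetric density `f0`;
`g0` is a positive continuous symmetric density on the line, asymptotic to a von Mises
function `e^{-ψ}` with `ψ` regularly varying with exponent `θ`; and `g` is the meta density with
marginals `g0` based on `f`. -/
structure StandardSetup {d : ℕ} (lam θ : ℝ) (D : Set (EuclideanSpace ℝ (Fin d)))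
    (f g : EuclideanSpace ℝ (Fin d) → ℝ) (f0 g0 ψ : ℝ → ℝ) : Prop where
  lam_pos : 0 < lam
  theta_pos : 0 < θ
  heavy : IsHeavyTailedDensity lam D f
  f0_density : IsPosContDensity f0
  f0_symm : ∀ t, f0 (-t) = f0 t
  f0_marginal : ∀ i : Fin d, (densityMeasure f).map (fun z => z i) = densityMeasure f0
  g0_density : IsPosContDensity g0
  g0_symm : ∀ s, g0 (-s) = g0 s
  vonMises : IsVonMises ψ
  psi_varies : VariesRegularly ψ θ
  g0_asymp : Asymptotics.IsEquivalent atTop g0 (fun s => Real.exp (-ψ s))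
  metaDensity : IsMetaDensity f0 g0 f g

/-! ### Partitions -/

/-- A partition of `ℝ^d` into countably many Borel sets. -/
structure IsBorelPartition {d : ℕ} (A : ℕ → Set (EuclideanSpace ℝ (Fin d))) : Prop where
  measurable : ∀ n, MeasurableSet (A n)
  disjoint : Pairwise (Function.onFun Disjoint A)
  cover : ⋃ n, A n = univ

/-- Regular partitions: the atoms are bounded with positive volume, every compact set is covered by
finitely many of them, and they are relatively small. -/
structure IsRegularPartition {d : ℕ} (A : ℕ → Set (EuclideanSpace ℝ (Fin d))) : Prop where
  partition : IsBorelPartition A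
  isBounded : ∀ n, Bornology.IsBounded (A n)
  volume_pos : ∀ n, 0 < volume (A n)
  compact_cover : ∀ C : Set (EuclideanSpace ℝ (Fin d)), IsCompact C →
    ∃ t : Finset ℕ, C ⊆ ⋃ n ∈ t, A n
  small : ∃ p : ℕ → EuclideanSpace ℝ (Fin d), (∀ n, p n ∈ A n) ∧ (∀ n, 0 < ‖p n‖) ∧
    ∀ ε : ℝ, 0 < ε → ∀ᶠ n in atTop, A n ⊆ Metric.ball (p n) (ε * ‖p n‖)

/-- The closed coordinate block with corners `a` and `b`. -/
def closedBlock {d : ℕ} (a b : Fin d → ℝ) : Set (EuclideanSpace ℝ (Fin d)) :=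
  {x | ∀ i, x i ∈ Icc (a i) (b i)}

/-- The open coordinate block with corners `a` and `b`. -/
def openBlock {d : ℕ} (a b : Fin d → ℝ) : Set (EuclideanSpace ℝ (Fin d)) :=
  {x | ∀ i, x i ∈ Ioo (a i) (b i)}

/-- The cube `sC = [-s, s]^d`. -/
def closedCube (d : ℕ) (s : ℝ) : Set (EuclideanSpace ℝ (Fin d)) :=
  closedBlock (fun _ => -s) fun _ => s

/-- `[a, b]` is one of the `2m + 1` intervals cut out of `[-σ (m+1), σ (m+1)]` by the symmetric
division points `±σ 1, …, ±σ m`. -/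
def IsGridInterval (σ : ℕ → ℝ) (m : ℕ) (a b : ℝ) : Prop :=
  (a = -σ 1 ∧ b = σ 1) ∨
  ∃ j, 1 ≤ j ∧ j ≤ m ∧ ((a = σ j ∧ b = σ (j + 1)) ∨ (a = -σ (j + 1) ∧ b = -σ j))

/-- Block partitions. There are cubes `s₀C ⊂ s₁C ⊂ ⋯` with `s k → ∞` and, for each `k`, division
points `0 < σ k 1 < ⋯ < σ k (m k) = s k < σ k (m k + 1) = s (k + 1)`. Each atom is, up to boundary
points, a coordinate block; this block lies in the initial cube (whose subdivision into blocks is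
arbitrary), or it is one of the blocks of the `k`-th grid on `s (k + 1) C` which form the ring
between `s k C` and `s (k + 1) C`. Boundary points may be allotted to the atoms in any way. -/
def IsBlockPartition {d : ℕ} (A : ℕ → Set (EuclideanSpace ℝ (Fin d))) : Prop :=
  IsBorelPartition A ∧
  ∃ (s : ℕ → ℝ) (m : ℕ → ℕ) (σ : ℕ → ℕ → ℝ),
    0 < s 0 ∧ StrictMono s ∧ Tendsto s atTop atTop ∧
    (∀ k, 1 ≤ m k ∧ 0 < σ k 1 ∧ StrictMonoOn (σ k) (Icc 1 (m k + 1)) ∧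
      σ k (m k) = s k ∧ σ k (m k + 1) = s (k + 1)) ∧
    ∀ n, ∃ a b : Fin d → ℝ, (∀ i, a i < b i) ∧ openBlock a b ⊆ A n ∧ A n ⊆ closedBlock a b ∧
      (closedBlock a b ⊆ closedCube d (s 0) ∨
        ∃ k, (∀ i, IsGridInterval (σ k) (m k) (a i) (b i)) ∧
          ¬ closedBlock a b ⊆ closedCube d (s k))

/-! ### Sample clouds and their convergence -/

/-- The scaled `n`-point sample cloud `{Z₁ / c, …, Z_n / c}`, as a counting measure: `sampleCloud Z c
n ω B` is the number of scaled sample points in `B`. -/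
def sampleCloud {d : ℕ} {Ω : Type*} (Z : ℕ → Ω → EuclideanSpace ℝ (Fin d)) (c : ℕ → ℝ) (n : ℕ)
    (ω : Ω) : Measure (EuclideanSpace ℝ (Fin d)) :=
  ∑ k ∈ Finset.range n, Measure.dirac ((c n)⁻¹ • Z k ω)

/-- `Z 0, Z 1, …` are independent observations from the distribution `ν`. -/
structure IsSample {d : ℕ} {Ω : Type*} [MeasurableSpace Ω] (P : Measure Ω)
    (Z : ℕ → Ω → EuclideanSpace ℝ (Fin d)) (ν : Measure (EuclideanSpace ℝ (Fin d))) : Prop where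
  hasLaw : ∀ k, HasLaw (Z k) ν P
  indep : iIndepFun Z P

/-- `N` is a Poisson point process with mean measure `ρ`: a random measure such that `N A` is
Poisson distributed with expectation `ρ A` if this is finite, and such that the numbers of points
in disjoint sets are independent. -/
structure IsPoissonProcess {E : Type*} [MeasurableSpace E] {Ω : Type*} [MeasurableSpace Ω]
    (P : Measure Ω) (N : Ω → Measure E) (ρ : Measure E) : Prop where
  measurable : Measurable N
  poisson : ∀ A : Set E, MeasurableSet A → ρ A ≠ ∞ →
    P.map (fun ω => N ω A) = (poissonMeasure (ρ A).toNNReal).map (fun k : ℕ => (k : ℝ≥0∞))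
  indep : ∀ (k : ℕ) (A : Fin k → Set E), (∀ j, MeasurableSet (A j)) →
    Pairwise (Function.onFun Disjoint A) → iIndepFun (fun j ω => N ω (A j)) P

/-- The point processes `Nn n` converge to `N` in distribution, weakly on the complement of centered
balls: for every centered ball and every bounded continuous `φ`, the integral of `φ` over the
complement of the ball with respect to `Nn n` converges in distribution to the one with respect
to `N`. (By linearity in `φ` this contains the joint convergence of finitely many integrals.) -/
def ConvergesOffBalls {d : ℕ} {Ω Ω' : Type*} [MeasurableSpace Ω] [MeasurableSpace Ω']
    (P : Measure Ω) [IsProbabilityMeasure P] (Nn : ℕ → Ω → Measure (EuclideanSpace ℝ (Fin d)))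
    (P' : Measure Ω') [IsProbabilityMeasure P'] (N : Ω' → Measure (EuclideanSpace ℝ (Fin d))) :
    Prop :=
  ∀ (ε : ℝ), 0 < ε → ∀ φ : BoundedContinuousFunction (EuclideanSpace ℝ (Fin d)) ℝ,
    TendstoInDistribution (fun n ω => ∫ w in (Metric.ball 0 ε)ᶜ, φ w ∂(Nn n ω)) atTop
      (fun ω' => ∫ w in (Metric.ball 0 ε)ᶜ, φ w ∂(N ω')) (fun _ => P) P'

/-- The point processes `Nn n` converge onto the compact set `E`. -/
structure ConvergesOnto {d : ℕ} {Ω : Type*} [MeasurableSpace Ω] (P : Measure Ω)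
    (Nn : ℕ → Ω → Measure (EuclideanSpace ℝ (Fin d))) (E : Set (EuclideanSpace ℝ (Fin d))) :
    Prop where
  isCompact : IsCompact E
  outside : ∀ U : Set (EuclideanSpace ℝ (Fin d)), IsOpen U → E ⊆ U →
    Tendsto (fun n => P {ω | 0 < Nn n ω Uᶜ}) atTop (𝓝 0)
  inside : ∀ p ∈ E, ∀ ε : ℝ, 0 < ε → ∀ m : ℕ, 1 ≤ m →
    Tendsto (fun n => P {ω | (m : ℝ≥0∞) < Nn n ω (Metric.ball p ε)}) atTop (𝓝 1)

/-- The limit intensity `h w = 1 / n_D(w) ^ (lam + d)`. -/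
def limitIntensity {d : ℕ} (lam : ℝ) (D : Set (EuclideanSpace ℝ (Fin d)))
    (w : EuclideanSpace ℝ (Fin d)) : ℝ :=
  1 / gauge D w ^ (lam + (d : ℝ))

/-- The limit set `E_{lam,θ} = {u | |u₁|^θ + ⋯ + |u_d|^θ + lam ≥ (lam + d) ‖u‖_∞^θ}`; the norm of
`Fin d → ℝ` is the sup norm. -/
def limitSet (d : ℕ) (lam θ : ℝ) : Set (EuclideanSpace ℝ (Fin d)) :=
  {u | (lam + (d : ℝ)) * ‖(WithLp.ofLp u : Fin d → ℝ)‖ ^ θ ≤ ∑ i, |u i| ^ θ + lam}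

end

open MeasureTheory ProbabilityTheory Filter Topology Set

open scoped ENNReal NNReal

noncomputable section

/-! ### Regular variation -/

/-! The equivalence is a change of variables. `K` is a coordinatewise increasing bijection and
carries the measure with density `g` to the one with density `f` (`IsMetaDensity.map_metaMap`: both
agree on orthants). Hence `A n` and `B n` have equal masses both for the pair `muT`, `piT` and for
the pair `g`, `f`, and the two asymptotic relations are the same relation.

Both limits hold for samples from `f` and `g` themselves and are transferred through
`IsRegularPartition.eventually_measure_le`. For large `t` the atoms that meet a scaled set `t S`,
with `S` away from the origin, have small diameter relative to their norm and stay in `t S'` for a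
relative neighbourhood `S'` of `S`. A comparison of two measures on atoms, with a factor `C > 1`
close to `1`, therefore becomes a comparison on scaled sets.

Poisson limit. Regular variation gives `f (t w) / fstar t → h w`, with an integrable majorant from a
Potter bound, so `n` times the `f`-mass of `c n S` tends to the integral of `h` over `S`. The
comparison and a portmanteau argument give weak convergence of the mean measures of the clouds from
`piT` off balls. The characteristic function of an integral of `φ` over the cloud is `(1 + a n / n)
^ n`, where `a n` is the integral of `exp (i t φ) - 1` against the mean measure. It tends to the
exponential of the limit of `a n`, which is the characteristic function for the Poisson process;
Lévy's continuity theorem concludes.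

Convergence onto the limit set. Only logarithmic orders matter. Since `1 - F₀ t = t ^ (-lam +
o(1))`, `1 - G₀ s = exp (-(1 + o(1)) ψ s)` and `ψ (r n s) ~ s ^ θ log n`, one finds `K₀ (r n s) = n
^ (s ^ θ / lam + o(1))`. A small cube about `u`, scaled by `r n`, is mapped by `K` to a box of
volume about `n ^ (∑ |u i| ^ θ / lam)` on which `f` is about `n ^ (-(lam + d) ‖u‖_∞ ^ θ / lam)`. The
expected number of sample points in it is thus `n` to the power `(∑ |u i| ^ θ + lam - (lam + d)
‖u‖_∞ ^ θ) / lam`, up to a small error (`tendsto_box_zero`, `tendsto_box_atTop`). The sign of this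
exponent decides membership of the limit set. -/

/-- Writing `x = 2 ^ k * y` with `1 ≤ y ≤ 2`, the `k` doublings cost `(2 ^ γ) ^ k = (x / y) ^ γ`,
and `2 ^ |γ|` absorbs `y ^ (-γ)` for either sign of `γ`. This elementary bound takes the place of
Karamata's representation. -/
theorem le_rpow_mul_of_doubling {u : ℝ → ℝ} {T γ : ℝ} (hT : 0 < T)
    (hu : ∀ t, T ≤ t → u (2 * t) ≤ 2 ^ γ * u t) {t M : ℝ} (ht : T ≤ t) (hM : 0 ≤ M)
    (hb : ∀ y ∈ Icc (1 : ℝ) 2, u (y * t) ≤ M) {x : ℝ} (hx : 1 ≤ x) :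
    u (x * t) ≤ 2 ^ |γ| * x ^ γ * M := by
  obtain ⟨k, hk1, hk2⟩ := exists_nat_pow_near hx (one_lt_two)
  have h2k : (0 : ℝ) < 2 ^ k := by positivity
  set y : ℝ := x / 2 ^ k with hy
  have hy1 : 1 ≤ y := by rw [hy, le_div_iff₀ h2k]; simpa using hk1
  have hy2 : y ≤ 2 := by
    rw [hy, div_le_iff₀ h2k]; rw [pow_succ] at hk2; linarith
  have hxy : x = 2 ^ k * y := by rw [hy]; field_simp
  have key : ∀ j : ℕ, u (2 ^ j * (y * t)) ≤ (2 ^ γ) ^ j * M := by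
    intro j
    induction j with
    | zero => simpa using hb y ⟨hy1, hy2⟩
    | succ j ih =>
      have h1 : T ≤ 2 ^ j * (y * t) := by
        have : 1 ≤ (2 : ℝ) ^ j * y := by
          have : (1 : ℝ) ≤ 2 ^ j := one_le_pow₀ (by norm_num)
          nlinarith
        nlinarith
      have h2 := hu _ h1
      calc u (2 ^ (j + 1) * (y * t)) = u (2 * (2 ^ j * (y * t))) := by ring_nf
        _ ≤ 2 ^ γ * u (2 ^ j * (y * t)) := h2
        _ ≤ 2 ^ γ * ((2 ^ γ) ^ j * M) := by gcongr
        _ = (2 ^ γ) ^ (j + 1) * M := by ring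
  have h3 : ((2 : ℝ) ^ γ) ^ k ≤ 2 ^ |γ| * x ^ γ := by
    have e1 : ((2 : ℝ) ^ γ) ^ k = (2 ^ k : ℝ) ^ γ := by
      rw [← Real.rpow_natCast, ← Real.rpow_mul (by norm_num), mul_comm, Real.rpow_mul (by norm_num),
        Real.rpow_natCast]
    have hy0 : 0 < y := by linarith
    rw [e1, hxy, Real.mul_rpow h2k.le hy0.le]
    have h4 : 1 ≤ (2 : ℝ) ^ |γ| * y ^ γ := by
      have : y ^ (-γ) ≤ 2 ^ |γ| := by
        calc y ^ (-γ) ≤ y ^ |γ| := Real.rpow_le_rpow_of_exponent_le hy1 (neg_le_abs γ)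
          _ ≤ 2 ^ |γ| := Real.rpow_le_rpow hy0.le hy2 (abs_nonneg _)
      calc (1 : ℝ) = y ^ (-γ) * y ^ γ := by rw [← Real.rpow_add hy0]; simp
        _ ≤ _ := by gcongr
    have h5 : 0 < ((2 : ℝ) ^ k) ^ γ := by positivity
    nlinarith
  calc u (x * t) = u (2 ^ k * (y * t)) := by rw [hxy]; ring_nf
    _ ≤ (2 ^ γ) ^ k * M := key k
    _ ≤ _ := by gcongr

theorem VariesRegularly.eventually_doubling_le {u : ℝ → ℝ} {γ γ' : ℝ} (hu : VariesRegularly u γ)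
    (h : γ < γ') : ∀ᶠ t in atTop, u (2 * t) ≤ 2 ^ γ' * u t := by
  have h1 := hu.2 2 two_pos
  have h2 : (2 : ℝ) ^ γ < 2 ^ γ' := Real.rpow_lt_rpow_of_exponent_lt one_lt_two h
  filter_upwards [h1.eventually_lt_const h2, hu.1] with t ht ht0
  exact ((div_lt_iff₀ ht0).1 ht).le

theorem VariesRegularly.inv {u : ℝ → ℝ} {γ : ℝ} (hu : VariesRegularly u γ) :
    VariesRegularly (fun t => (u t)⁻¹) (-γ) := by
  refine ⟨hu.1.mono fun t ht => inv_pos.2 ht, fun x hx => ?_⟩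
  have := (hu.2 x hx).inv₀ (Real.rpow_pos_of_pos hx γ).ne'
  rw [Real.rpow_neg hx.le]
  refine this.congr fun t => ?_
  simp [div_eq_mul_inv, mul_comm]

/-- A regularly varying function which is locally bounded near infinity has upper logarithmic
order at most its index. -/
theorem VariesRegularly.eventually_log_le {u : ℝ → ℝ} {γ γ' : ℝ} (hu : VariesRegularly u γ)
    (hb : ∀ᶠ T in atTop, BddAbove (u '' Icc T (2 * T))) (h : γ < γ') :
    ∀ᶠ t in atTop, Real.log (u t) / Real.log t < γ' := by
  -- The power bound is proved with `γ₁ < γ'`; the gap swallows its multiplicative constant after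
  -- division by `log t`.
  obtain ⟨γ₁, h1, h2⟩ := exists_between h
  obtain ⟨T, hT⟩ := eventually_atTop.1 ((hu.eventually_doubling_le h1).and
    (hb.and (hu.1.and (eventually_ge_atTop 1))))
  have hT1 : 1 ≤ T := (hT T le_rfl).2.2.2
  have hT0 : 0 < T := by linarith
  obtain ⟨M, hM⟩ := (hT T le_rfl).2.1
  have hM' : ∀ y ∈ Icc (1 : ℝ) 2, u (y * T) ≤ max M 1 := fun y hy =>
    le_max_of_le_left (hM ⟨y * T, ⟨by nlinarith [hy.1], by nlinarith [hy.2]⟩, rfl⟩)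
  have key : ∀ t, T ≤ t → u t ≤ 2 ^ |γ₁| * (t / T) ^ γ₁ * max M 1 := fun t ht => by
    have := le_rpow_mul_of_doubling hT0 (fun t ht => (hT t ht).1) le_rfl
      (by positivity) hM' (x := t / T) (by rwa [le_div_iff₀ hT0, one_mul])
    rwa [div_mul_cancel₀ _ hT0.ne'] at this
  set C : ℝ := Real.log (2 ^ |γ₁| * max M 1) - γ₁ * Real.log T with hC
  have lim : Tendsto (fun t => C / Real.log t + γ₁) atTop (𝓝 (0 + γ₁)) :=
    (Real.tendsto_log_atTop.const_div_atTop C).add_const _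
  rw [zero_add] at lim
  filter_upwards [lim.eventually_lt_const h2, eventually_ge_atTop T, eventually_gt_atTop 1]
    with t ht htT ht1
  refine lt_of_le_of_lt ?_ ht
  have hl : 0 < Real.log t := Real.log_pos ht1
  have ht0 : 0 < t := by linarith
  have hm : (0 : ℝ) < max M 1 := by positivity
  have h3 := Real.log_le_log (hT t htT).2.2.1 (key t htT)
  rw [mul_right_comm, Real.log_mul (by positivity) (by positivity),
    Real.log_rpow (by positivity), Real.log_div ht0.ne' hT0.ne'] at h3
  rw [div_le_iff₀ hl, add_mul, div_mul_cancel₀ _ hl.ne']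
  linarith

/-- The lower bound is the upper bound for `1 / u`. Monotonicity serves only to bound `u` above and
away from zero on intervals `[T, 2T]`. -/
theorem VariesRegularly.tendsto_log_div_log {u : ℝ → ℝ} {γ : ℝ} (hu : VariesRegularly u γ)
    (hm : (∃ T, MonotoneOn u (Ici T)) ∨ ∃ T, AntitoneOn u (Ici T)) :
    Tendsto (fun t => Real.log (u t) / Real.log t) atTop (𝓝 γ) := by
  have hb : ∀ᶠ T in atTop, (∃ a, 0 < a ∧ ∀ t ∈ Icc T (2 * T), a ≤ u t) ∧
      BddAbove (u '' Icc T (2 * T)) := by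
    obtain ⟨T₀, hT₀⟩ := eventually_atTop.1 hu.1
    rcases hm with ⟨T₁, h⟩ | ⟨T₁, h⟩
    · filter_upwards [eventually_ge_atTop T₀, eventually_ge_atTop T₁, eventually_ge_atTop 0]
        with T h1 h2 h3
      refine ⟨⟨u T, hT₀ T h1, fun t ht => h h2 (h2.trans ht.1) ht.1⟩, u (2 * T), ?_⟩
      rintro _ ⟨t, ht, rfl⟩
      exact h (h2.trans ht.1) (show T₁ ≤ 2 * T by linarith) ht.2
    · filter_upwards [eventually_ge_atTop T₀, eventually_ge_atTop T₁, eventually_ge_atTop 0]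
        with T h1 h2 h3
      refine ⟨⟨u (2 * T), hT₀ _ (by linarith), fun t ht =>
        h (h2.trans ht.1) (show T₁ ≤ 2 * T by linarith) ht.2⟩, u T, ?_⟩
      rintro _ ⟨t, ht, rfl⟩
      exact h h2 (h2.trans ht.1) ht.1
  refine tendsto_order.2 ⟨fun a ha => ?_, fun b hb' => ?_⟩
  · have := hu.inv.eventually_log_le (γ' := -a) ?_ (by linarith)
    · filter_upwards [this] with t ht
      rw [Real.log_inv, neg_div] at ht
      linarith
    · filter_upwards [hb] with T hT
      obtain ⟨a, ha, h⟩ := hT.1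
      refine ⟨a⁻¹, ?_⟩
      rintro _ ⟨t, ht, rfl⟩
      exact inv_anti₀ ha (h t ht)
  · exact hu.eventually_log_le (hb.mono fun T hT => hT.2) hb'

/-- A Potter bound for eventually antitone functions. -/
theorem VariesRegularly.exists_potter_bound {u : ℝ → ℝ} {γ γ' : ℝ} (hu : VariesRegularly u γ)
    (hm : AntitoneOn u (Ici 0)) (h : γ < γ') {δ : ℝ} (hδ : 0 < δ) :
    ∃ C, 0 < C ∧ ∀ᶠ t in atTop, ∀ x, δ ≤ x → u (x * t) ≤ C * x ^ γ' * u t := by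
  obtain ⟨T, hT⟩ := eventually_atTop.1 ((hu.eventually_doubling_le h).and
    (hu.1.and (eventually_ge_atTop 1)))
  have hT1 : 1 ≤ T := (hT T le_rfl).2.2
  -- On `[δ, 1]` monotonicity gives `u (x * t) ≤ u (δ * t) ≤ C₁ * u t`; dividing by a lower bound
  -- `m` of `x ^ γ'` there puts the power back.
  obtain ⟨m, hm0, hm'⟩ : ∃ m : ℝ, 0 < m ∧ ∀ x ∈ Icc δ 1, m ≤ x ^ γ' := by
    refine ⟨min (δ ^ γ') 1, by positivity, fun x hx => ?_⟩
    have hx0 : 0 < x := hδ.trans_le hx.1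
    rcases le_total 0 γ' with h0 | h0
    · exact (min_le_left _ _).trans (Real.rpow_le_rpow hδ.le hx.1 h0)
    · exact (min_le_right _ _).trans (by
        simpa using Real.rpow_le_rpow_of_nonpos hx0 hx.2 h0)
  set C₁ := δ ^ γ + 1
  have hC₁ : 0 < C₁ := by positivity
  refine ⟨max (2 ^ |γ'|) (C₁ / m), by positivity, ?_⟩
  filter_upwards [eventually_ge_atTop T,
    (hu.2 δ hδ).eventually_lt_const (show δ ^ γ < C₁ by simp [C₁])] with t ht htδ x hx
  have hut : 0 < u t := (hT t ht).2.1
  have hx0 : 0 < x := hδ.trans_le hx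
  have ht0 : 0 < t := by linarith
  rcases le_total 1 x with h1 | h1
  · refine (le_rpow_mul_of_doubling (by linarith) (fun t ht => (hT t ht).1) ht hut.le ?_ h1).trans ?_
    · intro y hy
      exact hm ht0.le (show 0 ≤ y * t by nlinarith [hy.1]) (by nlinarith [hy.1])
    · gcongr
      exact le_max_left _ _
  · have h2 : u (x * t) ≤ u (δ * t) :=
      hm (show 0 ≤ δ * t by positivity) (show 0 ≤ x * t by positivity) (by gcongr)
    have h3 : u (δ * t) ≤ C₁ * u t := ((div_lt_iff₀ hut).1 htδ).le
    refine h2.trans (h3.trans ?_)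
    gcongr
    calc C₁ = C₁ / m * m := by field_simp
      _ ≤ _ := by
        gcongr
        · exact le_max_right _ _
        · exact hm' x ⟨hx, h1⟩

/-! ### Heavy-tailed densities -/

/-- `D` lies between two centered balls; the constants are the reciprocals of their radii. -/
theorem IsShape.exists_gauge_bounds {d : ℕ} {D : Set (EuclideanSpace ℝ (Fin d))} (hD : IsShape D) :
    ∃ a b : ℝ, 0 < a ∧ 0 < b ∧ ∀ w, a * ‖w‖ ≤ gauge D w ∧ gauge D w ≤ b * ‖w‖ := by
  obtain ⟨r, hr, hr'⟩ := Metric.isOpen_iff.1 hD.isOpen 0 hD.zero_mem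
  obtain ⟨R, hR, hR'⟩ := hD.isBounded.subset_closedBall_lt 0 0
  have habs : Absorbent ℝ D := absorbent_nhds_zero (hD.isOpen.mem_nhds hD.zero_mem)
  refine ⟨1 / R, 1 / r, by positivity, by positivity, fun w => ⟨?_, ?_⟩⟩
  · have := le_gauge_of_subset_closedBall habs hR.le hR' (x := w)
    rwa [one_div, inv_mul_eq_div]
  · have := mul_gauge_le_norm hr' (x := w)
    rw [one_div, inv_mul_eq_div, le_div_iff₀ hr]; linarith

theorem VariesSlowly.variesRegularly_of_mul_rpow {u : ℝ → ℝ} {α : ℝ}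
    (h : VariesSlowly fun r => u r * r ^ α) : VariesRegularly u (-α) := by
  refine ⟨?_, fun x hx => ?_⟩
  · filter_upwards [h.1, eventually_gt_atTop 0] with t ht ht0
    exact (pos_iff_pos_of_mul_pos ht).2 (Real.rpow_pos_of_pos ht0 _)
  · have h1 := (h.2 x hx).mul_const (x ^ (-α))
    rw [Real.rpow_zero, one_mul] at h1
    refine h1.congr' ?_
    filter_upwards [eventually_gt_atTop 0] with t ht
    have := Real.rpow_pos_of_pos ht α
    have := Real.rpow_pos_of_pos hx α
    rw [Real.mul_rpow hx.le ht.le, Real.rpow_neg hx.le]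
    field_simp

theorem limitIntensity_nonneg {d : ℕ} {lam : ℝ} {D : Set (EuclideanSpace ℝ (Fin d))}
    (w : EuclideanSpace ℝ (Fin d)) : 0 ≤ limitIntensity lam D w :=
  one_div_nonneg.2 (Real.rpow_nonneg (gauge_nonneg _) _)

theorem IsShape.measurable_limitIntensity {d : ℕ} {lam : ℝ} {D : Set (EuclideanSpace ℝ (Fin d))}
    (hD : IsShape D) : Measurable (limitIntensity lam D) := by
  have := hD.continuous_gauge.measurable
  unfold limitIntensity
  fun_prop

/-- Away from the origin `‖w‖` is comparable with `1 + ‖w‖`, so a negative power of the gauge is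
dominated by a power of `1 + ‖w‖`, which is integrable on the whole space when `β > d`. -/
theorem rpow_neg_le_of_le_norm {E : Type*} [NormedAddCommGroup E] {a ε β : ℝ}
    (ha : 0 < a) (hε : 0 < ε) (hβ : 0 ≤ β) {w : E} (hw : ε ≤ ‖w‖) {x : ℝ} (hx : a * ‖w‖ ≤ x) :
    x ^ (-β) ≤ (a * (ε / (1 + ε))) ^ (-β) * (1 + ‖w‖) ^ (-β) := by
  have h1 : ε / (1 + ε) * (1 + ‖w‖) ≤ ‖w‖ := by
    rw [div_mul_eq_mul_div, div_le_iff₀ (by positivity)]; nlinarith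
  rw [← Real.mul_rpow (by positivity) (by positivity)]
  refine Real.rpow_le_rpow_of_nonpos (by positivity) ?_ (by linarith)
  refine le_trans ?_ hx
  rw [mul_assoc]; gcongr

theorem IsShape.integrableOn_limitIntensity {d : ℕ} {lam : ℝ} (hlam : 0 < lam)
    {D : Set (EuclideanSpace ℝ (Fin d))} (hD : IsShape D) {ε : ℝ} (hε : 0 < ε)
    {S : Set (EuclideanSpace ℝ (Fin d))} (hS : MeasurableSet S) (hSε : ∀ w ∈ S, ε ≤ ‖w‖) :
    IntegrableOn (limitIntensity lam D) S := by
  obtain ⟨a, b, ha, hb, hab⟩ := hD.exists_gauge_bounds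
  have hI : Integrable (fun w : EuclideanSpace ℝ (Fin d) => (1 + ‖w‖) ^ (-(lam + (d : ℝ)))) :=
    integrable_one_add_norm (by simp [hlam])
  refine Integrable.mono' ((hI.const_mul ((a * (ε / (1 + ε))) ^ (-(lam + (d : ℝ))))).integrableOn)
    hD.measurable_limitIntensity.aestronglyMeasurable ?_
  filter_upwards [ae_restrict_mem hS] with w hw
  rw [Real.norm_of_nonneg (limitIntensity_nonneg w), limitIntensity, one_div,
    ← Real.rpow_neg (gauge_nonneg _)]
  exact rpow_neg_le_of_le_norm ha hε (by positivity) (hSε w hw) (hab w).1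

theorem IsShape.limitIntensity_pos {d : ℕ} {lam : ℝ} {D : Set (EuclideanSpace ℝ (Fin d))}
    (hD : IsShape D) {w : EuclideanSpace ℝ (Fin d)} (hw : w ≠ 0) : 0 < limitIntensity lam D w := by
  obtain ⟨a, b, ha, hb, hab⟩ := hD.exists_gauge_bounds
  have h1 : 0 < a * ‖w‖ := by positivity
  have : 0 < gauge D w := h1.trans_le (hab w).1
  unfold limitIntensity
  positivity

theorem densityMeasure_apply {α : Type*} [MeasureSpace α] (p : α → ℝ) {S : Set α}
    (hS : MeasurableSet S) : densityMeasure p S = ∫⁻ x in S, ENNReal.ofReal (p x) := by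
  rw [densityMeasure, withDensity_apply _ hS]

theorem densityMeasure_real_apply {α : Type*} [MeasureSpace α] {p : α → ℝ}
    (hp : ∀ x, 0 ≤ p x) (hm : Measurable p) {S : Set α} (hS : MeasurableSet S) :
    (densityMeasure p).real S = ∫ x in S, p x := by
  rw [integral_eq_lintegral_of_nonneg_ae (Eventually.of_forall hp) hm.aestronglyMeasurable,
    Measure.real, densityMeasure_apply p hS]

theorem IsPosContDensity.isProbabilityMeasure {α : Type*} [TopologicalSpace α] [MeasureSpace α]
    {p : α → ℝ} (hp : IsPosContDensity p) : IsProbabilityMeasure (densityMeasure p) :=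
  ⟨by rw [densityMeasure_apply p MeasurableSet.univ, setLIntegral_univ, hp.lintegral_eq_one]⟩

theorem measurableSet_preimage_smul {d : ℕ} {S : Set (EuclideanSpace ℝ (Fin d))}
    (hS : MeasurableSet S) (t : ℝ) : MeasurableSet {z | t • z ∈ S} :=
  (measurable_const_smul t) hS

open scoped Pointwise in
theorem IsPosContDensity.real_preimage_smul {d : ℕ} {f : EuclideanSpace ℝ (Fin d) → ℝ}
    (hf : IsPosContDensity f) {S : Set (EuclideanSpace ℝ (Fin d))} (hS : MeasurableSet S) {t : ℝ}
    (ht : 0 < t) : (densityMeasure f).real {z | t⁻¹ • z ∈ S} = t ^ d * ∫ w in S, f (t • w) := by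
  rw [densityMeasure_real_apply (fun z => (hf.pos z).le) hf.continuous.measurable
    (measurableSet_preimage_smul hS _), Measure.setIntegral_comp_smul_of_pos _ f S ht]
  have : {z | t⁻¹ • z ∈ S} = t • S := by
    ext z; exact (mem_smul_set_iff_inv_smul_mem₀ ht.ne' S z).symm
  rw [this]
  simp
  field_simp

section
variable {d : ℕ} {lam : ℝ} {D : Set (EuclideanSpace ℝ (Fin d))}
  {f : EuclideanSpace ℝ (Fin d) → ℝ} {fstar : ℝ → ℝ}

/-- `f` is asymptotic to the antitone regularly varying function `fstar` of the gauge. -/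
structure IsRadialTail (lam : ℝ) (D : Set (EuclideanSpace ℝ (Fin d)))
    (f : EuclideanSpace ℝ (Fin d) → ℝ) (fstar : ℝ → ℝ) : Prop where
  antitone : AntitoneOn fstar (Ici 0)
  varies : VariesRegularly fstar (-(lam + (d : ℝ)))
  equiv : Asymptotics.IsEquivalent (Bornology.cobounded (EuclideanSpace ℝ (Fin d)))
      f (fun z => fstar (gauge D z))

theorem IsHeavyTailedDensity.exists_isRadialTail (hf : IsHeavyTailedDensity lam D f) :
    ∃ fstar, IsRadialTail lam D f fstar := by
  obtain ⟨fstar, -, h2, h3, h4⟩ := hf.asymp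
  exact ⟨fstar, h2, h3.variesRegularly_of_mul_rpow, h4⟩

theorem tendsto_norm_smul_cobounded {w : EuclideanSpace ℝ (Fin d)} (hw : w ≠ 0) :
    Tendsto (fun t : ℝ => t • w) atTop (Bornology.cobounded (EuclideanSpace ℝ (Fin d))) := by
  rw [← tendsto_norm_atTop_iff_cobounded]
  have : Tendsto (fun t : ℝ => t * ‖w‖) atTop atTop :=
    tendsto_id.atTop_mul_const (norm_pos_iff.2 hw)
  refine this.congr' ?_
  filter_upwards [eventually_ge_atTop 0] with t ht
  rw [norm_smul, Real.norm_of_nonneg ht]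

theorem IsRadialTail.eventually_pos (hD : IsShape D) (h : IsRadialTail lam D f fstar) :
    ∀ᶠ z in Bornology.cobounded (EuclideanSpace ℝ (Fin d)), 0 < fstar (gauge D z) := by
  obtain ⟨a, b, ha, hb, hab⟩ := hD.exists_gauge_bounds
  have : Tendsto (gauge D) (Bornology.cobounded _) atTop :=
    tendsto_atTop_mono (fun w => (hab w).1) (tendsto_norm_cobounded_atTop.const_mul_atTop ha)
  exact this.eventually h.varies.1

/-- The quotient factors as `f (t w) / fstar (gauge D (t w))`, which tends to `1`, times `fstar
(gauge D w * t) / fstar t`, which is regular variation at the fixed ratio `gauge D w`. -/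
theorem IsRadialTail.tendsto_div (hD : IsShape D) (h : IsRadialTail lam D f fstar)
    {w : EuclideanSpace ℝ (Fin d)} (hw : w ≠ 0) :
    Tendsto (fun t => f (t • w) / fstar t) atTop (𝓝 (limitIntensity lam D w)) := by
  obtain ⟨a, b, ha, hb, hab⟩ := hD.exists_gauge_bounds
  have hg : 0 < gauge D w := lt_of_lt_of_le (by positivity) (hab w).1
  have h1 := (Asymptotics.isEquivalent_iff_tendsto_one
    ((h.eventually_pos hD).mono fun z hz => hz.ne')).1 h.equiv
  have h2 := (h1.comp (tendsto_norm_smul_cobounded hw)).mul (h.varies.2 _ hg)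
  rw [one_mul, Real.rpow_neg hg.le, ← one_div] at h2
  refine h2.congr' ?_
  filter_upwards [eventually_ge_atTop 0,
    (tendsto_norm_smul_cobounded hw).eventually (h.eventually_pos hD)] with t ht ht'
  have e : gauge D (t • w) = gauge D w * t := by
    rw [gauge_smul_of_nonneg ht, smul_eq_mul, mul_comm]
  simp only [Function.comp, Pi.div_apply]
  rw [e] at ht' ⊢
  field_simp

theorem IsRadialTail.eventually_le_two_mul (hD : IsShape D) (h : IsRadialTail lam D f fstar) :
    ∃ R, ∀ z, R ≤ ‖z‖ → f z ≤ 2 * fstar (gauge D z) ∧ fstar (gauge D z) ≤ 2 * f z := by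
  have h1 := (Asymptotics.isEquivalent_iff_tendsto_one
    ((h.eventually_pos hD).mono fun z hz => hz.ne')).1 h.equiv
  have h2 : ∀ᶠ z in Bornology.cobounded (EuclideanSpace ℝ (Fin d)),
      f z ≤ 2 * fstar (gauge D z) ∧ fstar (gauge D z) ≤ 2 * f z := by
    filter_upwards [h1.eventually_lt_const (show (1 : ℝ) < 2 by norm_num),
      h1.eventually_const_lt (show (1 / 2 : ℝ) < 1 by norm_num), h.eventually_pos hD] with z h2 h3 h4
    simp only [Pi.div_apply] at h2 h3
    rw [div_lt_iff₀ h4] at h2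
    rw [lt_div_iff₀ h4] at h3
    constructor <;> linarith
  rw [← comap_norm_atTop, eventually_comap] at h2
  obtain ⟨R, hR⟩ := eventually_atTop.1 h2
  exact ⟨R, fun z hz => hR _ hz z rfl⟩

/-- The majorant for dominated convergence. The exponent `lam / 2 + d` is below the index `lam + d`,
as the Potter bound requires, and above `d`, as integrability requires. -/
theorem IsRadialTail.exists_bound (hlam : 0 < lam) (hD : IsShape D)
    (h : IsRadialTail lam D f fstar) {ε : ℝ} (hε : 0 < ε) :
    ∃ C β : ℝ, (d : ℝ) < β ∧ ∀ᶠ t in atTop, ∀ w : EuclideanSpace ℝ (Fin d), ε ≤ ‖w‖ →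
      f (t • w) / fstar t ≤ C * (1 + ‖w‖) ^ (-β) := by
  obtain ⟨a, b, ha, hb, hab⟩ := hD.exists_gauge_bounds
  obtain ⟨R, hR⟩ := h.eventually_le_two_mul hD
  obtain ⟨C, hC, hC'⟩ := h.varies.exists_potter_bound h.antitone
    (show -(lam + (d : ℝ)) < -(lam / 2 + d) by linarith) (show 0 < a * ε by positivity)
  refine ⟨2 * (C * (a * (ε / (1 + ε))) ^ (-(lam / 2 + (d : ℝ)))), lam / 2 + d, by linarith, ?_⟩
  filter_upwards [hC', h.varies.1, eventually_ge_atTop (max 0 R / ε)] with t ht ht0 htR w hw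
  have htt : 0 ≤ t := le_trans (by positivity) htR
  have h1 : R ≤ ‖t • w‖ := by
    rw [norm_smul, Real.norm_of_nonneg htt]
    rw [div_le_iff₀ hε] at htR
    calc R ≤ max 0 R := le_max_right _ _
      _ ≤ t * ε := htR
      _ ≤ _ := by gcongr
  have h2 := (hR _ h1).1
  rw [gauge_smul_of_nonneg htt, smul_eq_mul, mul_comm t] at h2
  have h3 := ht (gauge D w) (le_trans (by gcongr) (hab w).1)
  have h4 := rpow_neg_le_of_le_norm ha hε (β := lam / 2 + d) (by positivity) hw (hab w).1
  rw [div_le_iff₀ ht0]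
  calc f (t • w) ≤ 2 * (C * gauge D w ^ (-(lam / 2 + (d : ℝ))) * fstar t) := by linarith
    _ ≤ 2 * (C * ((a * (ε / (1 + ε))) ^ (-(lam / 2 + (d : ℝ))) *
        (1 + ‖w‖) ^ (-(lam / 2 + (d : ℝ)))) * fstar t) := by gcongr
    _ = _ := by ring

theorem IsRadialTail.tendsto_setIntegral (hlam : 0 < lam) (hD : IsShape D)
    (hf : IsPosContDensity f) (h : IsRadialTail lam D f fstar) {ε : ℝ} (hε : 0 < ε)
    {S : Set (EuclideanSpace ℝ (Fin d))} (hS : MeasurableSet S) (hSε : ∀ w ∈ S, ε ≤ ‖w‖) :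
    Tendsto (fun t => ∫ w in S, f (t • w) / fstar t) atTop
      (𝓝 (∫ w in S, limitIntensity lam D w)) := by
  obtain ⟨C, β, hβ, hC⟩ := h.exists_bound hlam hD hε
  have hI : Integrable (fun w : EuclideanSpace ℝ (Fin d) => (1 + ‖w‖) ^ (-β)) :=
    integrable_one_add_norm (by simpa using hβ)
  refine tendsto_integral_filter_of_dominated_convergence (fun w => C * (1 + ‖w‖) ^ (-β))
    (Eventually.of_forall fun t => ?_) ?_ (hI.const_mul C).integrableOn ?_
  · exact ((hf.continuous.comp (continuous_const_smul t)).div_const _).aestronglyMeasurable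
  · filter_upwards [hC, h.varies.1] with t ht ht0
    filter_upwards [ae_restrict_mem hS] with w hw
    rw [Real.norm_of_nonneg (div_nonneg (hf.pos _).le ht0.le)]
    exact ht w (hSε w hw)
  · filter_upwards [ae_restrict_mem hS] with w hw
    exact h.tendsto_div hD (norm_pos_iff.1 (hε.trans_le (hSε w hw)))

theorem IsRadialTail.tendsto_real_div (hlam : 0 < lam) (hD : IsShape D)
    (hf : IsPosContDensity f) (h : IsRadialTail lam D f fstar) {ε : ℝ} (hε : 0 < ε)
    {S : Set (EuclideanSpace ℝ (Fin d))} (hS : MeasurableSet S) (hSε : ∀ w ∈ S, ε ≤ ‖w‖) :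
    Tendsto (fun t => (densityMeasure f).real {z | t⁻¹ • z ∈ S} / (t ^ d * fstar t)) atTop
      (𝓝 (∫ w in S, limitIntensity lam D w)) := by
  refine (h.tendsto_setIntegral hlam hD hf hε hS hSε).congr' ?_
  filter_upwards [eventually_gt_atTop 0, h.varies.1] with t ht ht0
  rw [hf.real_preimage_smul hS ht, integral_div]
  field_simp

theorem IsRadialTail.tendsto_log_div_log (h : IsRadialTail lam D f fstar) :
    Tendsto (fun t => Real.log (fstar t) / Real.log t) atTop (𝓝 (-(lam + (d : ℝ)))) :=
  h.varies.tendsto_log_div_log (Or.inr ⟨0, h.antitone⟩)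

/-- Power bounds for the density `f`. -/
theorem IsRadialTail.eventually_rpow_bounds (hD : IsShape D)
    (h : IsRadialTail lam D f fstar) {β β' : ℝ} (hβ : β < lam + (d : ℝ))
    (hβ' : lam + (d : ℝ) < β') :
    ∃ R, ∀ z, R ≤ ‖z‖ → f z ≤ ‖z‖ ^ (-β) ∧ ‖z‖ ^ (-β') ≤ f z := by
  obtain ⟨a, b, ha, hb, hab⟩ := hD.exists_gauge_bounds
  obtain ⟨R, hR⟩ := h.eventually_le_two_mul hD
  -- Constant factors inside and outside `fstar` do not change its logarithmic order, so the gauge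
  -- constants `a`, `b` and the factors `2`, `1 / 2` disappear in the gaps between `β`, `lam + d`
  -- and `β'`.
  have key : ∀ c : ℝ, 0 < c → ∀ k : ℝ, 0 < k →
      Tendsto (fun t => Real.log (k * fstar (c * t)) / Real.log t) atTop
        (𝓝 (-(lam + (d : ℝ)))) := by
    intro c hc k hk
    have h1 := h.varies.2 c hc
    have h2 : Tendsto (fun t => Real.log (k * (fstar (c * t) / fstar t)) / Real.log t) atTop (𝓝 0) := by
      refine Tendsto.div_atTop ?_ Real.tendsto_log_atTop (a := Real.log (k * c ^ (-(lam + (d : ℝ)))))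
      exact (h1.const_mul k).log (by positivity)
    have h3 := h2.add h.tendsto_log_div_log
    rw [zero_add] at h3
    refine h3.congr' ?_
    have hct : Tendsto (fun t => c * t) atTop atTop := tendsto_id.const_mul_atTop hc
    filter_upwards [h.varies.1, hct.eventually h.varies.1] with t h4 h5
    rw [← add_div, ← Real.log_mul (by positivity) (by positivity)]
    congr 2
    field_simp
  obtain ⟨R', hR'⟩ := eventually_atTop.1
    (((key a ha 2 two_pos).eventually_lt_const (show -(lam + (d : ℝ)) < -β by linarith)).and
      (((key b hb (1 / 2) (by norm_num)).eventually_const_lt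
        (show -β' < -(lam + (d : ℝ)) by linarith)).and
      (((tendsto_id.const_mul_atTop ha).eventually h.varies.1).and
        ((tendsto_id.const_mul_atTop hb).eventually h.varies.1))))
  refine ⟨max (max R R') 2, fun z hz => ?_⟩
  have hzR : R ≤ ‖z‖ := (le_max_left _ _).trans ((le_max_left _ _).trans hz)
  have hzR' : R' ≤ ‖z‖ := (le_max_right _ _).trans ((le_max_left _ _).trans hz)
  have hz2 : 2 ≤ ‖z‖ := (le_max_right _ _).trans hz
  have hz0 : 0 < ‖z‖ := by linarith
  have hl : 0 < Real.log ‖z‖ := Real.log_pos (by linarith)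
  obtain ⟨h1, h2, h3, h4⟩ := hR' _ hzR'
  simp only [id] at h3 h4
  rw [div_lt_iff₀ hl] at h1
  rw [lt_div_iff₀ hl] at h2
  rw [← Real.log_rpow hz0, Real.log_lt_log_iff (by positivity) (by positivity)] at h1 h2
  have h5 : fstar (gauge D z) ≤ fstar (a * ‖z‖) :=
    h.antitone (show 0 ≤ a * ‖z‖ by positivity) (gauge_nonneg z) (hab z).1
  have h6 : fstar (b * ‖z‖) ≤ fstar (gauge D z) :=
    h.antitone (gauge_nonneg z) (show 0 ≤ b * ‖z‖ by positivity) (hab z).2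
  have h7 := hR z hzR
  constructor <;> linarith [h7.1, h7.2]

/-- The constant has to be nonzero because the marginal tail replaces `t ^ d * fstar t` as
normalization, which means dividing by it. -/
theorem IsShape.setIntegral_halfSpace_pos (hlam : 0 < lam) (hD : IsShape D) (i : Fin d) :
    0 < ∫ w in {w : EuclideanSpace ℝ (Fin d) | 1 ≤ w i}, limitIntensity lam D w := by
  have hn : ∀ w ∈ {w : EuclideanSpace ℝ (Fin d) | 1 ≤ w i}, 1 ≤ ‖w‖ := fun w hw =>
    (show (1 : ℝ) ≤ w i from hw).trans ((le_abs_self _).trans (PiLp.norm_apply_le w i))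
  have hc : IsClosed {w : EuclideanSpace ℝ (Fin d) | 1 ≤ w i} :=
    isClosed_le continuous_const (by fun_prop)
  rw [setIntegral_pos_iff_support_of_nonneg_ae
    (Eventually.of_forall fun w => limitIntensity_nonneg w)
    (hD.integrableOn_limitIntensity hlam one_pos hc.measurableSet hn)]
  have ho : IsOpen {w : EuclideanSpace ℝ (Fin d) | 1 < w i} :=
    isOpen_lt continuous_const (by fun_prop)
  have hne : {w : EuclideanSpace ℝ (Fin d) | 1 < w i}.Nonempty :=
    ⟨WithLp.toLp 2 fun _ => 2, by simp⟩
  refine (ho.measure_pos volume hne).trans_le (measure_mono fun w hw => ⟨?_, (show 1 < w i from hw).le⟩)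
  exact (hD.limitIntensity_pos (norm_pos_iff.1 (one_pos.trans_le
    (hn w (show 1 < w i from hw).le)))).ne'

end

/-! ### Distribution functions and the meta transformation -/

namespace IsPosContDensity

variable {p : ℝ → ℝ}

theorem integrable (hp : IsPosContDensity p) : Integrable p := by
  refine ⟨hp.continuous.aestronglyMeasurable, ?_⟩
  rw [hasFiniteIntegral_iff_ofReal (Eventually.of_forall fun x => (hp.pos x).le),
    hp.lintegral_eq_one]
  exact ENNReal.one_lt_top

theorem integral_eq_one (hp : IsPosContDensity p) : ∫ x, p x = 1 := by
  rw [integral_eq_lintegral_of_nonneg_ae (Eventually.of_forall fun x => (hp.pos x).le)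
    hp.continuous.aestronglyMeasurable, hp.lintegral_eq_one, ENNReal.toReal_one]

theorem one_sub_dfOf (hp : IsPosContDensity p) (t : ℝ) : 1 - dfOf p t = ∫ s in Ioi t, p s := by
  have := intervalIntegral.integral_Iic_add_Ioi (b := t) hp.integrable.integrableOn hp.integrable.integrableOn
  rw [hp.integral_eq_one] at this
  rw [dfOf]; linarith

theorem dfOf_sub (hp : IsPosContDensity p) (a b : ℝ) :
    dfOf p b - dfOf p a = ∫ s in a..b, p s :=
  intervalIntegral.integral_Iic_sub_Iic hp.integrable.integrableOn hp.integrable.integrableOn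

theorem strictMono_dfOf (hp : IsPosContDensity p) : StrictMono (dfOf p) := fun a b hab => by
  rw [← sub_pos, hp.dfOf_sub]
  exact intervalIntegral.intervalIntegral_pos_of_pos (hp.continuous.intervalIntegrable a b) hp.pos hab

theorem continuous_dfOf (hp : IsPosContDensity p) : Continuous (dfOf p) := by
  have : dfOf p = fun t => dfOf p 0 + ∫ s in (0 : ℝ)..t, p s := by
    ext t; rw [← hp.dfOf_sub]; ring
  rw [this]
  exact continuous_const.add (intervalIntegral.continuous_primitive
    (fun a b => hp.continuous.intervalIntegrable a b) 0)

theorem dfOf_eq_cdf (hp : IsPosContDensity p) : dfOf p = cdf (densityMeasure p) := by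
  have := hp.isProbabilityMeasure
  ext t
  rw [cdf_eq_real, densityMeasure_real_apply (fun x => (hp.pos x).le) hp.continuous.measurable
    measurableSet_Iic, dfOf]

theorem tendsto_dfOf_atTop (hp : IsPosContDensity p) : Tendsto (dfOf p) atTop (𝓝 1) := by
  rw [hp.dfOf_eq_cdf]; exact tendsto_cdf_atTop _

theorem tendsto_dfOf_atBot (hp : IsPosContDensity p) : Tendsto (dfOf p) atBot (𝓝 0) := by
  rw [hp.dfOf_eq_cdf]; exact tendsto_cdf_atBot _

theorem dfOf_lt_one (hp : IsPosContDensity p) (t : ℝ) : dfOf p t < 1 :=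
  (hp.strictMono_dfOf (lt_add_one t)).trans_le
    (hp.strictMono_dfOf.monotone.ge_of_tendsto hp.tendsto_dfOf_atTop _)

theorem dfOf_pos (hp : IsPosContDensity p) (t : ℝ) : 0 < dfOf p t :=
  (hp.strictMono_dfOf.monotone.le_of_tendsto hp.tendsto_dfOf_atBot _).trans_lt
    (hp.strictMono_dfOf (sub_one_lt t))

theorem exists_dfOf_eq (hp : IsPosContDensity p) {y : ℝ} (h0 : 0 < y) (h1 : y < 1) :
    ∃ t, dfOf p t = y := by
  obtain ⟨a, ha⟩ := (hp.tendsto_dfOf_atBot.eventually_lt_const h0).exists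
  obtain ⟨b, hb⟩ := (hp.tendsto_dfOf_atTop.eventually_const_lt h1).exists
  exact mem_range_of_exists_le_of_exists_ge hp.continuous_dfOf ⟨a, ha.le⟩ ⟨b, hb.le⟩

theorem dfOf_neg (hp : IsPosContDensity p) (hs : ∀ t, p (-t) = p t) (t : ℝ) :
    dfOf p (-t) = 1 - dfOf p t := by
  rw [hp.one_sub_dfOf, dfOf, ← neg_neg t, ← integral_comp_neg_Iic, neg_neg]
  simp [hs]

variable {q : ℝ → ℝ}

/-- `F₀` is continuous and strictly increasing, so the set in the quantile is a closed half-line and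
its infimum is attained. -/
theorem dfOf_metaComponent (hp : IsPosContDensity p) (hq : IsPosContDensity q) (s : ℝ) :
    dfOf p (metaComponent p q s) = dfOf q s := by
  obtain ⟨t, ht⟩ := hp.exists_dfOf_eq (hq.dfOf_pos s) (hq.dfOf_lt_one s)
  have : {t' : ℝ | dfOf q s ≤ dfOf p t'} = Ici t := by
    ext t'
    rw [← ht]
    exact hp.strictMono_dfOf.le_iff_le
  rw [metaComponent, this, csInf_Ici, ht]

theorem strictMono_metaComponent (hp : IsPosContDensity p) (hq : IsPosContDensity q) :
    StrictMono (metaComponent p q) := fun a b hab => by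
  rw [← hp.strictMono_dfOf.lt_iff_lt, hp.dfOf_metaComponent hq, hp.dfOf_metaComponent hq]
  exact hq.strictMono_dfOf hab

theorem surjective_metaComponent (hp : IsPosContDensity p) (hq : IsPosContDensity q) :
    Function.Surjective (metaComponent p q) := fun t => by
  obtain ⟨s, hs⟩ := hq.exists_dfOf_eq (hp.dfOf_pos t) (hp.dfOf_lt_one t)
  exact ⟨s, hp.strictMono_dfOf.injective (by rw [hp.dfOf_metaComponent hq, hs])⟩

theorem tendsto_metaComponent (hp : IsPosContDensity p) (hq : IsPosContDensity q) :
    Tendsto (metaComponent p q) atTop atTop :=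
  tendsto_atTop_atTop_of_monotone (hp.strictMono_metaComponent hq).monotone fun b =>
    (hp.surjective_metaComponent hq b).imp fun _ h => h.ge

theorem metaComponent_neg (hp : IsPosContDensity p) (hq : IsPosContDensity q)
    (hps : ∀ t, p (-t) = p t) (hqs : ∀ t, q (-t) = q t) (s : ℝ) :
    metaComponent p q (-s) = -metaComponent p q s :=
  hp.strictMono_dfOf.injective (by
    rw [hp.dfOf_metaComponent hq, hp.dfOf_neg hps, hp.dfOf_metaComponent hq, hq.dfOf_neg hqs])

theorem measurable_metaMap {d : ℕ} (hp : IsPosContDensity p) (hq : IsPosContDensity q) :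
    Measurable (metaMap (d := d) p q) := by
  have h := (hp.strictMono_metaComponent hq).monotone.measurable
  unfold metaMap
  refine (WithLp.measurable_toLp 2 _).comp (measurable_pi_lambda _ fun i => h.comp ?_)
  fun_prop

theorem injective_metaMap {d : ℕ} (hp : IsPosContDensity p) (hq : IsPosContDensity q) :
    Function.Injective (metaMap (d := d) p q) := fun x y hxy => by
  ext i
  exact (hp.strictMono_metaComponent hq).injective (congrArg (fun z => z i) hxy)

theorem surjective_metaMap {d : ℕ} (hp : IsPosContDensity p) (hq : IsPosContDensity q) :
    Function.Surjective (metaMap (d := d) p q) := fun z => by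
  choose x hx using fun i => hp.surjective_metaComponent hq (z i)
  exact ⟨WithLp.toLp 2 x, by ext i; exact hx i⟩

end IsPosContDensity

/-- Finite measures on `ℝ^d` are determined by their distribution functions. -/
theorem measure_ext_of_orthant {d : ℕ} {μ ν : Measure (EuclideanSpace ℝ (Fin d))}
    [IsFiniteMeasure ν] (h : ∀ x : EuclideanSpace ℝ (Fin d),
      μ {y | ∀ i, y i ≤ x i} = ν {y | ∀ i, y i ≤ x i}) : μ = ν := by
  let e := (MeasurableEquiv.toLp 2 (Fin d → ℝ)).symm
  let O : (Fin d → ℝ) → Set (Fin d → ℝ) := fun x => univ.pi fun i => Iic (x i)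
  have hO : ∀ (x : Fin d → ℝ) (κ : Measure (EuclideanSpace ℝ (Fin d))),
      κ.map e (O x) = κ {y | ∀ i, y i ≤ x i} := by
    intro x κ
    rw [e.map_apply]
    congr 1
    ext y
    simp [O, e, Pi.le_def]
  have hcs : ∀ i : Fin d, IsCountablySpanning (range (Iic : ℝ → Set ℝ)) := fun _ =>
    ⟨fun n : ℕ => Iic (n : ℝ), fun n => mem_range_self _, by
      rw [iUnion_eq_univ_iff]; exact fun x => (exists_nat_ge x).imp fun _ h => h⟩
  have hgen : (MeasurableSpace.pi : MeasurableSpace (Fin d → ℝ)) =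
      MeasurableSpace.generateFrom
        (pi univ '' pi univ fun _ : Fin d => range (Iic : ℝ → Set ℝ)) := by
    rw [← generateFrom_pi_eq hcs, ← borel_eq_generateFrom_Iic]
  have hpi : IsPiSystem (pi univ '' pi univ fun _ : Fin d => range (Iic : ℝ → Set ℝ)) :=
    IsPiSystem.pi fun _ => isPiSystem_Iic
  have key : μ.map e = ν.map e := by
    refine Measure.ext_of_generateFrom_of_iUnion _ (fun n : ℕ => O fun _ => n) hgen hpi ?_ ?_ ?_ ?_
    · rw [iUnion_eq_univ_iff]
      intro x
      obtain ⟨M, hM⟩ := (Set.finite_range x).bddAbove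
      obtain ⟨n, hn⟩ := exists_nat_ge M
      exact ⟨n, fun i _ => (hM (mem_range_self i)).trans hn⟩
    · exact fun n => ⟨fun _ => Iic (n : ℝ), fun i _ => mem_range_self _, rfl⟩
    -- Finiteness is assumed for `ν` only; on the exhausting orthants it passes to `μ` through `h`.
    · intro n
      rw [hO, h (WithLp.toLp 2 fun _ => (n : ℝ))]
      exact measure_ne_top _ _
    · rintro _ ⟨s, hs, rfl⟩
      choose x hx using fun i => hs i (mem_univ i)
      have : pi univ s = O x := by simp only [O]; congr; funext i; exact (hx i).symm
      rw [this, hO, hO]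
      exact h (WithLp.toLp 2 x)
  have := congrArg (Measure.map e.symm) key
  rwa [Measure.map_map e.symm.measurable e.measurable,
    Measure.map_map e.symm.measurable e.measurable, MeasurableEquiv.symm_comp_self,
    Measure.map_id, Measure.map_id] at this

section
variable {d : ℕ} {f g : EuclideanSpace ℝ (Fin d) → ℝ} {f0 g0 : ℝ → ℝ}

/-- As `K` increases in each coordinate, the preimage of the orthant below `K x` is the orthant
below `x`; as `K` is onto, every orthant arises in this way. -/
theorem IsMetaDensity.map_metaMap (hg : IsMetaDensity f0 g0 f g) (hf : IsPosContDensity f)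
    (hf0 : IsPosContDensity f0) (hg0 : IsPosContDensity g0) :
    (densityMeasure g).map (metaMap f0 g0) = densityMeasure f := by
  have := hf.isProbabilityMeasure
  refine measure_ext_of_orthant fun z => ?_
  obtain ⟨x, rfl⟩ := hf0.surjective_metaMap hg0 z
  rw [Measure.map_apply (hf0.measurable_metaMap hg0), ← hg.df_eq]
  · congr 1
    ext y
    exact forall_congr' fun i => (hf0.strictMono_metaComponent hg0).le_iff_le
  · rw [ofPred_forall]
    exact (isClosed_iInter fun i : Fin d => isClosed_le (by fun_prop) continuous_const).measurableSet

theorem IsMetaDensity.isProbabilityMeasure (hg : IsMetaDensity f0 g0 f g) (hf : IsPosContDensity f)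
    (hf0 : IsPosContDensity f0) (hg0 : IsPosContDensity g0) :
    IsProbabilityMeasure (densityMeasure g) := by
  have := hf.isProbabilityMeasure
  have h := hg.map_metaMap hf hf0 hg0
  refine ⟨?_⟩
  rw [← preimage_univ (f := metaMap (d := d) f0 g0),
    ← Measure.map_apply (hf0.measurable_metaMap hg0) MeasurableSet.univ, h, measure_univ]

end

/-! ### Logarithmic asymptotics of the tails -/

theorem IsVonMises.exists_monotoneOn {ψ : ℝ → ℝ} (h : IsVonMises ψ) :
    ∃ T, MonotoneOn ψ (Ici T) := by
  obtain ⟨s₀, h1, h2⟩ := h.smooth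
  have : StrictMonoOn ψ (Ioi s₀) := by
    refine strictMonoOn_of_deriv_pos (convex_Ioi s₀) h1.continuousOn fun x hx => ?_
    rw [interior_Ioi] at hx
    exact h2 x hx
  exact ⟨s₀ + 1, (this.mono fun x hx => (lt_add_one s₀).trans_le hx).monotoneOn⟩

/-- Eventually `ψ t ≥ t ^ (θ / 2)`, which dominates the logarithm. This lets a power of `t` be
absorbed by `exp (η * ψ t)`. -/
theorem IsVonMises.eventually_mul_log_le {ψ : ℝ → ℝ} (h : IsVonMises ψ) {θ : ℝ} (hθ : 0 < θ)
    (hψ : VariesRegularly ψ θ) (C : ℝ) {η : ℝ} (hη : 0 < η) :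
    ∀ᶠ t in atTop, C * Real.log t ≤ η * ψ t := by
  have h1 := hψ.tendsto_log_div_log (Or.inl h.exists_monotoneOn)
  have h2 := (isLittleO_log_rpow_atTop (half_pos hθ)).const_mul_left C
  filter_upwards [h1.eventually_const_lt (half_lt_self hθ), h2.bound hη, hψ.1,
    eventually_gt_atTop 1] with t ht1 ht2 ht3 ht4
  have ht0 : 0 < t := by linarith
  rw [lt_div_iff₀ (Real.log_pos ht4), ← Real.log_rpow ht0,
    Real.log_lt_log_iff (by positivity) ht3] at ht1
  rw [Real.norm_of_nonneg (by positivity : 0 ≤ t ^ (θ / 2))] at ht2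
  calc C * Real.log t ≤ η * t ^ (θ / 2) := (le_abs_self _).trans ht2
    _ ≤ _ := by gcongr

/-- Below, the tail is at least the mass of `[s, (1 + ε) s]`, where the density is at least `exp (-ψ
((1 + ε) s)) / 2`, and `ψ ((1 + ε) s) / ψ s → (1 + ε) ^ θ` is close to `1`. Above, `exp (-ψ t) ≤ exp
(-(1 - η) ψ s) * t ^ (-2)` for `t ≥ s`, because `η ψ t ≥ 2 log t`, and the right side is integrable
in `t`. -/
theorem IsPosContDensity.tendsto_log_tail_div {g0 ψ : ℝ → ℝ} {θ : ℝ} (hg0 : IsPosContDensity g0)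
    (h : IsVonMises ψ) (hθ : 0 < θ) (hψ : VariesRegularly ψ θ)
    (hgψ : Asymptotics.IsEquivalent atTop g0 (fun s => Real.exp (-ψ s))) :
    Tendsto (fun s => Real.log (1 - dfOf g0 s) / ψ s) atTop (𝓝 (-1)) := by
  have h1 := (Asymptotics.isEquivalent_iff_tendsto_one
    (Eventually.of_forall fun s => (Real.exp_pos _).ne')).1 hgψ
  obtain ⟨T, hT⟩ := h.exists_monotoneOn
  obtain ⟨T', hT'⟩ := eventually_atTop.1
    ((h1.eventually_lt_const (show (1 : ℝ) < 2 by norm_num)).and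
      (h1.eventually_const_lt (show (1 / 2 : ℝ) < 1 by norm_num)))
  have hb : ∀ t, T' ≤ t → g0 t ≤ 2 * Real.exp (-ψ t) ∧ 1 / 2 * Real.exp (-ψ t) ≤ g0 t := by
    intro t ht
    obtain ⟨h2, h3⟩ := hT' t ht
    simp only [Pi.div_apply] at h2 h3
    rw [div_lt_iff₀ (Real.exp_pos _)] at h2
    rw [lt_div_iff₀ (Real.exp_pos _)] at h3
    exact ⟨h2.le, h3.le⟩
  have hpos : ∀ s, 0 < 1 - dfOf g0 s := fun s => sub_pos.2 (hg0.dfOf_lt_one s)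
  refine tendsto_order.2 ⟨fun a ha => ?_, fun b hb' => ?_⟩
  · obtain ⟨ε, hε, hεa⟩ : ∃ ε : ℝ, 0 < ε ∧ a < -(1 + ε) ^ θ := by
      have : Tendsto (fun ε : ℝ => -(1 + ε) ^ θ) (𝓝[>] 0) (𝓝 (-(1 + 0) ^ θ)) := by
        refine Tendsto.mono_left ?_ nhdsWithin_le_nhds
        exact ((Real.continuousAt_rpow_const _ _ (Or.inl (by norm_num))).comp
          (by fun_prop : ContinuousAt (fun ε : ℝ => 1 + ε) 0)).neg
      rw [add_zero, Real.one_rpow] at this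
      exact ((eventually_mem_nhdsWithin).and (this.eventually_const_lt ha)).exists
    have h2 := (hψ.2 (1 + ε) (by positivity)).neg
    filter_upwards [h2.eventually_const_lt hεa, hψ.1, eventually_ge_atTop T,
      eventually_ge_atTop T', eventually_gt_atTop 0, eventually_ge_atTop (2 / ε)]
      with s hs1 hs2 hs3 hs4 hs5 hs6
    refine hs1.trans_le ?_
    rw [← neg_div, div_le_div_iff_of_pos_right hs2, ← Real.log_exp (-ψ _)]
    refine Real.log_le_log (Real.exp_pos _) ?_
    have hss : s ≤ (1 + ε) * s := by nlinarith
    have h3 : dfOf g0 ((1 + ε) * s) - dfOf g0 s ≤ 1 - dfOf g0 s := by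
      linarith [hg0.dfOf_lt_one ((1 + ε) * s)]
    refine le_trans ?_ h3
    rw [hg0.dfOf_sub]
    calc Real.exp (-ψ ((1 + ε) * s)) ≤ (ε * s / 2) * Real.exp (-ψ ((1 + ε) * s)) := by
          rw [div_le_iff₀ hε] at hs6
          have : 1 ≤ ε * s / 2 := by linarith
          have := Real.exp_pos (-ψ ((1 + ε) * s))
          nlinarith
      _ = ∫ t in s..(1 + ε) * s, 1 / 2 * Real.exp (-ψ ((1 + ε) * s)) := by
          rw [intervalIntegral.integral_const, smul_eq_mul]; ring
      _ ≤ _ := by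
          refine intervalIntegral.integral_mono_on hss (by simp)
            (hg0.continuous.intervalIntegrable _ _) fun t ht => ?_
          refine le_trans ?_ (hb t (hs4.trans ht.1)).2
          gcongr
          exact hT (hs3.trans ht.1) (hs3.trans (ht.1.trans ht.2)) ht.2
  -- The second entry gives `-(1 - η) < b`; the first keeps `1 - η` positive.
  · set η := min (1 / 2) ((b + 1) / 2) with hη
    have hη0 : 0 < η := lt_min (by norm_num) (by linarith)
    have hη1 : η ≤ 1 / 2 := min_le_left _ _
    have hηb : -(1 - η) < b := by
      have : η ≤ (b + 1) / 2 := min_le_right _ _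
      linarith
    obtain ⟨T₂, hT₂⟩ := eventually_atTop.1 (h.eventually_mul_log_le hθ hψ 2 hη0)
    filter_upwards [hψ.1, eventually_ge_atTop T, eventually_ge_atTop T',
      eventually_ge_atTop T₂, eventually_ge_atTop 2] with s hs1 hs2 hs3 hs4 hs5
    refine lt_of_le_of_lt ?_ hηb
    rw [div_le_iff₀ hs1, ← Real.log_exp (-(1 - η) * ψ s)]
    refine Real.log_le_log (hpos s) ?_
    have hs0 : 0 < s := by linarith
    rw [hg0.one_sub_dfOf]
    have hle : ∀ t ∈ Ioi s, g0 t ≤ 2 * Real.exp (-(1 - η) * ψ s) * t ^ (-2 : ℝ) := by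
      intro t ht
      have hst : s ≤ t := (show s < t from ht).le
      have ht0 : 0 < t := hs0.trans_le hst
      refine (hb t (hs3.trans hst)).1.trans ?_
      rw [mul_assoc, Real.rpow_def_of_pos ht0, ← Real.exp_add]
      gcongr
      have h5 := hT₂ t (hs4.trans hst)
      have h6 : ψ s ≤ ψ t := hT hs2 (hs2.trans hst) hst
      nlinarith
    calc ∫ t in Ioi s, g0 t ≤ ∫ t in Ioi s, 2 * Real.exp (-(1 - η) * ψ s) * t ^ (-2 : ℝ) :=
          setIntegral_mono_on hg0.integrable.integrableOn
            ((integrableOn_Ioi_rpow_of_lt (by norm_num) hs0).const_mul _) measurableSet_Ioi hle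
      _ = (2 / s) * Real.exp (-(1 - η) * ψ s) := by
          rw [integral_const_mul, integral_Ioi_rpow_of_lt (by norm_num) hs0]
          norm_num [Real.rpow_neg_one]
          field_simp
      _ ≤ 1 * Real.exp (-(1 - η) * ψ s) := by
          gcongr
          rw [div_le_one hs0]; exact hs5
      _ = _ := one_mul _

section
variable {d : ℕ} {lam θ : ℝ} {D : Set (EuclideanSpace ℝ (Fin d))}
  {f g : EuclideanSpace ℝ (Fin d) → ℝ} {fstar f0 g0 ψ : ℝ → ℝ}

theorem IsPosContDensity.one_sub_dfOf_eq_real (hf0 : IsPosContDensity f0) {i : Fin d}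
    (hm : (densityMeasure f).map (fun z => z i) = densityMeasure f0) {t : ℝ} (ht : 0 < t) :
    1 - dfOf f0 t = (densityMeasure f).real {z | t⁻¹ • z ∈ {w : EuclideanSpace ℝ (Fin d) | 1 ≤ w i}} := by
  have h1 : {z | t⁻¹ • z ∈ {w : EuclideanSpace ℝ (Fin d) | 1 ≤ w i}} =
      (fun z : EuclideanSpace ℝ (Fin d) => z i) ⁻¹' Ici t := by
    ext z
    simp [inv_mul_eq_div, one_le_div ht]
  rw [h1, Measure.real, ← Measure.map_apply (by fun_prop) measurableSet_Ici, hm, ← Measure.real,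
    densityMeasure_real_apply (fun x => (hf0.pos x).le) hf0.continuous.measurable measurableSet_Ici,
    hf0.one_sub_dfOf, integral_Ici_eq_integral_Ioi]

theorem IsRadialTail.tendsto_marginal_tail (hlam : 0 < lam) (hD : IsShape D)
    (hf : IsPosContDensity f) (h : IsRadialTail lam D f fstar) (hf0 : IsPosContDensity f0)
    {i : Fin d} (hm : (densityMeasure f).map (fun z => z i) = densityMeasure f0) :
    Tendsto (fun t => (1 - dfOf f0 t) / (t ^ d * fstar t)) atTop
      (𝓝 (∫ w in {w : EuclideanSpace ℝ (Fin d) | 1 ≤ w i}, limitIntensity lam D w)) := by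
  have hc : IsClosed {w : EuclideanSpace ℝ (Fin d) | 1 ≤ w i} :=
    isClosed_le continuous_const (by fun_prop)
  refine (h.tendsto_real_div hlam hD hf one_pos hc.measurableSet fun w hw =>
    (show (1 : ℝ) ≤ w i from hw).trans ((le_abs_self _).trans (PiLp.norm_apply_le w i))).congr' ?_
  filter_upwards [eventually_gt_atTop 0] with t ht
  rw [hf0.one_sub_dfOf_eq_real hm ht]
  rfl

/-- The tail is of order `t ^ d * fstar t`, so the index is `d - (lam + d)`. -/
theorem IsRadialTail.tendsto_log_marginal_tail (hlam : 0 < lam) (hD : IsShape D)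
    (hf : IsPosContDensity f) (h : IsRadialTail lam D f fstar) (hf0 : IsPosContDensity f0)
    {i : Fin d} (hm : (densityMeasure f).map (fun z => z i) = densityMeasure f0) :
    Tendsto (fun t => Real.log (1 - dfOf f0 t) / Real.log t) atTop (𝓝 (-lam)) := by
  have h1 := (h.tendsto_marginal_tail hlam hD hf hf0 hm).log
    (hD.setIntegral_halfSpace_pos hlam i).ne'
  have h2 := (h1.div_atTop Real.tendsto_log_atTop).add (h.tendsto_log_div_log.const_add (d : ℝ))
  rw [zero_add, neg_add, add_comm (-lam), add_neg_cancel_left] at h2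
  refine h2.congr' ?_
  filter_upwards [eventually_gt_atTop 1, h.varies.1] with t ht ht'
  have ht0 : 0 < t := by linarith
  have hl := Real.log_pos ht
  have hp : 0 < 1 - dfOf f0 t := sub_pos.2 (hf0.dfOf_lt_one t)
  rw [Real.log_div hp.ne' (by positivity), Real.log_mul (by positivity) ht'.ne', Real.log_pow]
  field_simp
  ring

theorem tendsto_log_natCast_atTop : Tendsto (fun n : ℕ => Real.log (n : ℝ)) atTop atTop :=
  Real.tendsto_log_atTop.comp tendsto_natCast_atTop_atTop

/-- Take logarithms in `1 - F₀ (K₀ x) = 1 - G₀ x` at `x = r n * s`: the left side is about `-lam *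
log (K₀ x)`, the right side about `-ψ (r n * s)`, hence about `-s ^ θ * ψ (r n)` and `-s ^ θ * log
n`. -/
theorem tendsto_log_metaComponent {r : ℕ → ℝ} (hlam : 0 < lam) (hD : IsShape D)
    (hf : IsPosContDensity f) (h : IsRadialTail lam D f fstar) (hf0 : IsPosContDensity f0)
    {i : Fin d} (hm : (densityMeasure f).map (fun z => z i) = densityMeasure f0)
    (hg0 : IsPosContDensity g0) (hψ : IsVonMises ψ) (hθ : 0 < θ) (hψ' : VariesRegularly ψ θ)
    (hgψ : Asymptotics.IsEquivalent atTop g0 (fun s => Real.exp (-ψ s)))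
    (hr_top : Tendsto r atTop atTop)
    (hr : Asymptotics.IsEquivalent atTop (fun n : ℕ => ψ (r n)) (fun n : ℕ => Real.log (n : ℝ)))
    {s : ℝ} (hs : 0 < s) :
    Tendsto (fun n : ℕ => Real.log (metaComponent f0 g0 (r n * s)) / Real.log n) atTop
      (𝓝 (s ^ θ / lam)) := by
  have hrs : Tendsto (fun n => r n * s) atTop atTop := hr_top.atTop_mul_const hs
  have hK := (hf0.tendsto_metaComponent hg0).comp hrs
  have h1 := ((h.tendsto_log_marginal_tail hlam hD hf hf0 hm).comp hK).inv₀ (by linarith)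
  have h2 := (hg0.tendsto_log_tail_div hψ hθ hψ' hgψ).comp hrs
  have h3 := (hψ'.2 s hs).comp hr_top
  have hln := tendsto_log_natCast_atTop.eventually_gt_atTop 0
  have h4 := (Asymptotics.isEquivalent_iff_tendsto_one (hln.mono fun n hn => hn.ne')).1 hr
  have h5 := ((h1.mul h2).mul h3).mul h4
  have e : (-lam)⁻¹ * -1 * s ^ θ * 1 = s ^ θ / lam := by field_simp
  rw [e] at h5
  refine h5.congr' ?_
  filter_upwards [hln, hrs.eventually hψ'.1, hr_top.eventually hψ'.1,
    (hK.eventually_gt_atTop 1)] with n hn h6 h7 h8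
  have h9 : Real.log (1 - dfOf g0 (r n * s)) ≠ 0 :=
    (Real.log_neg (sub_pos.2 (hg0.dfOf_lt_one _)) (by linarith [hg0.dfOf_pos (r n * s)])).ne
  simp only [Function.comp, Pi.div_apply] at h8 ⊢
  have h10 := (Real.log_pos h8).ne'
  rw [hf0.dfOf_metaComponent hg0, mul_comm s (r n)]
  field_simp

theorem tendsto_zero_of_log_div_log {x : ℕ → ℝ} {c : ℝ} (hx : ∀ᶠ n in atTop, 0 < x n) (hc : c < 0)
    (h : Tendsto (fun n : ℕ => Real.log (x n) / Real.log n) atTop (𝓝 c)) :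
    Tendsto x atTop (𝓝 0) := by
  have h1 := Real.tendsto_exp_atBot.comp (h.neg_mul_atTop hc tendsto_log_natCast_atTop)
  refine h1.congr' ?_
  filter_upwards [hx, tendsto_log_natCast_atTop.eventually_gt_atTop 0] with n hn hl
  simp only [Function.comp]
  rw [div_mul_cancel₀ _ hl.ne', Real.exp_log hn]

theorem tendsto_atTop_of_log_div_log {x : ℕ → ℝ} {c : ℝ} (hx : ∀ᶠ n in atTop, 0 < x n) (hc : 0 < c)
    (h : Tendsto (fun n : ℕ => Real.log (x n) / Real.log n) atTop (𝓝 c)) :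
    Tendsto x atTop atTop := by
  have h1 := Real.tendsto_exp_atTop.comp (h.pos_mul_atTop hc tendsto_log_natCast_atTop)
  refine h1.congr' ?_
  filter_upwards [hx, tendsto_log_natCast_atTop.eventually_gt_atTop 0] with n hn hl
  simp only [Function.comp]
  rw [div_mul_cancel₀ _ hl.ne', Real.exp_log hn]

end

/-! ### The mass of coordinate boxes -/

theorem volume_real_closedBlock {d : ℕ} {a b : Fin d → ℝ} (h : a ≤ b) :
    volume.real (closedBlock a b) = ∏ i, (b i - a i) := by
  have : closedBlock a b = WithLp.ofLp ⁻¹' Icc a b := by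
    ext x; simp [closedBlock, Pi.le_def, forall_and]
  rw [this, Measure.real, (PiLp.volume_preserving_ofLp (Fin d)).measure_preimage
    measurableSet_Icc.nullMeasurableSet, Real.volume_Icc_pi_toReal h]

theorem isCompact_closedBlock {d : ℕ} (a b : Fin d → ℝ) : IsCompact (closedBlock a b) := by
  have : closedBlock a b = (EuclideanSpace.equiv (Fin d) ℝ) ⁻¹' Icc a b := by
    ext x; simp [closedBlock, Pi.le_def, forall_and]
  rw [this]
  exact (EuclideanSpace.equiv (Fin d) ℝ).toHomeomorph.isCompact_preimage.2 isCompact_Icc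

section
variable {d : ℕ} {f : EuclideanSpace ℝ (Fin d) → ℝ}

theorem IsPosContDensity.real_closedBlock_le (hf : IsPosContDensity f) {a b : Fin d → ℝ}
    (h : a ≤ b) {M : ℝ} (hM : ∀ z ∈ closedBlock a b, f z ≤ M) :
    (densityMeasure f).real (closedBlock a b) ≤ M * ∏ i, (b i - a i) := by
  have hK := isCompact_closedBlock a b
  rw [densityMeasure_real_apply (fun x => (hf.pos x).le) hf.continuous.measurable hK.measurableSet,
    ← volume_real_closedBlock h]
  calc ∫ z in closedBlock a b, f z ≤ ∫ _ in closedBlock a b, M :=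
        setIntegral_mono_on (hf.continuous.continuousOn.integrableOn_compact hK)
          (integrableOn_const hK.measure_lt_top.ne) hK.measurableSet hM
    _ = _ := by rw [setIntegral_const, smul_eq_mul, mul_comm]

theorem IsPosContDensity.le_real_closedBlock (hf : IsPosContDensity f) {a b : Fin d → ℝ}
    (h : a ≤ b) {M : ℝ} (hM : ∀ z ∈ closedBlock a b, M ≤ f z) :
    M * ∏ i, (b i - a i) ≤ (densityMeasure f).real (closedBlock a b) := by
  have hK := isCompact_closedBlock a b
  rw [densityMeasure_real_apply (fun x => (hf.pos x).le) hf.continuous.measurable hK.measurableSet,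
    ← volume_real_closedBlock h]
  calc _ = ∫ _ in closedBlock a b, M := by rw [setIntegral_const, smul_eq_mul, mul_comm]
    _ ≤ ∫ z in closedBlock a b, f z :=
        setIntegral_mono_on (integrableOn_const hK.measure_lt_top.ne)
          (hf.continuous.continuousOn.integrableOn_compact hK) hK.measurableSet hM

end

/-- The logarithmic order of sample size times density bound times volume of a box, with `κ n s`
standing for `K (r n * s)`. The constants `A` and `B` vanish on this scale. -/
theorem tendsto_log_mul_prod {d : ℕ} {θ lam : ℝ} {κ : ℕ → ℝ → ℝ}
    (hκ : ∀ s, 0 < s → Tendsto (fun n : ℕ => Real.log (κ n s) / Real.log n) atTop (𝓝 (s ^ θ / lam)))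
    (hpos : ∀ n s, 0 < s → 0 < κ n s) {V : ℝ} (hV : 0 < V) {v : Fin d → ℝ} (hv : ∀ i, 0 < v i)
    {A B : ℝ} (hA : 0 < A) (hB : 0 < B) (β : ℝ) :
    Tendsto (fun n : ℕ => Real.log (n * ((A * κ n V) ^ (-β) * ∏ i, (B * κ n (v i)))) / Real.log n)
      atTop (𝓝 (1 + (-β * (V ^ θ / lam) + ∑ i, v i ^ θ / lam))) := by
  have hln := tendsto_log_natCast_atTop
  have h0 : ∀ C : ℝ, 0 < C → ∀ s, 0 < s → Tendsto (fun n : ℕ => Real.log (C * κ n s) / Real.log n)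
      atTop (𝓝 (s ^ θ / lam)) := by
    intro C hC s hs
    have := (hln.const_div_atTop (Real.log C)).add (hκ s hs)
    rw [zero_add] at this
    refine this.congr fun n => ?_
    rw [Real.log_mul hC.ne' (hpos n s hs).ne', add_div]
  have h1 := ((h0 A hA V hV).const_mul (-β)).add
    (tendsto_finsetSum Finset.univ fun i _ => h0 B hB (v i) (hv i))
  refine (h1.const_add 1).congr' ?_
  filter_upwards [hln.eventually_gt_atTop 0, eventually_gt_atTop 0] with n hn hn0
  have hκV := hpos n V hV
  have hκv : ∀ i, 0 < B * κ n (v i) := fun i => mul_pos hB (hpos n _ (hv i))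
  have hP : 0 < ∏ i, (B * κ n (v i)) := Finset.prod_pos fun i _ => hκv i
  rw [Real.log_mul (x := (n : ℝ)) (by positivity) (by positivity),
    Real.log_mul (y := ∏ i, (B * κ n (v i))) (by positivity) hP.ne',
    Real.log_rpow (by positivity), Real.log_prod (fun i _ => (hκv i).ne'), add_div, add_div,
    div_self hn.ne', mul_div_assoc, Finset.sum_div]

/-- The crude factor `d` in place of `√d` is enough; no estimate below depends on the sharp value.
-/
theorem norm_le_card_mul {d : ℕ} {z : EuclideanSpace ℝ (Fin d)} {M : ℝ} (h : ∀ i, |z i| ≤ M) :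
    ‖z‖ ≤ d * M := by
  rcases Nat.eq_zero_or_pos d with rfl | hd
  · simp [Subsingleton.elim z 0]
  have hM : 0 ≤ M := (abs_nonneg _).trans (h ⟨0, hd⟩)
  have hd1 : (1 : ℝ) ≤ d := by exact_mod_cast hd
  rw [← abs_of_nonneg (norm_nonneg z), ← abs_of_nonneg (show 0 ≤ d * M by positivity),
    ← sq_le_sq, EuclideanSpace.norm_sq_eq]
  calc ∑ i, ‖z i‖ ^ 2 ≤ ∑ _i : Fin d, M ^ 2 := by
        gcongr with i
        exact h i
    _ = d * M ^ 2 := by simp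
    _ ≤ (d * M) ^ 2 := by
      rw [mul_pow]
      gcongr
      nlinarith

/-- An odd increasing function `K` and scaling constants `r` such that `K (r n * s)` is of
logarithmic order `s ^ θ / lam`. -/
structure IsLogScale (lam θ : ℝ) (K : ℝ → ℝ) (r : ℕ → ℝ) : Prop where
  strictMono : StrictMono K
  odd : ∀ s, K (-s) = -K s
  tendsto : Tendsto K atTop atTop
  r_pos : ∀ n, 0 < r n
  r_tendsto : Tendsto r atTop atTop
  log_tendsto : ∀ s, 0 < s →
    Tendsto (fun n : ℕ => Real.log (K (r n * s)) / Real.log n) atTop (𝓝 (s ^ θ / lam))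

namespace IsLogScale

variable {d : ℕ} {lam θ : ℝ} {D : Set (EuclideanSpace ℝ (Fin d))}
  {f : EuclideanSpace ℝ (Fin d) → ℝ} {fstar : ℝ → ℝ} {K : ℝ → ℝ} {r : ℕ → ℝ}

theorem zero (h : IsLogScale lam θ K r) : K 0 = 0 := by
  have := h.odd 0
  rw [neg_zero] at this
  linarith

theorem pos (h : IsLogScale lam θ K r) (n : ℕ) (s : ℝ) (hs : 0 < s) : 0 < K (r n * s) := by
  have := h.r_pos n
  rw [← h.zero]
  exact h.strictMono (by positivity)

theorem mono (h : IsLogScale lam θ K r) (n : ℕ) {s t : ℝ} (hst : s ≤ t) :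
    K (r n * s) ≤ K (r n * t) :=
  h.strictMono.monotone (mul_le_mul_of_nonneg_left hst (h.r_pos n).le)

theorem neg (h : IsLogScale lam θ K r) (n : ℕ) (s : ℝ) : K (r n * -s) = -K (r n * s) := by
  rw [mul_neg, h.odd]

theorem tendsto_of_pos (h : IsLogScale lam θ K r) {s : ℝ} (hs : 0 < s) :
    Tendsto (fun n => K (r n * s)) atTop atTop :=
  h.tendsto.comp (h.r_tendsto.atTop_mul_const hs)

/-- The exponents obtained from boxes of half-side `δ`, with `σ = 1` in the upper bound and `σ = -1`
in the lower one. By continuity a small `δ` preserves the sign of the limiting exponent. -/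
theorem exponent_tendsto (hθ : 0 < θ) (u : EuclideanSpace ℝ (Fin d)) (σ : ℝ) :
    Tendsto (fun δ : ℝ => 1 + (-(lam + d - σ * δ) * ((‖(WithLp.ofLp u : Fin d → ℝ)‖ - σ * δ) ^ θ / lam) +
        ∑ i, (|u i| + σ * δ) ^ θ / lam)) (𝓝[>] 0)
      (𝓝 (1 + (-(lam + d) * (‖(WithLp.ofLp u : Fin d → ℝ)‖ ^ θ / lam) + ∑ i, |u i| ^ θ / lam))) := by
  have hc : Continuous fun x : ℝ => x ^ θ := Real.continuous_rpow_const hθ.le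
  have : Continuous (fun δ : ℝ => 1 + (-(lam + d - σ * δ) *
      ((‖(WithLp.ofLp u : Fin d → ℝ)‖ - σ * δ) ^ θ / lam) + ∑ i, (|u i| + σ * δ) ^ θ / lam)) := by
    have h1 : Continuous fun δ : ℝ => (‖(WithLp.ofLp u : Fin d → ℝ)‖ - σ * δ) ^ θ :=
      hc.comp (by fun_prop)
    have h2 : ∀ i, Continuous fun δ : ℝ => (|u i| + σ * δ) ^ θ := fun i => hc.comp (by fun_prop)
    fun_prop
  simpa using (this.tendsto 0).mono_left nhdsWithin_le_nhds

theorem exists_abs_eq_norm (i₀ : Fin d) (u : EuclideanSpace ℝ (Fin d)) :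
    ∃ j, |u j| = ‖(WithLp.ofLp u : Fin d → ℝ)‖ := by
  have : Nonempty (Fin d) := ⟨i₀⟩
  obtain ⟨j, hj⟩ := Finite.exists_max fun i => |u i|
  exact ⟨j, le_antisymm (norm_le_pi_norm (WithLp.ofLp u) j)
    ((pi_norm_le_iff_of_nonneg (abs_nonneg _)).2 hj)⟩

theorem abs_le_norm (u : EuclideanSpace ℝ (Fin d)) (i : Fin d) :
    |u i| ≤ ‖(WithLp.ofLp u : Fin d → ℝ)‖ := norm_le_pi_norm (WithLp.ofLp u) i

/-- Oddness of `K` reflects an interval about a negative point to the positive side; with the next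
lemmas, boxes are estimated through `|u i|` alone. -/
theorem le_abs_of_mem (h : IsLogScale lam θ K r) {n : ℕ} {x δ z : ℝ}
    (hz1 : K (r n * (x - δ)) ≤ z) (hz2 : z ≤ K (r n * (x + δ))) : K (r n * (|x| - δ)) ≤ |z| := by
  rcases le_total 0 x with hx | hx
  · rw [abs_of_nonneg hx]; exact hz1.trans (le_abs_self z)
  · rw [abs_of_nonpos hx, show -x - δ = -(x + δ) by ring, h.neg]
    exact (neg_le_neg hz2).trans (neg_le_abs z)

theorem abs_le_of_mem (h : IsLogScale lam θ K r) {n : ℕ} {x δ z : ℝ}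
    (hz1 : K (r n * (x - δ)) ≤ z) (hz2 : z ≤ K (r n * (x + δ))) : |z| ≤ K (r n * (|x| + δ)) := by
  refine abs_le.2 ⟨?_, hz2.trans (h.mono n (by linarith [le_abs_self x]))⟩
  rw [← h.neg]
  exact (h.mono n (by linarith [neg_le_abs x])).trans hz1

theorem sub_eq (h : IsLogScale lam θ K r) (n : ℕ) (x δ : ℝ) :
    K (r n * (x + δ)) - K (r n * (x - δ)) = K (r n * (|x| + δ)) - K (r n * (|x| - δ)) := by
  rcases le_total 0 x with hx | hx
  · rw [abs_of_nonneg hx]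
  · rw [abs_of_nonpos hx, show -x + δ = -(x - δ) by ring, show -x - δ = -(x + δ) by ring, h.neg, h.neg]
    ring

/-- A coordinate with `|u j| = ‖u‖_∞` forces `‖z‖ ≥ K (r n * (U - δ))` on the box, which bounds `f`
above; the sides are at most `2 * K (r n * (|u i| + δ))`. For small `δ` the resulting power of `n`
is negative, since `u` violates the inequality that defines the limit set. -/
theorem tendsto_box_zero (h : IsLogScale lam θ K r) (hlam : 0 < lam) (hθ : 0 < θ) (hD : IsShape D)
    (hf : IsPosContDensity f) (hs : IsRadialTail lam D f fstar) (i₀ : Fin d)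
    {u : EuclideanSpace ℝ (Fin d)} (hu : u ∉ limitSet d lam θ) :
    ∀ᶠ δ in 𝓝[>] (0 : ℝ), Tendsto (fun n : ℕ => n * (densityMeasure f).real
      (closedBlock (fun i => K (r n * (u i - δ))) (fun i => K (r n * (u i + δ))))) atTop (𝓝 0) := by
  set U := ‖(WithLp.ofLp u : Fin d → ℝ)‖ with hU
  have hu' : ∑ i, |u i| ^ θ + lam < (lam + d) * U ^ θ := not_le.1 hu
  have hU0 : 0 < U := by
    rcases (norm_nonneg (WithLp.ofLp u : Fin d → ℝ)).eq_or_lt with h0 | h0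
    · rw [hU, ← h0, Real.zero_rpow hθ.ne', mul_zero] at hu'
      have : 0 ≤ ∑ i, |u i| ^ θ := Finset.sum_nonneg fun i _ => by positivity
      linarith
    · exact h0
  obtain ⟨j, hj⟩ := exists_abs_eq_norm i₀ u
  have he : 1 + (-(lam + d) * (U ^ θ / lam) + ∑ i, |u i| ^ θ / lam) < 0 := by
    rw [← Finset.sum_div]
    have : 1 + (-(lam + d) * (U ^ θ / lam) + (∑ i, |u i| ^ θ) / lam) =
        (∑ i, |u i| ^ θ + lam - (lam + d) * U ^ θ) / lam := by field_simp; ring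
    rw [this]
    exact div_neg_of_neg_of_pos (by linarith) hlam
  have hE := (exponent_tendsto (lam := lam) hθ u 1).eventually_lt_const he
  simp only [one_mul] at hE
  filter_upwards [hE, eventually_mem_nhdsWithin,
    (tendsto_nhdsWithin_of_tendsto_nhds tendsto_id).eventually_lt_const hU0,
    (tendsto_nhdsWithin_of_tendsto_nhds tendsto_id).eventually_lt_const hlam] with δ hδ hδ0 hδU hδl
  have hδ0 : 0 < δ := hδ0
  simp only [id] at hδU hδl
  -- Only the upper bound on `f` is used, so `β'` is arbitrary; `δ < lam` keeps `β` positive.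
  obtain ⟨R, hR⟩ := hs.eventually_rpow_bounds hD (β := lam + d - δ) (β' := lam + d + 1)
    (by linarith) (by linarith)
  have hv : ∀ i, 0 < |u i| + δ := fun i => by positivity
  have hyp : ∀ᶠ n : ℕ in atTop, 0 < (n : ℝ) * ((1 * K (r n * (U - δ))) ^ (-(lam + d - δ)) *
      ∏ i, (2 * K (r n * (|u i| + δ)))) := by
    filter_upwards [eventually_gt_atTop 0] with n hn
    have := h.pos n _ (sub_pos.2 hδU)
    have : 0 < ∏ i, (2 * K (r n * (|u i| + δ))) :=
      Finset.prod_pos fun i _ => by have := h.pos n _ (hv i); positivity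
    positivity
  have hy := tendsto_zero_of_log_div_log hyp hδ (tendsto_log_mul_prod h.log_tendsto h.pos
    (sub_pos.2 hδU) hv one_pos two_pos (lam + d - δ))
  refine tendsto_of_tendsto_of_tendsto_of_le_of_le' tendsto_const_nhds hy
    (Eventually.of_forall fun n => by positivity) ?_
  filter_upwards [(h.tendsto_of_pos (sub_pos.2 hδU)).eventually_ge_atTop R] with n hn
  gcongr
  have hle : (fun i => K (r n * (u i - δ))) ≤ fun i => K (r n * (u i + δ)) := fun i =>
    h.mono n (by linarith)
  have hK0 := h.pos n _ (sub_pos.2 hδU)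
  refine (hf.real_closedBlock_le hle (M := (1 * K (r n * (U - δ))) ^ (-(lam + d - δ))) ?_).trans ?_
  · intro z hz
    have h1 : K (r n * (U - δ)) ≤ ‖z‖ := by
      rw [hU, ← hj]
      exact (h.le_abs_of_mem (hz j).1 (hz j).2).trans (PiLp.norm_apply_le z j)
    refine (hR z (hn.trans h1)).1.trans ?_
    rw [one_mul]
    have hd : (0 : ℝ) < d := by exact_mod_cast i₀.pos
    exact Real.rpow_le_rpow_of_nonpos hK0 h1 (by linarith)
  · refine mul_le_mul_of_nonneg_left (Finset.prod_le_prod (fun i _ => ?_) fun i _ => ?_) (by positivity)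
    · exact sub_nonneg.2 (hle i)
    · have h1 := h.mono n (show u i + δ ≤ |u i| + δ by linarith [le_abs_self (u i)])
      have h2 := h.mono n (show -(u i - δ) ≤ |u i| + δ by linarith [neg_le_abs (u i)])
      rw [h.neg] at h2
      linarith

/-- The reverse estimates: `‖z‖ ≤ d * K (r n * (U + δ))` bounds `f` below, and each side is at least
`K (r n * |u i|)`. The logarithmic order of the latter is known for `u i ≠ 0`. -/
theorem tendsto_box_atTop (h : IsLogScale lam θ K r) (hlam : 0 < lam) (hθ : 0 < θ) (hD : IsShape D)
    (hf : IsPosContDensity f) (hs : IsRadialTail lam D f fstar) (i₀ : Fin d)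
    {u : EuclideanSpace ℝ (Fin d)} (hu0 : ∀ i, u i ≠ 0)
    (hu : (lam + (d : ℝ)) * ‖(WithLp.ofLp u : Fin d → ℝ)‖ ^ θ < ∑ i, |u i| ^ θ + lam) :
    ∀ᶠ δ in 𝓝[>] (0 : ℝ), Tendsto (fun n : ℕ => n * (densityMeasure f).real
      (closedBlock (fun i => K (r n * (u i - δ))) (fun i => K (r n * (u i + δ))))) atTop atTop := by
  set U := ‖(WithLp.ofLp u : Fin d → ℝ)‖ with hU
  have hd : (0 : ℝ) < d := by exact_mod_cast i₀.pos
  have hu1 : ∀ i, 0 < |u i| := fun i => abs_pos.2 (hu0 i)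
  have he : 0 < 1 + (-(lam + d) * (U ^ θ / lam) + ∑ i, |u i| ^ θ / lam) := by
    rw [← Finset.sum_div]
    have : 1 + (-(lam + d) * (U ^ θ / lam) + (∑ i, |u i| ^ θ) / lam) =
        (∑ i, |u i| ^ θ + lam - (lam + d) * U ^ θ) / lam := by field_simp; ring
    rw [this]
    exact div_pos (by linarith) hlam
  have hE := (exponent_tendsto (lam := lam) hθ u (-1)).eventually_const_lt he
  have hlt : ∀ᶠ δ in 𝓝[>] (0 : ℝ), ∀ i, δ < |u i| := eventually_all.2 fun i =>
    (tendsto_nhdsWithin_of_tendsto_nhds tendsto_id).eventually_lt_const (hu1 i)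
  filter_upwards [hE, eventually_mem_nhdsWithin, hlt] with δ hδ hδ0 hδu
  have hδ0 : 0 < δ := hδ0
  have hU0 : 0 < U := (hu1 i₀).trans_le (abs_le_norm u i₀)
  have hUδ : 0 < U + δ := by positivity
  -- Replacing `|u i| - δ` by `|u i|` only raises the exponent.
  have hE' : 0 < 1 + (-(lam + d + δ) * ((U + δ) ^ θ / lam) + ∑ i, |u i| ^ θ / lam) := by
    refine hδ.trans_le ?_
    simp only [neg_mul, one_mul, sub_neg_eq_add, ← sub_eq_add_neg]
    gcongr with i
    · linarith [hδu i]
    · linarith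
  obtain ⟨R, hR⟩ := hs.eventually_rpow_bounds hD (β := lam + d - 1) (β' := lam + d + δ)
    (by linarith) (by linarith)
  have hyp : ∀ᶠ n : ℕ in atTop, 0 < (n : ℝ) * ((d * K (r n * (U + δ))) ^ (-(lam + d + δ)) *
      ∏ i, (1 * K (r n * |u i|))) := by
    filter_upwards [eventually_gt_atTop 0] with n hn
    have := h.pos n _ hUδ
    have : 0 < ∏ i, (1 * K (r n * |u i|)) :=
      Finset.prod_pos fun i _ => by have := h.pos n _ (hu1 i); positivity
    positivity
  have hy := tendsto_atTop_of_log_div_log hyp hE' (tendsto_log_mul_prod h.log_tendsto h.pos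
    hUδ hu1 hd one_pos (lam + d + δ))
  refine tendsto_atTop_mono' _ ?_ hy
  -- The quotient grows like a positive power of `n`, hence exceeds `2`. Then the side, at least `K
  -- (r n * (|u i| + δ)) - K (r n * |u i|)`, is at least `K (r n * |u i|)`.
  have hdouble : ∀ᶠ n in atTop, ∀ i, 2 * K (r n * |u i|) ≤ K (r n * (|u i| + δ)) := by
    refine eventually_all.2 fun i => ?_
    have h1 := (h.log_tendsto (|u i| + δ) (by positivity)).sub (h.log_tendsto _ (hu1 i))
    have hc : 0 < (|u i| + δ) ^ θ / lam - |u i| ^ θ / lam := by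
      rw [sub_pos]
      gcongr
      linarith
    have h2 := tendsto_atTop_of_log_div_log
      (x := fun n => K (r n * (|u i| + δ)) / K (r n * |u i|))
      (Eventually.of_forall fun n => div_pos (h.pos n _ (by positivity)) (h.pos n _ (hu1 i))) hc
      (h1.congr fun n => by
        rw [Real.log_div (h.pos n _ (by positivity)).ne' (h.pos n _ (hu1 i)).ne', sub_div])
    filter_upwards [h2.eventually_ge_atTop 2] with n hn
    rwa [le_div_iff₀ (h.pos n _ (hu1 i))] at hn
  filter_upwards [(h.tendsto_of_pos (sub_pos.2 (hδu i₀))).eventually_ge_atTop (max R 1),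
    hdouble] with n hn hn2
  gcongr
  have hle : (fun i => K (r n * (u i - δ))) ≤ fun i => K (r n * (u i + δ)) := fun i =>
    h.mono n (by linarith)
  have hK0 := h.pos n _ hUδ
  refine le_trans ?_ (hf.le_real_closedBlock hle
    (M := (d * K (r n * (U + δ))) ^ (-(lam + d + δ))) ?_)
  · refine mul_le_mul_of_nonneg_left (Finset.prod_le_prod (fun i _ => ?_) fun i _ => ?_) (by positivity)
    · rw [one_mul]; exact (h.pos n _ (hu1 i)).le
    · rw [h.sub_eq, one_mul]
      have := h.mono n (show |u i| - δ ≤ |u i| by linarith)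
      linarith [hn2 i]
  · intro z hz
    have h1 : max R 1 ≤ ‖z‖ :=
      hn.trans ((h.le_abs_of_mem (hz i₀).1 (hz i₀).2).trans (PiLp.norm_apply_le z i₀))
    have h2 : ‖z‖ ≤ d * K (r n * (U + δ)) := by
      have h3 : ∀ i, |z i| ≤ K (r n * (U + δ)) := fun i =>
        (h.abs_le_of_mem (hz i).1 (hz i).2).trans (h.mono n (by linarith [abs_le_norm u i]))
      exact norm_le_card_mul h3
    have hz0 : 0 < ‖z‖ := by linarith [le_max_right R 1]
    exact (Real.rpow_le_rpow_of_nonpos hz0 h2 (by linarith)).trans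
      (hR z ((le_max_left _ _).trans h1)).2

end IsLogScale

/-! ### Regular partitions -/

/-- A comparison of two measures on the atoms of a regular partition extends to scaled sets, up to
a relative neighbourhood. -/
theorem IsRegularPartition.eventually_measure_le {d : ℕ}
    {B : ℕ → Set (EuclideanSpace ℝ (Fin d))} (hB : IsRegularPartition B)
    {ν₁ ν₂ : Measure (EuclideanSpace ℝ (Fin d))} {C : ℝ≥0∞}
    (hC : ∀ᶠ m in atTop, ν₁ (B m) ≤ C * ν₂ (B m)) {S S' : Set (EuclideanSpace ℝ (Fin d))}
    {δ ρ : ℝ} (hδ : 0 < δ) (hρ : 0 < ρ) (hS : ∀ x ∈ S, ρ ≤ ‖x‖)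
    (hSS' : ∀ x ∈ S, ∀ y, ‖y - x‖ ≤ δ * ‖x‖ → y ∈ S') :
    ∀ᶠ t : ℝ in atTop, ν₁ {x | t⁻¹ • x ∈ S} ≤ C * ν₂ {x | t⁻¹ • x ∈ S'} := by
  obtain ⟨p, -, hp0, hp⟩ := hB.small
  -- The bound `1 / 2` gives `‖p m‖ ≤ 2 * ‖x‖` for `x` in the atom; then `δ / 4` makes two points of
  -- the atom differ by at most `2 * η * ‖p m‖ ≤ δ * ‖x‖`.
  set η := min (δ / 4) (1 / 2) with hη
  have hη0 : 0 < η := lt_min (by positivity) (by norm_num)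
  obtain ⟨M, hM⟩ := eventually_atTop.1 (hC.and (hp η hη0))
  have hbdd : Bornology.IsBounded (⋃ m ∈ Finset.range M, B m) := by
    rw [Bornology.isBounded_biUnion_finset]
    exact fun m _ => hB.isBounded m
  obtain ⟨R, hR⟩ := hbdd.subset_closedBall 0
  filter_upwards [eventually_gt_atTop 0, eventually_gt_atTop (R / ρ)] with t ht htR
  rw [div_lt_iff₀ hρ] at htR
  set J := {m | (B m ∩ {x | t⁻¹ • x ∈ S}).Nonempty}
  have hnorm : ∀ x, t⁻¹ • x ∈ S → t * ρ ≤ ‖x‖ := fun x hx => by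
    have := hS _ hx
    rw [norm_smul, Real.norm_of_nonneg (by positivity), inv_mul_eq_div, le_div_iff₀ ht] at this
    linarith
  -- The first `M` atoms, for which nothing is known, lie in a ball of radius `R < t * ρ` and miss
  -- the scaled set.
  have hJM : ∀ m ∈ J, M ≤ m := by
    rintro m ⟨x, hxB, hx⟩
    by_contra! hlt
    have : x ∈ Metric.closedBall (0 : EuclideanSpace ℝ (Fin d)) R :=
      hR (mem_biUnion (by simpa using hlt) hxB)
    rw [mem_closedBall_zero_iff] at this
    linarith [hnorm x hx]
  have hJS : ⋃ m ∈ J, B m ⊆ {x | t⁻¹ • x ∈ S'} := by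
    intro y hy
    obtain ⟨m, hm, hyB⟩ := mem_iUnion₂.1 hy
    obtain ⟨x, hxB, hx⟩ := hm
    have hsub := (hM m (hJM m ⟨x, hxB, hx⟩)).2
    have h1 := hsub hxB
    have h2 := hsub hyB
    rw [mem_ball_iff_norm] at h1 h2
    have h3 : ‖p m‖ ≤ 2 * ‖x‖ := by
      have h4 : ‖p m‖ ≤ ‖x‖ + ‖x - p m‖ := by
        have := norm_sub_le x (x - p m)
        rwa [sub_sub_cancel] at this
      have h5 : η * ‖p m‖ ≤ 1 / 2 * ‖p m‖ := by gcongr; exact min_le_right _ _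
      linarith
    have h6 : ‖y - x‖ ≤ δ * ‖x‖ := by
      have h7 : ‖y - x‖ ≤ ‖y - p m‖ + ‖x - p m‖ := by
        have := norm_sub_le (y - p m) (x - p m)
        rwa [sub_sub_sub_cancel_right] at this
      have h8 : η * ‖p m‖ ≤ δ / 4 * (2 * ‖x‖) := by
        gcongr
        exact min_le_left _ _
      linarith
    refine hSS' _ hx _ ?_
    rw [← smul_sub, norm_smul, norm_smul]
    nlinarith [norm_nonneg (t⁻¹)]
  have hcov : {x | t⁻¹ • x ∈ S} ⊆ ⋃ m ∈ J, B m := fun x hx => by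
    obtain ⟨m, hm⟩ := mem_iUnion.1 (hB.partition.cover.symm ▸ mem_univ x : x ∈ ⋃ n, B n)
    exact mem_biUnion (show m ∈ J from ⟨x, hm, hx⟩) hm
  calc ν₁ {x | t⁻¹ • x ∈ S} ≤ ν₁ (⋃ m ∈ J, B m) := measure_mono hcov
    _ ≤ ∑' m : J, ν₁ (B m) := measure_biUnion_le _ J.to_countable _
    _ ≤ ∑' m : J, C * ν₂ (B m) := ENNReal.tsum_le_tsum fun m => (hM m (hJM m m.2)).1
    _ = C * ν₂ (⋃ m ∈ J, B m) := by
      rw [ENNReal.tsum_mul_left, measure_biUnion J.to_countable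
        (fun i _ j _ hij => hB.partition.disjoint hij) fun m _ => hB.partition.measurable m]
    _ ≤ _ := by gcongr

theorem Asymptotics.IsEquivalent.eventually_measure_le {α : Type*} [MeasurableSpace α]
    {ν₁ ν₂ : Measure α} [IsFiniteMeasure ν₁] [IsFiniteMeasure ν₂] {B : ℕ → Set α}
    (h : Asymptotics.IsEquivalent atTop (fun n => ν₁.real (B n)) fun n => ν₂.real (B n))
    {C : ℝ} (hC : 1 < C) : ∀ᶠ m in atTop, ν₁ (B m) ≤ ENNReal.ofReal C * ν₂ (B m) := by
  filter_upwards [h.isLittleO.bound (sub_pos.2 hC)] with m hm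
  simp only [Pi.sub_apply, Real.norm_eq_abs] at hm
  rw [abs_of_nonneg (measureReal_nonneg (μ := ν₂))] at hm
  rw [← ofReal_measureReal, ← ofReal_measureReal (μ := ν₂), ← ENNReal.ofReal_mul (by linarith)]
  refine ENNReal.ofReal_le_ofReal ?_
  linarith [le_abs_self (ν₁.real (B m) - ν₂.real (B m))]

/-! ### Convergence of measures on the complement of balls -/

section
variable {d : ℕ} {lam : ℝ} {D : Set (EuclideanSpace ℝ (Fin d))}
  {f : EuclideanSpace ℝ (Fin d) → ℝ} {fstar f0 : ℝ → ℝ} {c : ℕ → ℝ}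

/-- The unknown normalization `t ^ d * fstar t` at `t = c n` cancels between the mass of the scaled
set and the marginal tail. -/
theorem IsRadialTail.tendsto_mul_real (hlam : 0 < lam) (hD : IsShape D)
    (hf : IsPosContDensity f) (h : IsRadialTail lam D f fstar) (hf0 : IsPosContDensity f0)
    {i : Fin d} (hm : (densityMeasure f).map (fun z => z i) = densityMeasure f0)
    (hc_top : Tendsto c atTop atTop)
    (hc : Tendsto (fun n : ℕ => (n : ℝ) * (1 - dfOf f0 (c n))) atTop
      (𝓝 (∫ w in {w : EuclideanSpace ℝ (Fin d) | 1 ≤ w i}, limitIntensity lam D w)))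
    {ε : ℝ} (hε : 0 < ε)
    {S : Set (EuclideanSpace ℝ (Fin d))} (hS : MeasurableSet S) (hSε : ∀ w ∈ S, ε ≤ ‖w‖) :
    Tendsto (fun n : ℕ => (n : ℝ) * (densityMeasure f).real {z | (c n)⁻¹ • z ∈ S}) atTop
      (𝓝 (∫ w in S, limitIntensity lam D w)) := by
  have hI := hD.setIntegral_halfSpace_pos hlam i
  have h1 := (h.tendsto_marginal_tail hlam hD hf hf0 hm).comp hc_top
  have h2 := (h.tendsto_real_div hlam hD hf hε hS hSε).comp hc_top
  have h3 := (hc.div h1 hI.ne').mul h2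
  rw [div_self hI.ne', one_mul] at h3
  refine h3.congr' ?_
  filter_upwards [hc_top.eventually_gt_atTop 0, hc_top.eventually h.varies.1] with n hn hn'
  have : 0 < 1 - dfOf f0 (c n) := sub_pos.2 (hf0.dfOf_lt_one _)
  simp only [Function.comp, Pi.div_apply]
  field_simp

theorem IsPosContDensity.tendsto_atTop_of_mul_tail (hf0 : IsPosContDensity f0) {a : ℝ}
    (hc : Tendsto (fun n : ℕ => (n : ℝ) * (1 - dfOf f0 (c n))) atTop (𝓝 a)) :
    Tendsto c atTop atTop := by
  refine tendsto_atTop.2 fun b => ?_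
  have h1 : Tendsto (fun n : ℕ => 1 - dfOf f0 (c n)) atTop (𝓝 0) := by
    refine (hc.div_atTop tendsto_natCast_atTop_atTop).congr' ?_
    filter_upwards [eventually_gt_atTop 0] with n hn
    field_simp
  filter_upwards [h1.eventually_lt_const (sub_pos.2 (hf0.dfOf_lt_one b))] with n hn
  exact (hf0.strictMono_dfOf.lt_iff_lt.1 (by linarith)).le

theorem IsShape.densityMeasure_eq_ofReal (hlam : 0 < lam) (hD : IsShape D) {ε : ℝ} (hε : 0 < ε)
    {S : Set (EuclideanSpace ℝ (Fin d))} (hS : MeasurableSet S) (hSε : ∀ w ∈ S, ε ≤ ‖w‖) :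
    densityMeasure (limitIntensity lam D) S = ENNReal.ofReal (∫ w in S, limitIntensity lam D w) := by
  rw [densityMeasure_apply _ hS, ofReal_integral_eq_lintegral_ofReal
    (hD.integrableOn_limitIntensity hlam hε hS hSε)
    (Eventually.of_forall fun w => limitIntensity_nonneg w)]

/-- The mean measure of the sample cloud of size `n` from `ν`, scaled by `c`. -/
def scaledMean {d : ℕ} (ν : Measure (EuclideanSpace ℝ (Fin d))) (c : ℝ) (n : ℕ) :
    Measure (EuclideanSpace ℝ (Fin d)) :=
  (n : ℝ≥0∞) • ν.map fun z => c⁻¹ • z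

theorem scaledMean_apply {ν : Measure (EuclideanSpace ℝ (Fin d))} {c : ℝ} {n : ℕ}
    {S : Set (EuclideanSpace ℝ (Fin d))} (hS : MeasurableSet S) :
    scaledMean ν c n S = n * ν {z | c⁻¹ • z ∈ S} := by
  rw [scaledMean, Measure.smul_apply, Measure.map_apply (by fun_prop) hS, smul_eq_mul]
  rfl

instance {ν : Measure (EuclideanSpace ℝ (Fin d))} [IsFiniteMeasure ν] {c : ℝ} {n : ℕ} :
    IsFiniteMeasure (scaledMean ν c n) :=
  Measure.smul_finite _ (ENNReal.natCast_ne_top n)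

/-- Continuity from above, used to undo the relative enlargement of a set. The shift `k + 2` keeps
the radius positive at `k = 0`. -/
theorem tendsto_norm_ge_measure {E : Type*} [NormedAddCommGroup E] [MeasurableSpace E]
    [BorelSpace E] {ρ : Measure E} (hρ : ∀ ε : ℝ, 0 < ε → ρ {w | ε ≤ ‖w‖} ≠ ∞) {ε : ℝ}
    (hε : 0 < ε) :
    Tendsto (fun k : ℕ => ρ {w | (1 - 1 / (k + 2 : ℝ)) * ε ≤ ‖w‖}) atTop (𝓝 (ρ {w | ε ≤ ‖w‖})) := by
  have hanti : Antitone fun k : ℕ => {w : E | (1 - 1 / (k + 2 : ℝ)) * ε ≤ ‖w‖} := by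
    intro k l hkl w hw
    refine le_trans ?_ (show (1 - 1 / (l + 2 : ℝ)) * ε ≤ ‖w‖ from hw)
    gcongr
  have hlim : Tendsto (fun k : ℕ => (1 - 1 / (k + 2 : ℝ)) * ε) atTop (𝓝 ((1 - 0) * ε)) := by
    refine Tendsto.mul_const _ (Tendsto.const_sub _ ?_)
    exact tendsto_const_nhds.div_atTop
      (tendsto_atTop_add_const_right _ _ tendsto_natCast_atTop_atTop)
  rw [sub_zero, one_mul] at hlim
  have hInter : ⋂ k : ℕ, {w : E | (1 - 1 / (k + 2 : ℝ)) * ε ≤ ‖w‖} = {w | ε ≤ ‖w‖} := by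
    ext w
    simp only [mem_iInter]
    refine ⟨fun hw => le_of_tendsto' hlim hw, fun hw k => le_trans ?_ (show ε ≤ ‖w‖ from hw)⟩
    have : 0 ≤ 1 / (k + 2 : ℝ) := by positivity
    nlinarith
  rw [← hInter]
  refine tendsto_measure_iInter_atTop (fun k => ?_) hanti ⟨0, hρ _ ?_⟩
  · exact (measurableSet_le measurable_const measurable_norm).nullMeasurableSet
  · norm_num; exact hε

variable {ν π : Measure (EuclideanSpace ℝ (Fin d))} [IsFiniteMeasure ν] [IsFiniteMeasure π]
  {B : ℕ → Set (EuclideanSpace ℝ (Fin d))} {ρ : Measure (EuclideanSpace ℝ (Fin d))}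

theorem ENNReal.le_of_forall_one_lt_ofReal_mul {x y : ℝ≥0∞}
    (h : ∀ C : ℝ, 1 < C → x ≤ ENNReal.ofReal C * y) : x ≤ y := by
  rcases eq_or_ne y ∞ with rfl | hy
  · exact le_top
  · have h1 : Tendsto (fun C : ℝ => ENNReal.ofReal C * y) (𝓝[>] 1) (𝓝 (ENNReal.ofReal 1 * y)) :=
      (ENNReal.Tendsto.mul_const (ENNReal.tendsto_ofReal tendsto_id) (Or.inr hy)).mono_left
        nhdsWithin_le_nhds
    rw [ENNReal.ofReal_one, one_mul] at h1
    exact ge_of_tendsto h1 (eventually_mem_nhdsWithin.mono fun C hC => h C hC)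

/-- The comparison costs a factor `C > 1` and a relative enlargement of the set; both are removed in
the limit. -/
theorem IsRegularPartition.limsup_scaledMean_le (hB : IsRegularPartition B)
    (hνπ : Asymptotics.IsEquivalent atTop (fun n => ν.real (B n)) fun n => π.real (B n))
    (hc : Tendsto c atTop atTop) (hρ : ∀ ε : ℝ, 0 < ε → ρ {w | ε ≤ ‖w‖} ≠ ∞)
    (hπ : ∀ ε : ℝ, 0 < ε → ∀ S, MeasurableSet S → (∀ w ∈ S, ε ≤ ‖w‖) →
      Tendsto (fun n => scaledMean π (c n) n S) atTop (𝓝 (ρ S))) {ε : ℝ} (hε : 0 < ε) :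
    limsup (fun n => scaledMean ν (c n) n {w | ε ≤ ‖w‖}) atTop ≤ ρ {w | ε ≤ ‖w‖} := by
  have hmeas : ∀ a : ℝ, MeasurableSet {w : EuclideanSpace ℝ (Fin d) | a ≤ ‖w‖} := fun a =>
    measurableSet_le measurable_const measurable_norm
  refine ge_of_tendsto' (tendsto_norm_ge_measure hρ hε) fun k => ?_
  set a : ℝ := 1 / (k + 2) with ha
  have ha0 : 0 < a := by positivity
  have ha1 : 0 < 1 - a := by
    rw [sub_pos, ha, div_lt_one (by positivity)]; linarith [(Nat.cast_nonneg k : (0 : ℝ) ≤ k)]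
  have hkey : ∀ C : ℝ, 1 < C → limsup (fun n => scaledMean ν (c n) n {w | ε ≤ ‖w‖}) atTop ≤
      ENNReal.ofReal C * ρ {w | (1 - a) * ε ≤ ‖w‖} := by
    intro C hC
    have h1 := hc.eventually (hB.eventually_measure_le (hνπ.eventually_measure_le hC) ha0 hε
      (S := {w | ε ≤ ‖w‖}) (S' := {w | (1 - a) * ε ≤ ‖w‖}) (fun x hx => hx) fun x hx y hy => by
        have h2 : ε ≤ ‖x‖ := hx
        have h3 := norm_sub_norm_le x y
        rw [norm_sub_rev] at h3
        show (1 - a) * ε ≤ ‖y‖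
        nlinarith)
    have h4 := ENNReal.Tendsto.const_mul (hπ ((1 - a) * ε) (by positivity) _ (hmeas _) fun w hw => hw)
      (Or.inr (ENNReal.ofReal_ne_top (r := C)))
    rw [← h4.limsup_eq]
    refine limsup_le_limsup ?_
    filter_upwards [h1] with n hn
    rw [scaledMean_apply (hmeas _), scaledMean_apply (hmeas _), mul_left_comm]
    gcongr
    exact hn
  exact ENNReal.le_of_forall_one_lt_ofReal_mul hkey

/-- The comparison with the two measures exchanged. `G` is exhausted by the sets `T k` of points
whose distance to the complement exceeds `‖x‖ / (k + 1)`, so a relative neighbourhood of `T k` stays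
in `G`. -/
theorem IsRegularPartition.le_liminf_scaledMean (hB : IsRegularPartition B)
    (hνπ : Asymptotics.IsEquivalent atTop (fun n => ν.real (B n)) fun n => π.real (B n))
    (hc : Tendsto c atTop atTop)
    (hπ : ∀ ε : ℝ, 0 < ε → ∀ S, MeasurableSet S → (∀ w ∈ S, ε ≤ ‖w‖) →
      Tendsto (fun n => scaledMean π (c n) n S) atTop (𝓝 (ρ S))) {ε : ℝ} (hε : 0 < ε)
    {G : Set (EuclideanSpace ℝ (Fin d))} (hG : IsOpen G) (hGε : ∀ w ∈ G, ε ≤ ‖w‖) :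
    ρ G ≤ liminf (fun n => scaledMean ν (c n) n G) atTop := by
  -- Nonemptiness matters because `Metric.infDist` to the empty set is `0` by default.
  have hne : (Gᶜ).Nonempty := ⟨0, fun h0 => by have := hGε 0 h0; simp at this; linarith⟩
  let T : ℕ → Set (EuclideanSpace ℝ (Fin d)) := fun k =>
    {x | 1 / (k + 1 : ℝ) * ‖x‖ < Metric.infDist x Gᶜ}
  have hT : ∀ k, MeasurableSet (T k) := fun k =>
    (isOpen_lt (by fun_prop) (Metric.continuous_infDist_pt _)).measurableSet
  have hTG : ∀ k, T k ⊆ G := fun k x hx => by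
    by_contra hxG
    have h1 : 1 / (k + 1 : ℝ) * ‖x‖ < Metric.infDist x Gᶜ := hx
    rw [Metric.infDist_zero_of_mem (show x ∈ Gᶜ from hxG)] at h1
    have : 0 ≤ 1 / (k + 1 : ℝ) * ‖x‖ := by positivity
    linarith
  have hmono : Monotone T := fun k l hkl x hx => by
    refine lt_of_le_of_lt ?_ (show 1 / (k + 1 : ℝ) * ‖x‖ < Metric.infDist x Gᶜ from hx)
    gcongr
  have hU : ⋃ k, T k = G := by
    refine Subset.antisymm (iUnion_subset hTG) fun x hx => ?_
    have hpos : 0 < Metric.infDist x Gᶜ :=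
      (hG.isClosed_compl.notMem_iff_infDist_pos hne).1 (by simpa using hx)
    have hlim : Tendsto (fun k : ℕ => 1 / (k + 1 : ℝ) * ‖x‖) atTop (𝓝 (0 * ‖x‖)) :=
      tendsto_one_div_add_atTop_nhds_zero_nat.mul_const _
    rw [zero_mul] at hlim
    obtain ⟨k, hk⟩ := (hlim.eventually_lt_const hpos).exists
    exact mem_iUnion.2 ⟨k, hk⟩
  have hlim := tendsto_measure_iUnion_atTop (μ := ρ) hmono
  rw [hU] at hlim
  refine le_of_tendsto' hlim fun k => ENNReal.le_of_forall_one_lt_ofReal_mul fun C hC => ?_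
  have h1 := hc.eventually (hB.eventually_measure_le (hνπ.symm.eventually_measure_le hC)
    (show 0 < 1 / (k + 1 : ℝ) by positivity) hε (S := T k) (S' := G) (fun x hx => hGε x (hTG k hx))
    fun x hx y hy => by
      by_contra hyG
      have h2 := Metric.infDist_le_dist_of_mem (x := x) (show y ∈ Gᶜ from hyG)
      rw [dist_comm, dist_eq_norm] at h2
      have h3 : 1 / (k + 1 : ℝ) * ‖x‖ < Metric.infDist x Gᶜ := hx
      linarith)
  have h4 := hπ ε hε _ (hT k) fun w hw => hGε w (hTG k hw)
  change ρ (T k) ≤ _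
  rw [← h4.liminf_eq, ← ENNReal.liminf_const_mul_of_ne_top ENNReal.ofReal_ne_top]
  refine liminf_le_liminf ?_
  filter_upwards [h1] with n hn
  rw [scaledMean_apply (hT k), scaledMean_apply hG.measurableSet, mul_left_comm]
  gcongr

end

/-- A lower bound for `b` turns convergence of the sum into an upper bound for `a`. Finiteness makes
the subtraction legitimate. -/
theorem ENNReal.tendsto_of_le_liminf_of_add {a b : ℕ → ℝ≥0∞} {A B : ℝ≥0∞} (hA : A ≠ ∞) (hB : B ≠ ∞)
    (ha : A ≤ liminf a atTop) (hb : B ≤ liminf b atTop)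
    (hab : Tendsto (fun n => a n + b n) atTop (𝓝 (A + B))) : Tendsto a atTop (𝓝 A) := by
  refine tendsto_order.2 ⟨fun x hx => eventually_lt_of_lt_liminf (hx.trans_le ha), fun x hx => ?_⟩
  obtain ⟨y, hAy, hyx⟩ := exists_between hx
  have hy : y ≠ ∞ := (hyx.trans_le le_top).ne
  have hδ : 0 < (y - A) / 2 := ENNReal.half_pos (tsub_pos_of_lt hAy).ne'
  have hδ' : (y - A) / 2 ≠ ∞ := (ENNReal.div_lt_top (ENNReal.sub_ne_top hy) two_ne_zero).ne
  have h1 : ∀ᶠ n in atTop, B ≤ b n + (y - A) / 2 := by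
    rcases eq_or_ne B 0 with rfl | hB0
    · exact Eventually.of_forall fun n => zero_le
    · have : B - (y - A) / 2 < B := ENNReal.sub_lt_self hB hB0 hδ.ne'
      filter_upwards [eventually_lt_of_lt_liminf (this.trans_le hb)] with n hn
      exact tsub_le_iff_right.1 hn.le
  have h2 : A + B < A + B + (y - A) / 2 :=
    ENNReal.lt_add_right (ENNReal.add_ne_top.2 ⟨hA, hB⟩) hδ.ne'
  filter_upwards [h1, hab.eventually_lt_const h2] with n hn1 hn2
  have hbn : b n ≠ ∞ := by
    intro h
    rw [h, add_top] at hn2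
    exact absurd hn2 not_top_lt
  have h3 : a n + b n < y + b n := by
    calc a n + b n < A + B + (y - A) / 2 := hn2
      _ ≤ A + (b n + (y - A) / 2) + (y - A) / 2 := by gcongr
      _ = A + ((y - A) / 2 + (y - A) / 2) + b n := by ring
      _ = y + b n := by rw [ENNReal.add_halves, add_tsub_cancel_of_le hAy.le]
  exact ((ENNReal.add_lt_add_iff_right hbn).1 h3).trans hyx

/-- A portmanteau theorem for finite measures. -/
theorem FiniteMeasure.tendsto_of_forall_isOpen_le_liminf {E : Type*} [MeasurableSpace E]
    [TopologicalSpace E] [OpensMeasurableSpace E] {μ : FiniteMeasure E} {μs : ℕ → FiniteMeasure E}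
    (h_opens : ∀ G, IsOpen G → (μ : Measure E) G ≤ liminf (fun n => (μs n : Measure E) G) atTop)
    (h_univ : limsup (fun n => (μs n : Measure E) univ) atTop ≤ (μ : Measure E) univ) :
    Tendsto μs atTop (𝓝 μ) := by
  have hmass : Tendsto (fun n => (μs n : Measure E) univ) atTop (𝓝 ((μ : Measure E) univ)) :=
    tendsto_of_le_liminf_of_limsup_le (h_opens _ isOpen_univ) h_univ
  rw [FiniteMeasure.tendsto_iff_forall_lintegral_tendsto]
  intro φ
  -- Lower semicontinuity is applied both to `φ` and to `M - φ`; their integrals add up to `M` times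
  -- the total mass, which converges.
  obtain ⟨M, hM⟩ : ∃ M : ℝ≥0, ∀ x, φ x ≤ M := ⟨_, fun x => φ.apply_le_nndist_zero x⟩
  have key : ∀ ξ : E → ℝ≥0, Continuous ξ →
      ∫⁻ x, ξ x ∂(μ : Measure E) ≤ liminf (fun n => ∫⁻ x, ξ x ∂(μs n : Measure E)) atTop := by
    intro ξ hξ
    have := lintegral_le_liminf_lintegral_of_forall_isOpen_measure_le_liminf_measure
      (f := fun x => (ξ x : ℝ)) (by fun_prop) (fun x => (ξ x).2) h_opens
    simpa using this
  have hfin : ∀ ξ : E → ℝ≥0, (∀ x, ξ x ≤ M) → ∫⁻ x, ξ x ∂(μ : Measure E) ≠ ∞ := by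
    intro ξ hξ
    have : ∫⁻ x, ξ x ∂(μ : Measure E) ≤ ∫⁻ _, M ∂(μ : Measure E) :=
      lintegral_mono fun x => ENNReal.coe_le_coe.2 (hξ x)
    rw [lintegral_const] at this
    exact (this.trans_lt (ENNReal.mul_lt_top ENNReal.coe_lt_top (measure_lt_top _ _))).ne
  have hadd : ∀ κ : Measure E, ∫⁻ x, φ x ∂κ + ∫⁻ x, ((M - φ x : ℝ≥0) : ℝ≥0∞) ∂κ = M * κ univ := by
    intro κ
    rw [← lintegral_add_left (by fun_prop), ← lintegral_const]
    refine lintegral_congr fun x => ?_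
    rw [← ENNReal.coe_add, add_tsub_cancel_of_le (hM x)]
  refine ENNReal.tendsto_of_le_liminf_of_add (hfin _ hM) (hfin (fun x => M - φ x) fun x => tsub_le_self)
    (key _ φ.continuous) (key (fun x => M - φ x) (by fun_prop)) ?_
  simp_rw [hadd]
  exact ENNReal.Tendsto.const_mul hmass (Or.inr ENNReal.coe_ne_top)

theorem compl_ball_eq {E : Type*} [SeminormedAddCommGroup E] (ε : ℝ) :
    (Metric.ball (0 : E) ε)ᶜ = {w | ε ≤ ‖w‖} := by
  ext w; simp

section
variable {d : ℕ} {c : ℕ → ℝ} {ν π : Measure (EuclideanSpace ℝ (Fin d))} [IsFiniteMeasure ν]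
  [IsFiniteMeasure π]
  {B : ℕ → Set (EuclideanSpace ℝ (Fin d))} {ρ : Measure (EuclideanSpace ℝ (Fin d))}

/-- The mean measures of the scaled sample clouds converge weakly on the complement of centered
balls. -/
theorem IsRegularPartition.tendsto_integral_scaledMean (hB : IsRegularPartition B)
    (hνπ : Asymptotics.IsEquivalent atTop (fun n => ν.real (B n)) fun n => π.real (B n))
    (hc : Tendsto c atTop atTop) (hρ : ∀ ε : ℝ, 0 < ε → ρ {w | ε ≤ ‖w‖} ≠ ∞)
    (hρs : ∀ ε : ℝ, 0 < ε → ρ {w | ‖w‖ = ε} = 0)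
    (hπ : ∀ ε : ℝ, 0 < ε → ∀ S, MeasurableSet S → (∀ w ∈ S, ε ≤ ‖w‖) →
      Tendsto (fun n => scaledMean π (c n) n S) atTop (𝓝 (ρ S))) {ε : ℝ} (hε : 0 < ε)
    (φ : BoundedContinuousFunction (EuclideanSpace ℝ (Fin d)) ℂ) :
    Tendsto (fun n => ∫ w in (Metric.ball 0 ε)ᶜ, φ w ∂(scaledMean ν (c n) n)) atTop
      (𝓝 (∫ w in (Metric.ball 0 ε)ᶜ, φ w ∂ρ)) := by
  have hF : MeasurableSet (Metric.ball (0 : EuclideanSpace ℝ (Fin d)) ε)ᶜ :=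
    Metric.isOpen_ball.measurableSet.compl
  have : IsFiniteMeasure (ρ.restrict (Metric.ball 0 ε)ᶜ) :=
    ⟨by rw [Measure.restrict_apply_univ, compl_ball_eq]; exact (hρ ε hε).lt_top⟩
  let μ : FiniteMeasure (EuclideanSpace ℝ (Fin d)) := ⟨ρ.restrict (Metric.ball 0 ε)ᶜ, this⟩
  let μs : ℕ → FiniteMeasure (EuclideanSpace ℝ (Fin d)) := fun n =>
    ⟨(scaledMean ν (c n) n).restrict (Metric.ball 0 ε)ᶜ, inferInstance⟩
  have key : Tendsto μs atTop (𝓝 μ) := by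
    refine FiniteMeasure.tendsto_of_forall_isOpen_le_liminf (fun G hG => ?_) ?_
    · change ρ.restrict (Metric.ball 0 ε)ᶜ G ≤
        liminf (fun n => (scaledMean ν (c n) n).restrict (Metric.ball 0 ε)ᶜ G) atTop
      -- The complement of the ball is closed; removing its bounding sphere, which is null for `ρ`,
      -- leaves an open set.
      have hG' : IsOpen (G ∩ {w | ε < ‖w‖}) := hG.inter (isOpen_lt continuous_const continuous_norm)
      have hsub : G ∩ {w | ε < ‖w‖} ⊆ G ∩ (Metric.ball 0 ε)ᶜ := by
        rw [compl_ball_eq]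
        exact inter_subset_inter_right _ fun w (hw : ε < ‖w‖) => hw.le
      calc ρ.restrict (Metric.ball 0 ε)ᶜ G = ρ (G ∩ (Metric.ball 0 ε)ᶜ) := Measure.restrict_apply' hF
        _ ≤ ρ ((G ∩ {w | ε < ‖w‖}) ∪ {w | ‖w‖ = ε}) := by
          refine measure_mono ?_
          rw [compl_ball_eq]
          rintro w ⟨hw, hw'⟩
          rcases (show ε ≤ ‖w‖ from hw').eq_or_lt with h | h
          · exact Or.inr h.symm
          · exact Or.inl ⟨hw, h⟩
        _ ≤ ρ (G ∩ {w | ε < ‖w‖}) := by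
          refine (measure_union_le _ _).trans ?_
          rw [hρs ε hε, add_zero]
        _ ≤ _ := hB.le_liminf_scaledMean hνπ hc hπ hε hG' fun w hw => le_of_lt hw.2
        _ ≤ _ := by
          refine liminf_le_liminf (Eventually.of_forall fun n => ?_)
          change _ ≤ (scaledMean ν (c n) n).restrict (Metric.ball 0 ε)ᶜ G
          rw [Measure.restrict_apply' hF]
          exact measure_mono hsub
    · change limsup (fun n => (scaledMean ν (c n) n).restrict (Metric.ball 0 ε)ᶜ univ) atTop ≤
        ρ.restrict (Metric.ball 0 ε)ᶜ univ
      simp_rw [Measure.restrict_apply_univ, compl_ball_eq]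
      exact hB.limsup_scaledMean_le hνπ hc hρ hπ hε
  exact (FiniteMeasure.tendsto_iff_forall_integral_rclike_tendsto ℂ).1 key φ

end

/-! ### Sample clouds -/

section
variable {d : ℕ} {Ω : Type*} {Z : ℕ → Ω → EuclideanSpace ℝ (Fin d)} {c : ℕ → ℝ}

theorem sampleCloud_apply {n : ℕ} {ω : Ω} {S : Set (EuclideanSpace ℝ (Fin d))}
    (hS : MeasurableSet S) : sampleCloud Z c n ω S =
      ∑ k ∈ Finset.range n, S.indicator 1 ((c n)⁻¹ • Z k ω) := by
  simp [sampleCloud, Measure.dirac_apply' _ hS]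

theorem integral_sampleCloud {n : ℕ} {ω : Ω} {S : Set (EuclideanSpace ℝ (Fin d))}
    (hS : MeasurableSet S) {φ : EuclideanSpace ℝ (Fin d) → ℝ} :
    ∫ w in S, φ w ∂(sampleCloud Z c n ω) =
      ∑ k ∈ Finset.range n, S.indicator φ ((c n)⁻¹ • Z k ω) := by
  rw [← integral_indicator hS, sampleCloud, integral_finsetSum_measure fun k _ =>
    integrable_dirac (by simp)]
  simp

variable [MeasurableSpace Ω] {P : Measure Ω} {ν : Measure (EuclideanSpace ℝ (Fin d))}

/-- The integral is a sum of independent, identically distributed terms. A point outside `S`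
contributes `exp 0 = 1`, so each factor is `1` plus an integral over `S`, and the `n` in
`scaledMean` is divided out. -/
theorem charFun_integral_sampleCloud [IsProbabilityMeasure P] (hZ : IsSample P Z ν) [IsProbabilityMeasure ν]
    {S : Set (EuclideanSpace ℝ (Fin d))} (hS : MeasurableSet S)
    {φ : EuclideanSpace ℝ (Fin d) → ℝ} (hφ : Measurable φ) (n : ℕ) (hn : n ≠ 0) (t : ℝ) :
    charFun (P.map fun ω => ∫ w in S, φ w ∂(sampleCloud Z c n ω)) t =
      (1 + (∫ w in S, (Complex.exp (t * φ w * Complex.I) - 1) ∂(scaledMean ν (c n) n)) / n) ^ n := by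
  have hm : Measurable fun z : EuclideanSpace ℝ (Fin d) => S.indicator φ ((c n)⁻¹ • z) :=
    (hφ.indicator hS).comp (measurable_const_smul _)
  have hind : iIndepFun (fun k ω => S.indicator φ ((c n)⁻¹ • Z k ω)) P :=
    hZ.indep.comp (fun _ z => S.indicator φ ((c n)⁻¹ • z)) fun _ => hm
  have hae : ∀ k, AEMeasurable (fun ω => S.indicator φ ((c n)⁻¹ • Z k ω)) P := fun k =>
    hm.comp_aemeasurable (hZ.hasLaw k).aemeasurable
  simp_rw [integral_sampleCloud hS]
  rw [iIndepFun.charFun_map_fun_finsetSum_eq_prod (fun k _ => hae k) (hind.restrict _)]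
  rw [Finset.prod_apply]
  have hone : ∀ k ∈ Finset.range n, charFun (P.map fun ω => S.indicator φ ((c n)⁻¹ • Z k ω)) t =
      1 + (∫ w in S, (Complex.exp (t * φ w * Complex.I) - 1) ∂(scaledMean ν (c n) n)) / n := by
    intro k _
    have h1 : P.map (fun ω => S.indicator φ ((c n)⁻¹ • Z k ω)) =
        ν.map fun z => S.indicator φ ((c n)⁻¹ • z) := by
      rw [← (hZ.hasLaw k).map_eq, AEMeasurable.map_map_of_aemeasurable hm.aemeasurable
        (hZ.hasLaw k).aemeasurable]
      rfl
    have hm2 : Measurable fun w : EuclideanSpace ℝ (Fin d) =>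
        Complex.exp (t * φ w * Complex.I) - 1 := by fun_prop
    have h2 : ∀ z, Complex.exp (t * (S.indicator φ ((c n)⁻¹ • z) : ℝ) * Complex.I) =
        1 + S.indicator (fun w => Complex.exp (t * φ w * Complex.I) - 1) ((c n)⁻¹ • z) := by
      intro z
      by_cases hz : (c n)⁻¹ • z ∈ S <;> simp [hz]
    have hb : ∀ w, ‖S.indicator (fun w => Complex.exp (t * φ w * Complex.I) - 1) w‖ ≤ 2 := by
      intro w
      refine (norm_indicator_le_norm_self _ _).trans ((norm_sub_le _ _).trans ?_)
      rw [← Complex.ofReal_mul, Complex.norm_exp_ofReal_mul_I]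
      norm_num
    have hint : Integrable (fun z => S.indicator (fun w => Complex.exp (t * φ w * Complex.I) - 1)
        ((c n)⁻¹ • z)) ν :=
      Integrable.of_bound ((hm2.indicator hS).comp (measurable_const_smul _)).aestronglyMeasurable 2
        (Eventually.of_forall fun z => hb _)
    rw [h1, charFun_apply_real, integral_map hm.aemeasurable (by fun_prop)]
    simp_rw [h2]
    rw [integral_add (integrable_const _) hint, integral_const, probReal_univ, one_smul,
      ← integral_indicator hS, scaledMean, integral_smul_measure, integral_map (by fun_prop)
        (hm2.indicator hS).aestronglyMeasurable]
    have hn' : (n : ℂ) ≠ 0 := by exact_mod_cast hn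
    rw [ENNReal.toReal_natCast, Complex.real_smul, Complex.ofReal_natCast,
      mul_div_cancel_left₀ _ hn']
  rw [Finset.prod_congr rfl hone, Finset.prod_const, Finset.card_range]

theorem aemeasurable_integral_sampleCloud (hZ : IsSample P Z ν)
    {S : Set (EuclideanSpace ℝ (Fin d))} (hS : MeasurableSet S)
    {φ : EuclideanSpace ℝ (Fin d) → ℝ} (hφ : Measurable φ) (n : ℕ) :
    AEMeasurable (fun ω => ∫ w in S, φ w ∂(sampleCloud Z c n ω)) P := by
  simp_rw [integral_sampleCloud hS]
  refine Finset.aemeasurable_fun_sum _ fun k _ => ?_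
  exact ((hφ.indicator hS).comp (measurable_const_smul _)).comp_aemeasurable (hZ.hasLaw k).aemeasurable

end

/-! ### Poisson point processes -/

namespace IsPoissonProcess

variable {E Ω : Type*} [MeasurableSpace E] [MeasurableSpace Ω] {P : Measure Ω}
  {N : Ω → Measure E} {ρ : Measure E}

theorem measurable_apply (h : IsPoissonProcess P N ρ) {A : Set E} (hA : MeasurableSet A) :
    Measurable fun ω => N ω A :=
  (Measure.measurable_coe hA).comp h.measurable

theorem ae_lt_top (h : IsPoissonProcess P N ρ) {A : Set E} (hA : MeasurableSet A)
    (hρ : ρ A ≠ ∞) : ∀ᵐ ω ∂P, N ω A < ∞ := by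
  have h1 : ∀ᵐ x ∂(P.map fun ω => N ω A), x < ∞ := by
    rw [h.poisson A hA hρ, ae_map_iff (by fun_prop) measurableSet_Iio]
    exact Eventually.of_forall fun k => ENNReal.natCast_lt_top k
  exact ae_of_ae_map (h.measurable_apply hA).aemeasurable h1

theorem charFun_real (h : IsPoissonProcess P N ρ) {A : Set E} (hA : MeasurableSet A)
    (hρ : ρ A ≠ ∞) (t : ℝ) :
    charFun (P.map fun ω => (N ω).real A) t =
      Complex.exp (ρ.real A * (Complex.exp (t * Complex.I) - 1)) := by
  have h1 : P.map (fun ω => (N ω).real A) =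
      (poissonMeasure (ρ A).toNNReal).map (fun k : ℕ => (k : ℝ)) := by
    have : P.map (fun ω => (N ω).real A) = (P.map fun ω => N ω A).map ENNReal.toReal := by
      rw [Measure.map_map ENNReal.measurable_toReal (h.measurable_apply hA)]
      rfl
    rw [this, h.poisson A hA hρ, Measure.map_map ENNReal.measurable_toReal (by fun_prop)]
    congr 1
  rw [h1, charFun_map_cast_poissonMeasure]
  rfl

theorem iIndepFun_of_fintype (h : IsPoissonProcess P N ρ) {ι : Type*} [Fintype ι] {A : ι → Set E}
    (hA : ∀ j, MeasurableSet (A j)) (hd : Pairwise (Function.onFun Disjoint A)) :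
    iIndepFun (fun j ω => N ω (A j)) P := by
  let e := Fintype.equivFin ι
  have := (h.indep _ (fun j => A (e.symm j)) (fun j => hA _)
    fun i j hij => hd (e.symm.injective.ne hij)).precomp e.injective
  simpa using this

/-- The integral is a linear combination of the counts on disjoint level sets, which are independent
Poisson variables; the characteristic functions multiply. -/
theorem integral_exp_simpleFunc [IsProbabilityMeasure P] (h : IsPoissonProcess P N ρ) {F : Set E}
    (hF : MeasurableSet F) (hρ : ρ F ≠ ∞) (s : SimpleFunc E ℝ) (t : ℝ) :
    ∫ ω, Complex.exp (t * (∫ w in F, s w ∂(N ω) : ℝ) * Complex.I) ∂P =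
      Complex.exp (∫ w in F, (Complex.exp (t * s w * Complex.I) - 1) ∂ρ) := by
  let A : s.range → Set E := fun v => s ⁻¹' {(v : ℝ)} ∩ F
  have hA : ∀ v, MeasurableSet (A v) := fun v => (s.measurableSet_fiber v).inter hF
  have hAρ : ∀ v, ρ (A v) ≠ ∞ := fun v => measure_ne_top_of_subset inter_subset_right hρ
  have hdis : Pairwise (Function.onFun Disjoint A) := fun v w hvw => by
    refine Disjoint.mono inter_subset_left inter_subset_left ?_
    exact Disjoint.preimage _ (by simpa using fun hh => hvw (Subtype.ext hh))
  have hmr : ∀ v, Measurable fun ω => (N ω).real (A v) := fun v =>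
    (h.measurable_apply (hA v)).ennreal_toReal
  have hind : iIndepFun (fun (v : s.range) ω => (v : ℝ) * (N ω).real (A v)) P :=
    (h.iIndepFun_of_fintype hA hdis).comp (fun v x => (v : ℝ) * x.toReal) fun v => by fun_prop
  -- Where `N ω F` is infinite, integrability may fail and the Bochner integral defaults to `0`;
  -- this event is null.
  have hsum : ∀ᵐ ω ∂P, ∫ w in F, s w ∂(N ω) = ∑ v : s.range, (v : ℝ) * (N ω).real (A v) := by
    filter_upwards [h.ae_lt_top hF hρ] with ω hω
    have : IsFiniteMeasure ((N ω).restrict F) := ⟨by rwa [Measure.restrict_apply_univ]⟩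
    rw [← SimpleFunc.integral_eq_integral s (SimpleFunc.integrable_of_isFiniteMeasure s),
      SimpleFunc.integral_eq, ← Finset.sum_coe_sort]
    refine Finset.sum_congr rfl fun v _ => ?_
    rw [measureReal_restrict_apply (s.measurableSet_fiber _), smul_eq_mul, mul_comm]
  have hsum' : ∫ w in F, (Complex.exp (t * s w * Complex.I) - 1) ∂ρ =
      ∑ v : s.range, ρ.real (A v) * (Complex.exp (t * v * Complex.I) - 1) := by
    have : IsFiniteMeasure (ρ.restrict F) := ⟨by rw [Measure.restrict_apply_univ]; exact hρ.lt_top⟩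
    have h0 : (fun w => Complex.exp (t * s w * Complex.I) - 1) =
        s.map fun v : ℝ => Complex.exp (t * v * Complex.I) - 1 := by ext; simp
    rw [h0, ← SimpleFunc.integral_eq_integral _ (SimpleFunc.integrable_of_isFiniteMeasure _),
      SimpleFunc.map_integral s _ (SimpleFunc.integrable_of_isFiniteMeasure _) (by simp),
      ← Finset.sum_coe_sort]
    refine Finset.sum_congr rfl fun v _ => ?_
    rw [measureReal_restrict_apply (s.measurableSet_fiber _), Complex.real_smul]
  have hprod := congrFun (iIndepFun.charFun_map_fun_sum_eq_prod
    (fun v => ((hmr v).const_mul (v : ℝ)).aemeasurable) hind) t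
  rw [charFun_apply_real, integral_map (Finset.aemeasurable_fun_sum _ fun v _ =>
    ((hmr v).const_mul (v : ℝ)).aemeasurable) (by fun_prop), Finset.prod_apply] at hprod
  rw [hsum', Complex.exp_sum, integral_congr_ae (hsum.mono fun ω hω => by rw [hω]), hprod]
  refine Finset.prod_congr rfl fun v _ => ?_
  have h2 := h.charFun_real (hA v) (hAρ v) (t * v)
  rw [charFun_apply_real, integral_map (hmr v).aemeasurable (by fun_prop)] at h2
  rw [charFun_apply_real, integral_map ((hmr v).const_mul (v : ℝ)).aemeasurable (by fun_prop)]
  push_cast at h2 ⊢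
  rw [← h2]
  simp_rw [mul_assoc]

variable {φ : E → ℝ} {C : ℝ}

theorem tendsto_integral_approxBounded (hφ : StronglyMeasurable φ)
    (hC : ∀ x, ‖φ x‖ ≤ C) (κ : Measure E) [IsFiniteMeasure κ] :
    Tendsto (fun k => ∫ w, hφ.approxBounded C k w ∂κ) atTop (𝓝 (∫ w, φ w ∂κ)) := by
  rcases isEmpty_or_nonempty E with hE | ⟨⟨x⟩⟩
  · simp [Measure.eq_zero_of_isEmpty κ]
  have hC0 : 0 ≤ C := (norm_nonneg _).trans (hC x)
  exact tendsto_integral_of_dominated_convergence (fun _ => C)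
    (fun k => (hφ.approxBounded C k).stronglyMeasurable.aestronglyMeasurable)
    (integrable_const _) (fun k => Eventually.of_forall fun w => hφ.norm_approxBounded_le hC0 k w)
    (Eventually.of_forall fun w => hφ.tendsto_approxBounded_of_norm_le (hC w))

theorem aemeasurable_integral (h : IsPoissonProcess P N ρ) {F : Set E}
    (hF : MeasurableSet F) (hρ : ρ F ≠ ∞) (hφ : StronglyMeasurable φ) (hC : ∀ x, ‖φ x‖ ≤ C) :
    AEMeasurable (fun ω => ∫ w in F, φ w ∂(N ω)) P := by
  refine aemeasurable_of_tendsto_metrizable_ae atTop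
    (f := fun k ω => ∫ w in F, hφ.approxBounded C k w ∂(N ω)) (fun k => ?_) ?_
  · set s := hφ.approxBounded C k
    have hm : Measurable fun ω => ∑ v ∈ s.range, (N ω).real (s ⁻¹' {v} ∩ F) • v :=
      Finset.measurable_fun_sum _ fun v _ =>
        ((h.measurable_apply ((s.measurableSet_fiber v).inter hF)).ennreal_toReal).smul_const v
    refine hm.aemeasurable.congr ?_
    filter_upwards [h.ae_lt_top hF hρ] with ω hω
    have : IsFiniteMeasure ((N ω).restrict F) := ⟨by rwa [Measure.restrict_apply_univ]⟩
    rw [← SimpleFunc.integral_eq_integral s (SimpleFunc.integrable_of_isFiniteMeasure s),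
      SimpleFunc.integral_eq]
    refine Finset.sum_congr rfl fun v _ => ?_
    rw [measureReal_restrict_apply (s.measurableSet_fiber _)]
  · filter_upwards [h.ae_lt_top hF hρ] with ω hω
    have : IsFiniteMeasure ((N ω).restrict F) := ⟨by rwa [Measure.restrict_apply_univ]⟩
    exact tendsto_integral_approxBounded hφ hC _

/-- The characteristic function of the integral of a bounded function with respect to a Poisson
point process, over a set of finite mean measure. -/
theorem charFun_integral [IsProbabilityMeasure P] (h : IsPoissonProcess P N ρ) {F : Set E}
    (hF : MeasurableSet F) (hρ : ρ F ≠ ∞) (hφ : StronglyMeasurable φ) (hC : ∀ x, ‖φ x‖ ≤ C)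
    (t : ℝ) : charFun (P.map fun ω => ∫ w in F, φ w ∂(N ω)) t =
      Complex.exp (∫ w in F, (Complex.exp (t * φ w * Complex.I) - 1) ∂ρ) := by
  rw [charFun_apply_real, integral_map (h.aemeasurable_integral hF hρ hφ hC) (by fun_prop)]
  have hρF : IsFiniteMeasure (ρ.restrict F) :=
    ⟨by rw [Measure.restrict_apply_univ]; exact hρ.lt_top⟩
  set s := hφ.approxBounded C
  have hnorm : ∀ x : ℝ, ‖Complex.exp (t * x * Complex.I)‖ = 1 := fun x => by
    rw [← Complex.ofReal_mul, Complex.norm_exp_ofReal_mul_I]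
  have hcont : Continuous fun x : ℝ => Complex.exp (t * x * Complex.I) := by fun_prop
  rcases isEmpty_or_nonempty E with hE | ⟨⟨x⟩⟩
  · have : ∀ κ : Measure E, κ = 0 := fun κ => Measure.eq_zero_of_isEmpty κ
    simp [this]
  have hC0 : 0 ≤ C := (norm_nonneg _).trans (hC x)
  have h1 : Tendsto (fun k => ∫ ω, Complex.exp (t * (∫ w in F, s k w ∂(N ω) : ℝ) * Complex.I) ∂P)
      atTop (𝓝 (∫ ω, Complex.exp (t * (∫ w in F, φ w ∂(N ω) : ℝ) * Complex.I) ∂P)) := by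
    refine tendsto_integral_of_dominated_convergence (fun _ => 1) (fun k => ?_)
      (integrable_const _) (fun k => Eventually.of_forall fun ω => (hnorm _).le) ?_
    · exact hcont.comp_aestronglyMeasurable
        (h.aemeasurable_integral hF hρ (s k).stronglyMeasurable
          fun x => hφ.norm_approxBounded_le hC0 k x).aestronglyMeasurable
    · filter_upwards [h.ae_lt_top hF hρ] with ω hω
      have : IsFiniteMeasure ((N ω).restrict F) := ⟨by rwa [Measure.restrict_apply_univ]⟩
      exact (hcont.tendsto _).comp (tendsto_integral_approxBounded hφ hC _)
  have h2 : Tendsto (fun k => ∫ w in F, (Complex.exp (t * s k w * Complex.I) - 1) ∂ρ)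
      atTop (𝓝 (∫ w in F, (Complex.exp (t * φ w * Complex.I) - 1) ∂ρ)) := by
    refine tendsto_integral_of_dominated_convergence (fun _ => 2) (fun k => ?_)
      (integrable_const _) (fun k => Eventually.of_forall fun w => ?_)
      (Eventually.of_forall fun w => ?_)
    · exact ((hcont.sub continuous_const).comp_stronglyMeasurable
        (s k).stronglyMeasurable).aestronglyMeasurable
    · refine (norm_sub_le _ _).trans ?_
      rw [hnorm]
      norm_num
    · exact ((hcont.sub continuous_const).tendsto _).comp
        (hφ.tendsto_approxBounded_of_norm_le (hC w))
  refine tendsto_nhds_unique h1 ?_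
  simp_rw [h.integral_exp_simpleFunc hF hρ]
  exact (Complex.continuous_exp.tendsto _).comp h2

end IsPoissonProcess

/-! ### Convergence of sample clouds -/

section
variable {d : ℕ} {c : ℕ → ℝ} {ν π : Measure (EuclideanSpace ℝ (Fin d))}
  {Ω : Type*} [MeasurableSpace Ω] {P : Measure Ω} [IsProbabilityMeasure P]
  {Z : ℕ → Ω → EuclideanSpace ℝ (Fin d)}
  {B : ℕ → Set (EuclideanSpace ℝ (Fin d))} {ρ : Measure (EuclideanSpace ℝ (Fin d))}

theorem IsSample.convergesOffBalls [IsProbabilityMeasure ν] (hZ : IsSample P Z ν)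
    (hρ : ∀ ε : ℝ, 0 < ε → ρ {w | ε ≤ ‖w‖} ≠ ∞)
    (hν : ∀ ε : ℝ, 0 < ε → ∀ φ : BoundedContinuousFunction (EuclideanSpace ℝ (Fin d)) ℂ,
      Tendsto (fun n => ∫ w in (Metric.ball 0 ε)ᶜ, φ w ∂(scaledMean ν (c n) n)) atTop
        (𝓝 (∫ w in (Metric.ball 0 ε)ᶜ, φ w ∂ρ)))
    {Ω' : Type*} [MeasurableSpace Ω'] {P' : Measure Ω'} [IsProbabilityMeasure P']
    {N : Ω' → Measure (EuclideanSpace ℝ (Fin d))} (hN : IsPoissonProcess P' N ρ) :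
    ConvergesOffBalls P (sampleCloud Z c) P' N := by
  intro ε hε φ
  have hF : MeasurableSet (Metric.ball (0 : EuclideanSpace ℝ (Fin d)) ε)ᶜ :=
    Metric.isOpen_ball.measurableSet.compl
  have hρF : ρ (Metric.ball 0 ε)ᶜ ≠ ∞ := by rw [compl_ball_eq]; exact hρ ε hε
  have hφ := φ.continuous.measurable
  have hφs := φ.continuous.stronglyMeasurable
  refine ⟨fun n => aemeasurable_integral_sampleCloud hZ hF hφ n,
    hN.aemeasurable_integral hF hρF hφs φ.norm_coe_le_norm, ?_⟩
  refine ProbabilityMeasure.tendsto_iff_tendsto_charFun.2 fun t => ?_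
  change Tendsto (fun n => charFun (P.map fun ω =>
    ∫ w in (Metric.ball 0 ε)ᶜ, φ w ∂(sampleCloud Z c n ω)) t) atTop
    (𝓝 (charFun (P'.map fun ω => ∫ w in (Metric.ball 0 ε)ᶜ, φ w ∂(N ω)) t))
  rw [hN.charFun_integral hF hρF hφs φ.norm_coe_le_norm]
  -- Since `χ` is bounded and continuous, weak convergence of the mean measures applies to it, and
  -- `(1 + a n / n) ^ n` tends to the exponential of the limit of `a n`.
  let χ : BoundedContinuousFunction (EuclideanSpace ℝ (Fin d)) ℂ :=
    BoundedContinuousFunction.ofNormedAddCommGroup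
      (fun w => Complex.exp (t * φ w * Complex.I) - 1) (by fun_prop) 2 fun w => by
        refine (norm_sub_le _ _).trans ?_
        rw [← Complex.ofReal_mul, Complex.norm_exp_ofReal_mul_I]
        norm_num
  have h1 := hν ε hε χ
  have h2 := Complex.tendsto_one_add_pow_exp_of_tendsto
    (g := fun n => (∫ w in (Metric.ball 0 ε)ᶜ, χ w ∂(scaledMean ν (c n) n)) / n)
    (h1.congr' (by
      filter_upwards [eventually_ne_atTop 0] with n hn
      have : (n : ℂ) ≠ 0 := by exact_mod_cast hn
      field_simp))
  refine h2.congr' ?_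
  filter_upwards [eventually_ne_atTop 0] with n hn
  exact (charFun_integral_sampleCloud hZ hF hφ n hn t).symm

omit [IsProbabilityMeasure P] in
theorem IsSample.measure_preimage_smul (hX : IsSample P Z ν) (k : ℕ)
    {S : Set (EuclideanSpace ℝ (Fin d))} (hS : MeasurableSet S) (a : ℝ) :
    P {ω | a⁻¹ • Z k ω ∈ S} = ν {x | a⁻¹ • x ∈ S} := by
  rw [← (hX.hasLaw k).map_eq, Measure.map_apply_of_aemeasurable (hX.hasLaw k).aemeasurable
    (measurableSet_preimage_smul hS _)]
  rfl

omit [IsProbabilityMeasure P] in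
theorem IsSample.measure_sampleCloud_pos_le (hX : IsSample P Z ν)
    {S : Set (EuclideanSpace ℝ (Fin d))} (hS : MeasurableSet S) (n : ℕ) :
    P {ω | 0 < sampleCloud Z c n ω S} ≤ scaledMean ν (c n) n S := by
  have hsub : {ω | 0 < sampleCloud Z c n ω S} ⊆
      ⋃ k ∈ Finset.range n, {ω | (c n)⁻¹ • Z k ω ∈ S} := by
    intro ω hω
    rw [mem_ofPred_eq, sampleCloud_apply hS] at hω
    obtain ⟨k, hk, hk'⟩ := Finset.exists_ne_zero_of_sum_ne_zero hω.ne'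
    exact mem_biUnion (x := k) hk (mem_of_indicator_ne_zero hk' : (c n)⁻¹ • Z k ω ∈ S)
  calc P {ω | 0 < sampleCloud Z c n ω S} ≤ ∑ k ∈ Finset.range n, P {ω | (c n)⁻¹ • Z k ω ∈ S} :=
        (measure_mono hsub).trans (measure_biUnion_finset_le _ _)
    _ = _ := by simp_rw [hX.measure_preimage_smul _ hS, scaledMean_apply hS]; simp

/-- A Chernoff bound at parameter `-1`: the count `N` is a sum of independent indicators of
probability `q`, so `E exp (-N) = (1 - (1 - exp (-1)) * q) ^ n`, and `1 + x ≤ exp x`. -/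
theorem IsSample.measureReal_sampleCloud_le (hX : IsSample P Z ν) [IsProbabilityMeasure ν]
    {S : Set (EuclideanSpace ℝ (Fin d))} (hS : MeasurableSet S) (m n : ℕ) :
    P.real {ω | sampleCloud Z c n ω S ≤ m} ≤
      Real.exp m * Real.exp (-((1 - Real.exp (-1)) * (n * ν.real {x | (c n)⁻¹ • x ∈ S}))) := by
  let ξ : EuclideanSpace ℝ (Fin d) → ℝ := fun z => S.indicator 1 ((c n)⁻¹ • z)
  have hξ : Measurable ξ := (measurable_one.indicator hS).comp (measurable_const_smul _)
  let Y : ℕ → Ω → ℝ := fun k ω => ξ (Z k ω)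
  have hY : ∀ k, AEMeasurable (Y k) P := fun k => hξ.comp_aemeasurable (hX.hasLaw k).aemeasurable
  have hY0 : ∀ k ω, 0 ≤ Y k ω := fun k ω => indicator_nonneg (fun _ _ => zero_le_one) _
  have hind : iIndepFun Y P := hX.indep.comp (fun _ => ξ) fun _ => hξ
  have hsum : ∀ ω, (sampleCloud Z c n ω S) = ENNReal.ofReal (∑ k ∈ Finset.range n, Y k ω) := by
    intro ω
    rw [sampleCloud_apply hS, ENNReal.ofReal_sum_of_nonneg fun k _ => hY0 k ω]
    refine Finset.sum_congr rfl fun k _ => ?_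
    by_cases h : (c n)⁻¹ • Z k ω ∈ S <;> simp [Y, ξ, h]
  have hset : {ω | sampleCloud Z c n ω S ≤ m} = {ω | (∑ k ∈ Finset.range n, Y k) ω ≤ m} := by
    ext ω
    rw [mem_ofPred_eq, mem_ofPred_eq, hsum, Finset.sum_apply, ENNReal.ofReal_le_natCast]
  set q := ν.real {x | (c n)⁻¹ • x ∈ S} with hq
  have hmgf : ∀ k, mgf (Y k) P (-1) = 1 - (1 - Real.exp (-1)) * q := by
    intro k
    have h1 : ∫ ω, Real.exp (-1 * ξ (Z k ω)) ∂P = ∫ z, Real.exp (-1 * ξ z) ∂ν := by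
      rw [← (hX.hasLaw k).map_eq, integral_map (hX.hasLaw k).aemeasurable (by fun_prop)]
    have h2 : ∀ z, Real.exp (-1 * ξ z) =
        1 - (1 - Real.exp (-1)) * {x | (c n)⁻¹ • x ∈ S}.indicator 1 z := by
      intro z
      by_cases h : (c n)⁻¹ • z ∈ S <;> simp [ξ, h]
    have hSm := measurableSet_preimage_smul hS (c n)⁻¹
    have hI : Integrable ({x | (c n)⁻¹ • x ∈ S}.indicator (1 : EuclideanSpace ℝ (Fin d) → ℝ)) ν :=
      (integrable_const (1 : ℝ)).indicator hSm
    rw [mgf, h1]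
    simp_rw [h2]
    rw [integral_sub (integrable_const _) (hI.const_mul _),
      integral_const_mul, integral_indicator_one hSm]
    simp [hq]
  have hint : Integrable (fun ω => Real.exp (-1 * (∑ k ∈ Finset.range n, Y k) ω)) P := by
    have hm : AEMeasurable (∑ k ∈ Finset.range n, Y k) P :=
      Finset.aemeasurable_sum _ fun k _ => hY k
    refine Integrable.of_bound (by fun_prop) 1 (Eventually.of_forall fun ω => ?_)
    rw [Real.norm_of_nonneg (Real.exp_pos _).le, Real.exp_le_one_iff, Finset.sum_apply]
    have : 0 ≤ ∑ k ∈ Finset.range n, Y k ω :=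
      Finset.sum_nonneg fun k _ => hY0 k ω
    linarith
  have h3 := measure_le_le_exp_mul_mgf (m : ℝ) (by norm_num : (-1 : ℝ) ≤ 0) hint
  rw [hind.mgf_sum₀ hY, Finset.prod_congr rfl fun k _ => hmgf k, Finset.prod_const,
    Finset.card_range, neg_neg, one_mul] at h3
  rw [hset]
  refine h3.trans ?_
  have hq1 : q ≤ 1 := measureReal_le_one
  have he : 0 < Real.exp (-1) := Real.exp_pos _
  have he1 : Real.exp (-1) ≤ 1 := Real.exp_le_one_iff.2 (by norm_num)
  have hq0 : 0 ≤ q := measureReal_nonneg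
  gcongr
  calc (1 - (1 - Real.exp (-1)) * q) ^ n ≤ Real.exp (-((1 - Real.exp (-1)) * q)) ^ n := by
        refine pow_le_pow_left₀ (by nlinarith) ?_ n
        linarith [Real.add_one_le_exp (-((1 - Real.exp (-1)) * q))]
    _ = _ := by rw [← Real.exp_nat_mul]; ring_nf

theorem IsSample.tendsto_measure_sampleCloud (hX : IsSample P Z ν) [IsProbabilityMeasure ν]
    {S : Set (EuclideanSpace ℝ (Fin d))} (hS : MeasurableSet S)
    (hν : Tendsto (fun n : ℕ => n * ν.real {x | (c n)⁻¹ • x ∈ S}) atTop atTop) (m : ℕ) :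
    Tendsto (fun n => P {ω | (m : ℝ≥0∞) < sampleCloud Z c n ω S}) atTop (𝓝 1) := by
  have he : 0 < 1 - Real.exp (-1) := sub_pos.2 (Real.exp_zero ▸ Real.exp_lt_exp.2 (by norm_num))
  have h1 : Tendsto (fun n => P.real {ω | sampleCloud Z c n ω S ≤ m}) atTop (𝓝 0) := by
    refine squeeze_zero (fun n => measureReal_nonneg)
      (fun n => hX.measureReal_sampleCloud_le hS m n) ?_
    have := (Real.tendsto_exp_neg_atTop_nhds_zero.comp (hν.const_mul_atTop he)).const_mul
      (Real.exp m)
    rwa [mul_zero] at this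
  have h2 : Tendsto (fun n => P {ω | sampleCloud Z c n ω S ≤ m}) atTop (𝓝 0) := by
    have := ENNReal.tendsto_ofReal h1
    rw [ENNReal.ofReal_zero] at this
    exact this.congr fun n => ofReal_measureReal
  have h3 := ENNReal.Tendsto.sub tendsto_const_nhds h2 (Or.inl ENNReal.one_ne_top)
  rw [tsub_zero] at h3
  refine tendsto_of_tendsto_of_tendsto_of_le_of_le h3 tendsto_const_nhds (fun n => ?_)
    fun n => prob_le_one
  rw [tsub_le_iff_right, ← measure_univ (μ := P)]
  refine (measure_mono fun ω _ => ?_).trans (measure_union_le _ _)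
  exact lt_or_ge (m : ℝ≥0∞) (sampleCloud Z c n ω S)

end

/-! ### The limit set -/

section
variable {d : ℕ} {lam θ : ℝ}

/-- The set is closed, and it lies in the unit cube: `∑ |u i| ^ θ ≤ d * ‖u‖_∞ ^ θ` turns the
defining inequality into `lam * ‖u‖_∞ ^ θ ≤ lam`. -/
theorem isCompact_limitSet (hlam : 0 < lam) (hθ : 0 < θ) :
    IsCompact (limitSet d lam θ) := by
  have hc : Continuous fun x : ℝ => x ^ θ := Real.continuous_rpow_const hθ.le
  refine (isCompact_closedBlock (fun _ => -1) fun _ => 1).of_isClosed_subset ?_ fun u hu i => ?_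
  · refine isClosed_le (continuous_const.mul (hc.comp (by fun_prop)))
      ((continuous_finsetSum _ fun i _ => hc.comp ?_).add continuous_const)
    fun_prop
  · refine abs_le.1 ?_
    refine (IsLogScale.abs_le_norm u i).trans ?_
    by_contra! h1
    have hu' : (lam + (d : ℝ)) * ‖(WithLp.ofLp u : Fin d → ℝ)‖ ^ θ ≤ ∑ i, |u i| ^ θ + lam := hu
    have h2 : ∑ i, |u i| ^ θ ≤ ∑ _i : Fin d, ‖(WithLp.ofLp u : Fin d → ℝ)‖ ^ θ := by
      gcongr with i
      exact IsLogScale.abs_le_norm u i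
    simp only [Finset.sum_const, Finset.card_univ, Fintype.card_fin, nsmul_eq_mul] at h2
    have h3 := Real.one_lt_rpow h1 hθ
    nlinarith

theorem zero_mem_limitSet (hlam : 0 < lam) (hθ : 0 < θ) : (0 : EuclideanSpace ℝ (Fin d)) ∈ limitSet d lam θ := by
  simp [limitSet, Real.zero_rpow hθ.ne', hlam.le]

/-- Points of the limit set are limits of points off the coordinate hyperplanes which satisfy the
defining inequality strictly. -/
theorem exists_strict_near_of_mem_limitSet (hlam : 0 < lam) (hθ : 0 < θ)
    {p : EuclideanSpace ℝ (Fin d)} (hp : p ∈ limitSet d lam θ) {ε : ℝ} (hε : 0 < ε) :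
    ∃ u : EuclideanSpace ℝ (Fin d), ‖u - p‖ < ε ∧ (∀ i, u i ≠ 0) ∧
      (lam + (d : ℝ)) * ‖(WithLp.ofLp u : Fin d → ℝ)‖ ^ θ < ∑ i, |u i| ^ θ + lam := by
  have hc : Continuous fun x : ℝ => x ^ θ := Real.continuous_rpow_const hθ.le
  -- `F` is homogeneous of degree `θ` and `F p ≤ lam` with `lam > 0`, so shrinking `p` by `t < 1`
  -- makes the inequality strict.
  let F : EuclideanSpace ℝ (Fin d) → ℝ := fun u =>
    (lam + (d : ℝ)) * ‖(WithLp.ofLp u : Fin d → ℝ)‖ ^ θ - ∑ i, |u i| ^ θ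
  have hF : Continuous F := by
    refine (continuous_const.mul (hc.comp (by fun_prop))).sub
      (continuous_finsetSum _ fun i _ => hc.comp ?_)
    fun_prop
  have hFp : F p ≤ lam := by
    have : (lam + (d : ℝ)) * ‖(WithLp.ofLp p : Fin d → ℝ)‖ ^ θ ≤ ∑ i, |p i| ^ θ + lam := hp
    simp only [F]
    linarith
  obtain ⟨t, ht0, ht1, ht⟩ : ∃ t : ℝ, 0 < t ∧ t < 1 ∧ ‖t • p - p‖ < ε := by
    have h1 : Tendsto (fun t : ℝ => ‖t • p - p‖) (𝓝[<] 1) (𝓝 ‖(1 : ℝ) • p - p‖) :=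
      ((by fun_prop : Continuous fun t : ℝ => ‖t • p - p‖).tendsto 1).mono_left nhdsWithin_le_nhds
    rw [one_smul, sub_self, norm_zero] at h1
    obtain ⟨t, h2, h3, h4⟩ := ((h1.eventually_lt_const hε).and
      (eventually_mem_nhdsWithin.and ((tendsto_nhdsWithin_of_tendsto_nhds
        tendsto_id).eventually_const_lt (zero_lt_one' ℝ)))).exists
    exact ⟨t, h4, h3, h2⟩
  have hFt : F (t • p) < lam := by
    have h1 : F (t • p) = t ^ θ * F p := by
      simp only [F, WithLp.ofLp_smul, norm_smul, PiLp.smul_apply, smul_eq_mul, abs_mul,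
        Real.norm_eq_abs, abs_of_pos ht0]
      rw [Real.mul_rpow ht0.le (norm_nonneg _), mul_sub, Finset.mul_sum]
      simp_rw [Real.mul_rpow ht0.le (abs_nonneg _)]
      ring
    have h2 : t ^ θ < 1 := Real.rpow_lt_one ht0.le ht1 hθ
    have h3 : 0 < t ^ θ := Real.rpow_pos_of_pos ht0 θ
    rw [h1]
    nlinarith
  -- The signs of `s` agree with those of `p`, so a step along `s` moves every coordinate away from
  -- zero.
  let s : EuclideanSpace ℝ (Fin d) := WithLp.toLp 2 fun i => if 0 ≤ p i then 1 else -1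
  have hlim : Tendsto (fun τ : ℝ => t • p + τ • s) (𝓝[>] 0) (𝓝 (t • p)) := by
    have := ((by fun_prop : Continuous fun τ : ℝ => t • p + τ • s).tendsto 0).mono_left
      (nhdsWithin_le_nhds (s := Ioi 0))
    simpa using this
  have h1 := ((hF.tendsto _).comp hlim).eventually_lt_const hFt
  have h2 := ((by fun_prop : Continuous fun u => ‖u - p‖).tendsto _ |>.comp hlim).eventually_lt_const ht
  obtain ⟨τ, hτ1, hτ2, hτ0⟩ := (h1.and (h2.and eventually_mem_nhdsWithin)).exists
  have hτ0 : 0 < τ := hτ0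
  refine ⟨t • p + τ • s, hτ2, fun i => ?_, ?_⟩
  · simp only [PiLp.add_apply, PiLp.smul_apply, smul_eq_mul, s]
    split_ifs with hi
    · positivity
    · have : t * p i < 0 := mul_neg_of_pos_of_neg ht0 (not_le.1 hi)
      linarith
  · have : F (t • p + τ • s) < lam := hτ1
    simp only [F] at this
    linarith

end

/-! ### Convergence onto the limit set -/

namespace StandardSetup

variable {d : ℕ} {lam θ : ℝ} {D : Set (EuclideanSpace ℝ (Fin d))}
  {f g : EuclideanSpace ℝ (Fin d) → ℝ} {f0 g0 ψ : ℝ → ℝ} {r : ℕ → ℝ}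

theorem isLogScale (h : StandardSetup lam θ D f g f0 g0 ψ) (i₀ : Fin d)
    (hr_pos : ∀ n, 0 < r n) (hr_top : Tendsto r atTop atTop)
    (hr : Asymptotics.IsEquivalent atTop (fun n : ℕ => ψ (r n)) (fun n : ℕ => Real.log (n : ℝ))) :
    IsLogScale lam θ (metaComponent f0 g0) r := by
  obtain ⟨fstar, hs⟩ := h.heavy.exists_isRadialTail
  exact ⟨h.f0_density.strictMono_metaComponent h.g0_density,
    h.f0_density.metaComponent_neg h.g0_density h.f0_symm h.g0_symm,
    h.f0_density.tendsto_metaComponent h.g0_density, hr_pos, hr_top, fun s hs' =>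
    tendsto_log_metaComponent h.lam_pos h.heavy.shape h.heavy.density hs h.f0_density
      (h.f0_marginal i₀) h.g0_density h.vonMises h.theta_pos h.psi_varies h.g0_asymp hr_top hr hs'⟩

theorem measure_preimage_metaMap (h : StandardSetup lam θ D f g f0 g0 ψ)
    {S : Set (EuclideanSpace ℝ (Fin d))} (hS : MeasurableSet S) :
    densityMeasure g (metaMap f0 g0 ⁻¹' S) = densityMeasure f S := by
  rw [← h.metaDensity.map_metaMap h.heavy.density h.f0_density h.g0_density,
    Measure.map_apply (h.f0_density.measurable_metaMap h.g0_density) hS]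

theorem measure_scaled_closedBlock (h : StandardSetup lam θ D f g f0 g0 ψ) {ρ : ℝ} (hρ : 0 < ρ)
    (a b : Fin d → ℝ) : densityMeasure g {x | ρ⁻¹ • x ∈ closedBlock a b} =
      densityMeasure f (closedBlock (fun i => metaComponent f0 g0 (ρ * a i))
        fun i => metaComponent f0 g0 (ρ * b i)) := by
  rw [← h.measure_preimage_metaMap (isCompact_closedBlock _ _).measurableSet]
  congr 1
  ext x
  have hK := h.f0_density.strictMono_metaComponent h.g0_density
  refine forall_congr' fun i => and_congr ?_ ?_
  · rw [PiLp.smul_apply, smul_eq_mul, inv_mul_eq_div, le_div_iff₀ hρ, mul_comm]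
    exact hK.le_iff_le.symm
  · rw [PiLp.smul_apply, smul_eq_mul, inv_mul_eq_div, div_le_iff₀ hρ, mul_comm]
    exact hK.le_iff_le.symm

theorem measure_coord_ge_le (h : StandardSetup lam θ D f g f0 g0 ψ) (i : Fin d) (t : ℝ) :
    densityMeasure g {x | t ≤ |x i|} ≤ ENNReal.ofReal (2 * (1 - dfOf g0 t)) := by
  have hK := h.f0_density.strictMono_metaComponent h.g0_density
  have hF := h.f0_density.isProbabilityMeasure
  set T := metaComponent f0 g0 t with hT
  have h1 : {x : EuclideanSpace ℝ (Fin d) | t ≤ |x i|} ⊆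
      metaMap f0 g0 ⁻¹' ((fun z => z i) ⁻¹' (Ici T ∪ Iic (-T))) := by
    intro x hx
    rcases le_abs.1 (show t ≤ |x i| from hx) with h2 | h2
    · exact Or.inl (hK.monotone h2)
    · right
      have := hK.monotone (le_neg_of_le_neg h2)
      rwa [h.f0_density.metaComponent_neg h.g0_density h.f0_symm h.g0_symm] at this
  have hm : MeasurableSet (Ici T ∪ Iic (-T)) := measurableSet_Ici.union measurableSet_Iic
  refine (measure_mono h1).trans ?_
  rw [h.measure_preimage_metaMap ((by fun_prop : Measurable fun z : EuclideanSpace ℝ (Fin d) => z i) hm),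
    ← Measure.map_apply (by fun_prop) hm, h.f0_marginal, ← ofReal_measureReal]
  refine ENNReal.ofReal_le_ofReal ((measureReal_union_le _ _).trans ?_)
  have hf0 := fun x => (h.f0_density.pos x).le
  have hf0m := h.f0_density.continuous.measurable
  rw [densityMeasure_real_apply hf0 hf0m measurableSet_Ici,
    densityMeasure_real_apply hf0 hf0m measurableSet_Iic, integral_Ici_eq_integral_Ioi,
    ← h.f0_density.one_sub_dfOf, ← dfOf, h.f0_density.dfOf_neg h.f0_symm, hT,
    h.f0_density.dfOf_metaComponent h.g0_density]
  linarith

variable {A : ℕ → Set (EuclideanSpace ℝ (Fin d))} {ν : Measure (EuclideanSpace ℝ (Fin d))}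
  [IsProbabilityMeasure ν]

theorem tendsto_scaledMean_zero_of_relative (hA : IsRegularPartition A)
    {μ : Measure (EuclideanSpace ℝ (Fin d))} [IsFiniteMeasure μ]
    (hνμ : Asymptotics.IsEquivalent atTop (fun n => ν.real (A n)) fun n => μ.real (A n))
    (hr : Tendsto r atTop atTop) {S S' : Set (EuclideanSpace ℝ (Fin d))} (hSm : MeasurableSet S)
    (hSm' : MeasurableSet S')
    {δ ρ : ℝ} (hδ : 0 < δ) (hρ : 0 < ρ) (hS : ∀ x ∈ S, ρ ≤ ‖x‖)
    (hSS' : ∀ x ∈ S, ∀ y, ‖y - x‖ ≤ δ * ‖x‖ → y ∈ S')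
    (h : Tendsto (fun n => scaledMean μ (r n) n S') atTop (𝓝 0)) :
    Tendsto (fun n => scaledMean ν (r n) n S) atTop (𝓝 0) := by
  have h1 := hr.eventually (hA.eventually_measure_le (hνμ.eventually_measure_le one_lt_two)
    hδ hρ hS hSS')
  have h2 := ENNReal.Tendsto.const_mul h (Or.inr (ENNReal.ofReal_ne_top (r := 2)))
  rw [mul_zero] at h2
  refine tendsto_of_tendsto_of_tendsto_of_le_of_le' tendsto_const_nhds h2
    (Eventually.of_forall fun n => zero_le) ?_
  filter_upwards [h1] with n hn
  rw [scaledMean_apply hSm, scaledMean_apply hSm', mul_left_comm]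
  gcongr

theorem exists_nhds_tendsto_zero (h : StandardSetup lam θ D f g f0 g0 ψ) (i₀ : Fin d)
    (hK : IsLogScale lam θ (metaComponent f0 g0) r)
    (hA : IsRegularPartition A)
    (hνμ : Asymptotics.IsEquivalent atTop (fun n => ν.real (A n))
      fun n => (densityMeasure g).real (A n))
    {u : EuclideanSpace ℝ (Fin d)} (hu : u ∉ limitSet d lam θ) :
    ∃ V ∈ 𝓝 u, Tendsto (fun n => scaledMean ν (r n) n V) atTop (𝓝 0) := by
  have := h.metaDensity.isProbabilityMeasure h.heavy.density h.f0_density h.g0_density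
  have := h.heavy.density.isProbabilityMeasure
  obtain ⟨fstar, hs⟩ := h.heavy.exists_isRadialTail
  obtain ⟨δ, hδ, hδ0⟩ := ((hK.tendsto_box_zero h.lam_pos h.theta_pos h.heavy.shape h.heavy.density hs
    i₀ hu).and eventually_mem_nhdsWithin).exists
  have hδ0 : 0 < δ := hδ0
  have hu0 : 0 < ‖u‖ := norm_pos_iff.2 fun h0 =>
    hu (h0 ▸ zero_mem_limitSet h.lam_pos h.theta_pos)
  -- The second entry keeps the ball away from the origin, where relative neighbourhoods shrink to
  -- nothing; the first leaves `δ / 2` for the enlargement inside the cube of half-side `δ`.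
  set η := min (δ / 2) (‖u‖ / 2)
  have hη : 0 < η := by positivity
  have hη1 : η ≤ δ / 2 := min_le_left _ _
  have hη2 : η ≤ ‖u‖ / 2 := min_le_right _ _
  refine ⟨Metric.ball u η, Metric.ball_mem_nhds u hη, ?_⟩
  have hnear : ∀ x ∈ Metric.ball u η, ‖u‖ / 2 ≤ ‖x‖ ∧ ‖x‖ ≤ 2 * ‖u‖ := fun x hx => by
    rw [mem_ball_iff_norm] at hx
    have h1 := abs_le.1 (abs_norm_sub_norm_le x u)
    constructor <;> linarith
  refine tendsto_scaledMean_zero_of_relative hA hνμ hK.r_tendsto measurableSet_ball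
    (isCompact_closedBlock (fun i => u i - δ) fun i => u i + δ).measurableSet
    (show 0 < δ / (4 * ‖u‖) by positivity) (half_pos hu0)
    (fun x hx => (hnear x hx).1) ?_ ?_
  · intro x hx y hy i
    have h1 := (hnear x hx).2
    rw [mem_ball_iff_norm] at hx
    have h2 : ‖y - u‖ ≤ ‖y - x‖ + ‖x - u‖ := norm_sub_le_norm_sub_add_norm_sub y x u
    have h3 : δ / (4 * ‖u‖) * ‖x‖ ≤ δ / (4 * ‖u‖) * (2 * ‖u‖) := by gcongr
    have h4 : δ / (4 * ‖u‖) * (2 * ‖u‖) = δ / 2 := by field_simp; norm_num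
    have h5 : |y i - u i| ≤ ‖y - u‖ := PiLp.norm_apply_le (y - u) i
    have h6 := abs_le.1 (h5.trans (show ‖y - u‖ ≤ δ by linarith))
    constructor <;> linarith
  · have h1 := ENNReal.tendsto_ofReal hδ
    rw [ENNReal.ofReal_zero] at h1
    refine h1.congr fun n => ?_
    rw [scaledMean_apply (isCompact_closedBlock _ _).measurableSet,
      h.measure_scaled_closedBlock (hK.r_pos n), ENNReal.ofReal_mul (Nat.cast_nonneg n),
      ENNReal.ofReal_natCast, ofReal_measureReal]

/-- Compactness handles bounded regions only; this handles the rest. With `i` a maximal coordinate,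
`‖x‖ ≤ d * |x i|`, so the enlargement changes `|x i|` by at most a third and ends in `{|y i| ≥ 2}`.
There the mean is at most `2 * n * (1 - G₀ (2 * r n))`, of order `n ^ (1 - 2 ^ θ + o(1))`. -/
theorem tendsto_far_zero (h : StandardSetup lam θ D f g f0 g0 ψ)
    (hr_pos : ∀ n, 0 < r n) (hr_top : Tendsto r atTop atTop)
    (hr : Asymptotics.IsEquivalent atTop (fun n : ℕ => ψ (r n)) (fun n : ℕ => Real.log (n : ℝ)))
    (hA : IsRegularPartition A)
    (hνμ : Asymptotics.IsEquivalent atTop (fun n => ν.real (A n))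
      fun n => (densityMeasure g).real (A n)) (i : Fin d) :
    Tendsto (fun n => scaledMean ν (r n) n {x | 3 ≤ |x i| ∧ ∀ j, |x j| ≤ |x i|}) atTop (𝓝 0) := by
  have := h.metaDensity.isProbabilityMeasure h.heavy.density h.f0_density h.g0_density
  have hd : (0 : ℝ) < d := by exact_mod_cast i.pos
  have hSm : MeasurableSet {x : EuclideanSpace ℝ (Fin d) | 2 ≤ |x i|} :=
    (isClosed_le continuous_const (by fun_prop)).measurableSet
  have hSm' : MeasurableSet {x : EuclideanSpace ℝ (Fin d) | 3 ≤ |x i| ∧ ∀ j, |x j| ≤ |x i|} := by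
    refine IsClosed.measurableSet ?_
    simp only [ofPred_and, ofPred_forall]
    exact (isClosed_le continuous_const (by fun_prop)).inter
      (isClosed_iInter fun j => isClosed_le (by fun_prop) (by fun_prop))
  refine tendsto_scaledMean_zero_of_relative hA hνμ hr_top hSm' hSm
    (show 0 < 1 / (3 * (d : ℝ)) by positivity) (show (0 : ℝ) < 3 by norm_num)
    (fun x hx => hx.1.trans (PiLp.norm_apply_le x i)) ?_ ?_
  · rintro x ⟨hx1, hx2⟩ y hy
    have h1 := norm_le_card_mul hx2
    have h2 : 1 / (3 * (d : ℝ)) * ‖x‖ ≤ 1 / (3 * (d : ℝ)) * (d * |x i|) := by gcongr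
    have h3 : 1 / (3 * (d : ℝ)) * (d * |x i|) = |x i| / 3 := by field_simp
    have h5 : |y i - x i| ≤ ‖y - x‖ := PiLp.norm_apply_le (y - x) i
    have h6 : |x i| - |y i| ≤ |y i - x i| := by
      rw [abs_sub_comm]; exact abs_sub_abs_le_abs_sub _ _
    show 2 ≤ |y i|
    linarith
  · have hr2 : Tendsto (fun n => r n * 2) atTop atTop := hr_top.atTop_mul_const two_pos
    have hln := tendsto_log_natCast_atTop
    have h2 := (h.g0_density.tendsto_log_tail_div h.vonMises h.theta_pos h.psi_varies
      h.g0_asymp).comp hr2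
    have h3 := (h.psi_varies.2 2 two_pos).comp hr_top
    have h4 := (Asymptotics.isEquivalent_iff_tendsto_one
      ((hln.eventually_gt_atTop 0).mono fun n hn => hn.ne')).1 hr
    have h5 := ((h2.mul h3).mul h4).add
      ((hln.const_div_atTop (Real.log 2)).const_add 1)
    have hpos : ∀ n : ℕ, 0 < 1 - dfOf g0 (r n * 2) := fun n => sub_pos.2 (h.g0_density.dfOf_lt_one _)
    have hneg : -1 * (2 : ℝ) ^ θ * 1 + (1 + 0) < 0 := by
      have := Real.one_lt_rpow one_lt_two h.theta_pos
      linarith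
    have h6 : Tendsto (fun n : ℕ => n * (2 * (1 - dfOf g0 (r n * 2)))) atTop (𝓝 0) := by
      refine tendsto_zero_of_log_div_log ?_ hneg (h5.congr' ?_)
      · filter_upwards [eventually_gt_atTop 0] with n hn
        have := hpos n
        positivity
      · filter_upwards [hln.eventually_gt_atTop 0, hr2.eventually h.psi_varies.1,
          hr_top.eventually h.psi_varies.1, eventually_gt_atTop 0] with n hn h7 h8 hn0
        have := hpos n
        rw [Real.log_mul (by positivity) (by positivity), Real.log_mul (by positivity) this.ne']
        simp only [Function.comp, Pi.div_apply]
        rw [mul_comm 2 (r n)]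
        field_simp
        ring
    have h7 := ENNReal.tendsto_ofReal h6
    rw [ENNReal.ofReal_zero] at h7
    refine tendsto_of_tendsto_of_tendsto_of_le_of_le tendsto_const_nhds h7
      (fun n => zero_le) fun n => ?_
    rw [scaledMean_apply hSm, ENNReal.ofReal_mul (Nat.cast_nonneg n), ENNReal.ofReal_natCast]
    refine mul_le_mul_right ?_ _
    refine le_trans (measure_mono fun x hx => ?_) (h.measure_coord_ge_le i (r n * 2))
    have hx' : 2 ≤ |((r n)⁻¹ • x) i| := hx
    rw [PiLp.smul_apply, smul_eq_mul, abs_mul, abs_of_pos (inv_pos.2 (hr_pos n)), inv_mul_eq_div,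
      le_div_iff₀ (hr_pos n)] at hx'
    show r n * 2 ≤ |x i|
    linarith

theorem convergesOnto (h : StandardSetup lam θ D f g f0 g0 ψ) (i₀ : Fin d)
    (hr_pos : ∀ n, 0 < r n) (hr_top : Tendsto r atTop atTop)
    (hr : Asymptotics.IsEquivalent atTop (fun n : ℕ => ψ (r n)) (fun n : ℕ => Real.log (n : ℝ)))
    (hA : IsRegularPartition A)
    (hνμ : Asymptotics.IsEquivalent atTop (fun n => ν.real (A n))
      fun n => (densityMeasure g).real (A n))
    {Ω : Type*} [MeasurableSpace Ω] {P : Measure Ω} [IsProbabilityMeasure P]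
    {X : ℕ → Ω → EuclideanSpace ℝ (Fin d)} (hX : IsSample P X ν) :
    ConvergesOnto P (sampleCloud X r) (limitSet d lam θ) := by
  have := h.metaDensity.isProbabilityMeasure h.heavy.density h.f0_density h.g0_density
  have := h.heavy.density.isProbabilityMeasure
  have hK := h.isLogScale i₀ hr_pos hr_top hr
  refine ⟨isCompact_limitSet h.lam_pos h.theta_pos, fun U hU hEU => ?_, fun p hp ε hε m _ => ?_⟩
  -- Vanishing mean is stable under subsets and finite unions, so on a compact set off the limit set
  -- it follows from the local statement.
  · let Q : Set (EuclideanSpace ℝ (Fin d)) → Prop := fun S =>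
      Tendsto (fun n => scaledMean ν (r n) n S) atTop (𝓝 0)
    have hmono : ∀ S T, S ⊆ T → Q T → Q S := fun S T hST hT =>
      tendsto_of_tendsto_of_tendsto_of_le_of_le tendsto_const_nhds hT (fun n => zero_le)
        fun n => measure_mono hST
    have hunion : ∀ S T, Q S → Q T → Q (S ∪ T) := fun S T hS hT => by
      have := hS.add hT
      rw [add_zero] at this
      exact tendsto_of_tendsto_of_tendsto_of_le_of_le tendsto_const_nhds this (fun n => zero_le)
        fun n => measure_union_le _ _
    have hcpt : Q (closedBlock (fun _ => -3) (fun _ => 3) ∩ Uᶜ) := by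
      refine ((isCompact_closedBlock _ _).inter_right hU.isClosed_compl).induction_on
        (p := Q) (by simp [Q]) hmono hunion fun u hu => ?_
      obtain ⟨V, hV, hV'⟩ := h.exists_nhds_tendsto_zero i₀ hK hA hνμ fun hE => hu.2 (hEU hE)
      exact ⟨V, mem_nhdsWithin_of_mem_nhds hV, hV'⟩
    have hfar : Q (⋃ i : Fin d, {x | 3 ≤ |x i| ∧ ∀ j, |x j| ≤ |x i|}) := by
      have hsum : Tendsto (fun n => ∑ i : Fin d,
          scaledMean ν (r n) n {x | 3 ≤ |x i| ∧ ∀ j, |x j| ≤ |x i|}) atTop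
          (𝓝 (∑ _i : Fin d, 0)) :=
        tendsto_finsetSum _ fun i _ => h.tendsto_far_zero hr_pos hr_top hr hA hνμ i
      rw [Finset.sum_const_zero] at hsum
      exact tendsto_of_tendsto_of_tendsto_of_le_of_le tendsto_const_nhds hsum (fun n => zero_le)
        fun n => measure_iUnion_fintype_le _ _
    have hUc : Q Uᶜ := by
      refine hmono _ _ (fun x hx => ?_) (hunion _ _ hcpt hfar)
      obtain ⟨i, hi⟩ := IsLogScale.exists_abs_eq_norm i₀ x
      rcases le_or_gt 3 (|x i|) with h3 | h3
      · exact Or.inr (mem_iUnion.2 ⟨i, h3, fun j => hi ▸ IsLogScale.abs_le_norm x j⟩)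
      · exact Or.inl ⟨fun j => abs_le.1 ((hi ▸ IsLogScale.abs_le_norm x j : |x j| ≤ |x i|).trans h3.le),
          hx⟩
    exact tendsto_of_tendsto_of_tendsto_of_le_of_le tendsto_const_nhds hUc (fun n => zero_le)
      fun n => hX.measure_sampleCloud_pos_le hU.isClosed_compl.measurableSet n
  · refine hX.tendsto_measure_sampleCloud measurableSet_ball ?_ m
    obtain ⟨u, hup, hu0, hu⟩ := exists_strict_near_of_mem_limitSet h.lam_pos h.theta_pos hp
      (show 0 < ε / 2 by positivity)
    obtain ⟨fstar, hs⟩ := h.heavy.exists_isRadialTail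
    have hd : (0 : ℝ) < d := by exact_mod_cast i₀.pos
    -- `δ < |u i₀|` keeps the cube off the origin. The budget is `ε / 4` for the cube, `ε / 4` for
    -- the relative enlargement and `ε / 2` from `u` to `p`.
    obtain ⟨δ, hδ, hδ0, hδu, hδε⟩ := ((hK.tendsto_box_atTop h.lam_pos h.theta_pos h.heavy.shape
      h.heavy.density hs i₀ hu0 hu).and (eventually_mem_nhdsWithin.and
      (((tendsto_nhdsWithin_of_tendsto_nhds tendsto_id).eventually_lt_const
        (abs_pos.2 (hu0 i₀))).and ((tendsto_nhdsWithin_of_tendsto_nhds tendsto_id).eventually_lt_const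
        (show 0 < ε / (4 * d) by positivity))))).exists
    have hδ0 : 0 < δ := hδ0
    simp only [id] at hδu hδε
    rw [lt_div_iff₀ (by positivity)] at hδε
    have hbox : ∀ x ∈ closedBlock (fun i => u i - δ) (fun i => u i + δ), ‖x - u‖ < ε / 4 := by
      intro x hx
      have h1 : ‖x - u‖ ≤ d * δ := norm_le_card_mul fun i => by
        rw [PiLp.sub_apply, abs_le]
        constructor <;> linarith [(hx i).1, (hx i).2]
      linarith
    have hR : 0 < 4 * (‖u‖ + ε) := by positivity
    have hle := hr_top.eventually (hA.eventually_measure_le (hνμ.symm.eventually_measure_le one_lt_two)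
      (show 0 < ε / (4 * (‖u‖ + ε)) by positivity) (sub_pos.2 hδu)
      (S := closedBlock (fun i => u i - δ) (fun i => u i + δ)) (S' := Metric.ball p ε)
      (fun x hx => by
        have h1 : |x i₀| ≤ ‖x‖ := PiLp.norm_apply_le x i₀
        have h2 : |u i₀ - x i₀| ≤ δ := abs_le.2 ⟨by linarith [(hx i₀).2], by linarith [(hx i₀).1]⟩
        linarith [abs_sub_abs_le_abs_sub (u i₀) (x i₀)])
      (fun x hx y hy => by
        have h1 := hbox x hx
        have h2 : ‖x‖ ≤ ‖u‖ + ε := by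
          have := norm_le_norm_add_norm_sub' x u
          linarith
        have h3 : ε / (4 * (‖u‖ + ε)) * ‖x‖ ≤ ε / (4 * (‖u‖ + ε)) * (‖u‖ + ε) := by gcongr
        have h4 : ε / (4 * (‖u‖ + ε)) * (‖u‖ + ε) = ε / 4 := by field_simp
        rw [mem_ball_iff_norm]
        have h5 := norm_sub_le_norm_sub_add_norm_sub y x p
        have h6 := norm_sub_le_norm_sub_add_norm_sub x u p
        linarith))
    -- The factor `1 / 2` pays for the constant `2` in the comparison of `g`-mass with `ν`-mass.
    refine tendsto_atTop_mono' _ ?_ (hδ.const_mul_atTop (show (0 : ℝ) < 1 / 2 by norm_num))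
    filter_upwards [hle] with n hn
    rw [h.measure_scaled_closedBlock (hr_pos n), ← ofReal_measureReal, ← ofReal_measureReal (μ := ν),
      ← ENNReal.ofReal_mul two_pos.le, ENNReal.ofReal_le_ofReal_iff (by positivity)] at hn
    have hn0 : (0 : ℝ) ≤ n := Nat.cast_nonneg n
    nlinarith

end StandardSetup

/-! ### Convergence to the Poisson point process -/

namespace StandardSetup

variable {d : ℕ} {lam θ : ℝ} {D : Set (EuclideanSpace ℝ (Fin d))}
  {f g : EuclideanSpace ℝ (Fin d) → ℝ} {f0 g0 ψ : ℝ → ℝ} {c : ℕ → ℝ}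
  {B : ℕ → Set (EuclideanSpace ℝ (Fin d))} {ν : Measure (EuclideanSpace ℝ (Fin d))}
  [IsProbabilityMeasure ν]

theorem convergesOffBalls (h : StandardSetup lam θ D f g f0 g0 ψ) (i₀ : Fin d)
    (hc : Tendsto (fun n : ℕ => (n : ℝ) * (1 - dfOf f0 (c n))) atTop
      (𝓝 (∫ w in {w : EuclideanSpace ℝ (Fin d) | 1 ≤ w i₀}, limitIntensity lam D w)))
    (hB : IsRegularPartition B)
    (hνπ : Asymptotics.IsEquivalent atTop (fun n => ν.real (B n))
      fun n => (densityMeasure f).real (B n))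
    {Ω Ω' : Type*} [MeasurableSpace Ω] {P : Measure Ω} [IsProbabilityMeasure P]
    [MeasurableSpace Ω'] {P' : Measure Ω'} [IsProbabilityMeasure P']
    {Z : ℕ → Ω → EuclideanSpace ℝ (Fin d)} (hZ : IsSample P Z ν)
    {N : Ω' → Measure (EuclideanSpace ℝ (Fin d))}
    (hN : IsPoissonProcess P' N (densityMeasure (limitIntensity lam D))) :
    ConvergesOffBalls P (sampleCloud Z c) P' N := by
  have := h.heavy.density.isProbabilityMeasure
  have hD := h.heavy.shape
  obtain ⟨fstar, hs⟩ := h.heavy.exists_isRadialTail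
  have hc_top := h.f0_density.tendsto_atTop_of_mul_tail hc
  have hρ : ∀ ε : ℝ, 0 < ε → densityMeasure (limitIntensity lam D)
      {w : EuclideanSpace ℝ (Fin d) | ε ≤ ‖w‖} ≠ ∞ := fun ε hε => by
    rw [hD.densityMeasure_eq_ofReal h.lam_pos hε
      (isClosed_le continuous_const continuous_norm).measurableSet fun w hw => hw]
    exact ENNReal.ofReal_ne_top
  refine hZ.convergesOffBalls hρ (fun ε hε φ =>
    hB.tendsto_integral_scaledMean hνπ hc_top hρ ?_ ?_ hε φ) hN
  · intro a ha
    have h1 : {w : EuclideanSpace ℝ (Fin d) | ‖w‖ = a} = Metric.sphere 0 a := by ext; simp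
    rw [h1]
    exact (withDensity_absolutelyContinuous _ _) (Measure.addHaar_sphere_of_ne_zero _ _ ha.ne')
  · intro a ha S hS hSa
    have h1 := ENNReal.tendsto_ofReal (hs.tendsto_mul_real h.lam_pos hD h.heavy.density
      h.f0_density (h.f0_marginal i₀) hc_top hc ha hS hSa)
    rw [← hD.densityMeasure_eq_ofReal h.lam_pos ha hS hSa] at h1
    refine h1.congr fun n => ?_
    rw [scaledMean_apply hS, ENNReal.ofReal_mul (Nat.cast_nonneg n), ENNReal.ofReal_natCast,
      ofReal_measureReal]

end StandardSetup

end

/-! ### Equivalence on the atoms and the two limits for sample clouds. -/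

theorem mainTheorem4 {d : ℕ} {lam θ : ℝ} {D : Set (EuclideanSpace ℝ (Fin d))}
    {f g : EuclideanSpace ℝ (Fin d) → ℝ} {f0 g0 ψ : ℝ → ℝ}
    (hsetup : StandardSetup lam θ D f g f0 g0 ψ)
    -- the scaling constants
    {c r : ℕ → ℝ} (hc_pos : ∀ n, 0 < c n) (i₀ : Fin d)
    (hc : Tendsto (fun n : ℕ => (n : ℝ) * (1 - dfOf f0 (c n))) atTop
      (𝓝 (∫ w in {w : EuclideanSpace ℝ (Fin d) | 1 ≤ w i₀}, limitIntensity lam D w)))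
    (hr_pos : ∀ n, 0 < r n) (hr_top : Tendsto r atTop atTop)
    (hr : Asymptotics.IsEquivalent atTop (fun n : ℕ => ψ (r n)) (fun n : ℕ => Real.log (n : ℝ)))
    -- the two partitions, `B n = K (A n)`
    {A B : ℕ → Set (EuclideanSpace ℝ (Fin d))} (hA_block : IsBlockPartition A)
    (hB : ∀ n, B n = metaMap f0 g0 '' A n)
    (hA : IsRegularPartition A) (hB_reg : IsRegularPartition B)
    -- the two probability measures, linked by `K`
    {piT muT : Measure (EuclideanSpace ℝ (Fin d))} [IsProbabilityMeasure piT]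
    [IsProbabilityMeasure muT] (hlink : piT = muT.map (metaMap f0 g0))
    -- independent observations from the two measures
    {ΩZ ΩX : Type*} [MeasurableSpace ΩZ] [MeasurableSpace ΩX]
    {PZ : Measure ΩZ} [IsProbabilityMeasure PZ] {PX : Measure ΩX} [IsProbabilityMeasure PX]
    {Z : ℕ → ΩZ → EuclideanSpace ℝ (Fin d)} {X : ℕ → ΩX → EuclideanSpace ℝ (Fin d)}
    (hZ : IsSample PZ Z piT) (hX : IsSample PX X muT) :
    (Asymptotics.IsEquivalent atTop (fun n => piT.real (B n)) (fun n => ∫ z in B n, f z) ↔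
      Asymptotics.IsEquivalent atTop (fun n => muT.real (A n)) (fun n => ∫ x in A n, g x)) ∧
    ((Asymptotics.IsEquivalent atTop (fun n => piT.real (B n)) (fun n => ∫ z in B n, f z) ∨
      Asymptotics.IsEquivalent atTop (fun n => muT.real (A n)) (fun n => ∫ x in A n, g x)) →
      -- for the Poisson point process `N` with intensity `h`
      (∀ {ΩN : Type*} [MeasurableSpace ΩN] (PN : Measure ΩN) [IsProbabilityMeasure PN]
        (N : ΩN → Measure (EuclideanSpace ℝ (Fin d))),
        IsPoissonProcess PN N (densityMeasure (limitIntensity lam D)) →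
          ConvergesOffBalls PZ (sampleCloud Z c) PN N) ∧
      ConvergesOnto PX (sampleCloud X r) (limitSet d lam θ)) := by
  have hf := hsetup.heavy.density
  have hKm := hsetup.f0_density.measurable_metaMap (d := d) hsetup.g0_density
  have hinj := hsetup.f0_density.injective_metaMap (d := d) hsetup.g0_density
  have hpre : ∀ n, metaMap f0 g0 ⁻¹' B n = A n := fun n => by
    rw [hB, preimage_image_eq _ hinj]
  have hBm := hB_reg.partition.measurable
  have hfB : ∀ n, ∫ z in B n, f z = (densityMeasure f).real (B n) := fun n =>
    (densityMeasure_real_apply (fun z => (hf.pos z).le) hf.continuous.measurable (hBm n)).symm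
  have hgA : ∀ n, ∫ x in A n, g x = (densityMeasure g).real (A n) := fun n =>
    (densityMeasure_real_apply hsetup.metaDensity.nonneg hsetup.metaDensity.measurable
      (hA.partition.measurable n)).symm
  have hgf : ∀ n, (densityMeasure g).real (A n) = (densityMeasure f).real (B n) := fun n => by
    rw [Measure.real, ← hpre, hsetup.measure_preimage_metaMap (hBm n), Measure.real]
  have hpm : ∀ n, muT.real (A n) = piT.real (B n) := fun n => by
    rw [hlink, Measure.real, Measure.real, Measure.map_apply hKm (hBm n), hpre]
  -- The sequences on the two sides coincide term by term, so the equivalence is a rewriting.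
  have hiff : Asymptotics.IsEquivalent atTop (fun n => piT.real (B n)) (fun n => ∫ z in B n, f z) ↔
      Asymptotics.IsEquivalent atTop (fun n => muT.real (A n)) (fun n => ∫ x in A n, g x) := by
    simp_rw [hfB, hgA, hgf, hpm]
  refine ⟨hiff, fun h => ?_⟩
  have h1 := h.elim id hiff.2
  have h2 := h.elim hiff.1 id
  simp_rw [hfB] at h1
  simp_rw [hgA] at h2
  exact ⟨fun PN _ N hN => hsetup.convergesOffBalls i₀ hc hB_reg h1 hZ hN,
    hsetup.convergesOnto i₀ hr_pos hr_top hr hA h2 hX⟩
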